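/- Let $M$ be a closed oriented smooth $n$-manifold with an open book decomposition: a closed (possibly empty) smooth codimension $2$ submanifold $B\subset M$ (the binding) with a tubular neighbourhood $N\cong B\times D^2$, and a smooth locally trivial fibration $\theta\colon M\setminus B\to S^1$ that is given by $(b,z)\mapsto z/|z|$ on $N\setminus B=B\times(D^2\setminus\{0\})$. Its fibres (the pages) are diffeomorphic to the interior of a compact manifold $P$ with $\partial P=B$. Let $f\colon P\to P$ be a monodromy diffeomorphism of the open book, that is, a diffeomorphism equal to the identity near $\partial P$ such that $\theta$ is identified with the mapping torus of $f$, compatibly with the product structure of $N$ near $B$. Suppose that $f$ has finite order as a mapping class: for some $k\ge 1$, $f^k$ is smoothly isotopic to the identity through diffeomorphisms of $P$ that are the identity on a fixed neighbourhood of $\partial P$ (this includes the case $f^k=\mathrm{id}_P$). Then the simplicial volume of $M$ vanishes: $$\|M\|=0,$$ where $\|M\|$ is the $\ell^1$-norm of the fundamental class of $M$, i.e. the infimum of $\sum_i|a_i|$ over all real singular cycles $\sum_i a_i\sigma_i$ representing $[M]\in H_n(M;\mathbb R)$. -/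

import Mathlib

open scoped Manifold ContDiff ENNReal

noncomputable section

/-! ## Real singular chains and the `ℓ¹`-norm -/

/-- Singular `k`-simplices of a topological space `X`. -/
abbrev SingularSimplex (k : ℕ) (X : Type*) [TopologicalSpace X] :=
  C(stdSimplex ℝ (Fin (k + 1)), X)

/-- Singular `k`-chains with real coefficients. -/
abbrev RealSingularChain (k : ℕ) (X : Type*) [TopologicalSpace X] :=
  SingularSimplex k X →₀ ℝ

/-- The `i`-th face of a singular simplex. -/
def SingularSimplex.face {k : ℕ} {X : Type*} [TopologicalSpace X] (i : Fin (k + 2))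
    (σ : SingularSimplex (k + 1) X) : SingularSimplex k X :=
  σ.comp ⟨stdSimplex.map i.succAbove, stdSimplex.continuous_map _⟩

/-- The singular boundary operator `∂ σ = ∑ (-1)^i σ ∘ δ_i`. -/
def RealSingularChain.boundary {k : ℕ} {X : Type*} [TopologicalSpace X] :
    RealSingularChain (k + 1) X →ₗ[ℝ] RealSingularChain k X :=
  Finsupp.linearCombination ℝ fun σ : SingularSimplex (k + 1) X =>
    ∑ i : Fin (k + 2), (-1 : ℝ) ^ (i : ℕ) • Finsupp.single (SingularSimplex.face i σ) (1 : ℝ)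

/-- Singular cycles; every `0`-chain is a cycle. -/
def RealSingularChain.IsCycle {X : Type*} [TopologicalSpace X] :
    {k : ℕ} → RealSingularChain k X → Prop
  | 0, _ => True
  | _ + 1, c => RealSingularChain.boundary c = 0

/-- The `ℓ¹`-norm of a chain: the sum of the absolute values of its coefficients. -/
def RealSingularChain.l1Norm {k : ℕ} {X : Type*} [TopologicalSpace X]
    (c : RealSingularChain k X) : ℝ≥0∞ :=
  ENNReal.ofReal (c.sum fun _ a => |a|)

/-- The chains `c` and `c'` differ by a boundary and a chain lying in `X ∖ {x}`. For cycles relative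
to `X ∖ {x}` this says that they define the same class in `H_k(X, X ∖ {x}; ℝ)`. -/
def RealSingularChain.HomologousAt {k : ℕ} {X : Type*} [TopologicalSpace X] (x : X)
    (c c' : RealSingularChain k X) : Prop :=
  ∃ d : RealSingularChain (k + 1) X,
    ∀ σ ∈ (c - c' - RealSingularChain.boundary d).support, x ∉ Set.range σ

/-! ## Oriented manifolds, fundamental cycles and the simplicial volume -/

/-- An orientation of a smooth `n`-manifold, given by an oriented smooth atlas: smooth charts that
cover `M` and whose transition maps have positive Jacobian determinant. -/
structure SmoothOrientation (n : ℕ) (M : Type*) [TopologicalSpace M]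
    [ChartedSpace (EuclideanSpace ℝ (Fin n)) M] where
  /-- the positively oriented charts -/
  charts : Set (OpenPartialHomeomorph M (EuclideanSpace ℝ (Fin n)))
  charts_subset : charts ⊆ IsManifold.maximalAtlas (𝓡 n) ∞ M
  exists_mem_source : ∀ x : M, ∃ e ∈ charts, x ∈ e.source
  det_pos : ∀ e ∈ charts, ∀ e' ∈ charts, ∀ y ∈ (e.symm.trans e').source,
    0 < (fderiv ℝ (e' ∘ e.symm) y).det

/-- `τ` is a positively oriented small simplex around `x`: read in some positively oriented chart,
it is an affine simplex with vertices `v 0, …, v n`, where `(v 1 - v 0, …, v n - v 0)` is a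
positively oriented basis, and `x` is an interior point of it. Its class in `H_n(M, M ∖ {x})` is
the local orientation generator at `x`. -/
def SmoothOrientation.IsPositiveSimplexAt {n : ℕ} {M : Type*} [TopologicalSpace M]
    [ChartedSpace (EuclideanSpace ℝ (Fin n)) M] (o : SmoothOrientation n M) (x : M)
    (τ : SingularSimplex n M) : Prop :=
  ∃ e ∈ o.charts, ∃ v : Fin (n + 1) → EuclideanSpace ℝ (Fin n),
    0 < (Matrix.of fun i j : Fin n => (v i.succ - v 0) j).det ∧
    (∀ t : stdSimplex ℝ (Fin (n + 1)), τ t ∈ e.source ∧ e (τ t) = ∑ i, t i • v i) ∧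
    ∃ t : stdSimplex ℝ (Fin (n + 1)), (∀ i, 0 < t i) ∧ τ t = x

/-- Real fundamental cycles of an oriented closed `n`-manifold: singular `n`-cycles whose class in
`H_n(M, M ∖ {x}; ℝ)` is, for every `x`, the local generator given by the orientation. -/
def SmoothOrientation.IsFundamentalCycle {n : ℕ} {M : Type*} [TopologicalSpace M]
    [ChartedSpace (EuclideanSpace ℝ (Fin n)) M] (o : SmoothOrientation n M)
    (c : RealSingularChain n M) : Prop :=
  c.IsCycle ∧ ∀ x : M, ∃ τ : SingularSimplex n M, o.IsPositiveSimplexAt x τ ∧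
    RealSingularChain.HomologousAt x c (Finsupp.single τ 1)

/-- The simplicial volume: the `ℓ¹`-norm of the fundamental class, that is, the infimum of the
`ℓ¹`-norms of the real singular cycles representing it. The infimum is taken in `[0, ∞]`, so that
no value could be produced by an absence of fundamental cycles except `∞`. -/
def simplicialVolume {n : ℕ} {M : Type*} [TopologicalSpace M]
    [ChartedSpace (EuclideanSpace ℝ (Fin n)) M] (o : SmoothOrientation n M) : ℝ≥0∞ :=
  ⨅ (c : RealSingularChain n M) (_ : o.IsFundamentalCycle c), c.l1Norm

/-! ## Open books and their monodromy -/

/-- An open book decomposition of the `n`-manifold `M` with binding (diffeomorphic to) `B` and page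
(diffeomorphic to) `P`. Here `P` is the open page, a fibre of `θ`, that is, the interior of the
compact page with boundary `B`.

The dimensions `n - 2` and `n - 1` are never affected by truncation: a local diffeomorphism
`B × D² → M` with `B` nonempty forces `n ≥ 2`, and one from `S¹ × P` with `P` nonempty forces
`n ≥ 1`. -/
structure OpenBook (n : ℕ) (M B P : Type*)
    [TopologicalSpace M] [ChartedSpace (EuclideanSpace ℝ (Fin n)) M]
    [TopologicalSpace B] [ChartedSpace (EuclideanSpace ℝ (Fin (n - 2))) B]
    [TopologicalSpace P] [ChartedSpace (EuclideanSpace ℝ (Fin (n - 1))) P] where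
  /-- the tubular neighbourhood `N = B × D²` of the binding; only its values on the open unit disc
  bundle matter -/
  tube : B × ℂ → M
  tube_isLocalDiffeomorphOn :
    IsLocalDiffeomorphOn ((𝓡 (n - 2)).prod 𝓘(ℝ, ℂ)) (𝓡 n) ∞ tube
      (Set.univ ×ˢ Metric.ball (0 : ℂ) 1)
  tube_injOn : Set.InjOn tube (Set.univ ×ˢ Metric.ball (0 : ℂ) 1)
  /-- the binding is a closed subset of `M` -/
  isClosed_binding : IsClosed (Set.range fun b : B => tube (b, 0))
  /-- the fibration `M ∖ B → S¹`; its values on the binding are irrelevant -/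
  θ : M → Circle
  contMDiffOn_θ : ContMDiffOn (𝓡 n) (𝓡 1) ∞ θ (Set.range fun b : B => tube (b, 0))ᶜ
  /-- `θ` is a smoothly locally trivial fibration on `M ∖ B`, with fibre `P` -/
  locallyTrivial : ∀ c : Circle, ∃ U : Set Circle, IsOpen U ∧ c ∈ U ∧ ∃ T : Circle × P → M,
    IsLocalDiffeomorphOn ((𝓡 1).prod (𝓡 (n - 1))) (𝓡 n) ∞ T (U ×ˢ Set.univ) ∧
    Set.InjOn T (U ×ˢ Set.univ) ∧
    T '' (U ×ˢ Set.univ) = (Set.range fun b : B => tube (b, 0))ᶜ ∩ θ ⁻¹' U ∧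
    ∀ u ∈ U, ∀ x : P, θ (T (u, x)) = u
  /-- on `N ∖ B = B × (D² ∖ {0})` the fibration is `(b, z) ↦ z / |z|` -/
  θ_tube : ∀ (b : B) (z : ℂ), ‖z‖ < 1 → z ≠ 0 → (θ (tube (b, z)) : ℂ) = z / ‖z‖

section Monodromy

variable {n : ℕ} {M B P : Type*}
    [TopologicalSpace M] [ChartedSpace (EuclideanSpace ℝ (Fin n)) M]
    [TopologicalSpace B] [ChartedSpace (EuclideanSpace ℝ (Fin (n - 2))) B]
    [TopologicalSpace P] [ChartedSpace (EuclideanSpace ℝ (Fin (n - 1))) P]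

/-- The binding, as a subset of `M`. -/
def OpenBook.binding (ob : OpenBook n M B P) : Set M := Set.range fun b : B => ob.tube (b, 0)

/-- `f` is a monodromy diffeomorphism of the open book. There is a smooth parametrization
`Φ : P × ℝ → M ∖ B` (the flow of a vector field lifting the rotation of the circle, started on the
page over `1`) that identifies the fibration `θ` with the mapping torus
`P × ℝ / (x, t + 1) ∼ (f x, t)` over `S¹ = ℝ / ℤ` and that, near the binding, is the rotation
`(b, r) ↦ (b, r e^{2πit})` of the tubular neighbourhood `B × D²`. The last condition makes `f` the
identity near the binding. -/
def OpenBook.IsMonodromy (ob : OpenBook n M B P) (f : P ≃ₘ^∞⟮𝓡 (n - 1), 𝓡 (n - 1)⟯ P) : Prop :=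
  ∃ Φ : P × ℝ → M,
    IsLocalDiffeomorph ((𝓡 (n - 1)).prod 𝓘(ℝ, ℝ)) (𝓡 n) ∞ Φ ∧
    Set.range Φ = ob.bindingᶜ ∧
    (∀ x t, ob.θ (Φ (x, t)) = Circle.exp (2 * Real.pi * t)) ∧
    (∀ x y t, Φ (x, t) = Φ (y, t) → x = y) ∧
    (∀ x t, Φ (x, t + 1) = Φ (f x, t)) ∧
    ∃ ε : ℝ, 0 < ε ∧ ε ≤ 1 ∧ ∀ (x : P) (b : B) (r : ℝ), 0 < r → r < ε →
      Φ (x, 0) = ob.tube (b, (r : ℂ)) →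
      ∀ t : ℝ, Φ (x, t) = ob.tube (b, (r : ℂ) * (Circle.exp (2 * Real.pi * t) : ℂ))

end Monodromy

/-- The map `g : P → P` is joined to the identity by a smooth isotopy through diffeomorphisms of `P`
all of which are the identity outside one compact set. When `P` is the interior of a compact
manifold with boundary, these are the diffeomorphisms of the compact manifold that are the identity
near the boundary. -/
def IsCompactlyIsotopicToId {m : ℕ} {P : Type*} [TopologicalSpace P]
    [ChartedSpace (EuclideanSpace ℝ (Fin m)) P] (g : P → P) : Prop :=
  ∃ F : ℝ → (P ≃ₘ^∞⟮𝓡 m, 𝓡 m⟯ P),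
    ContMDiffOn (𝓘(ℝ, ℝ).prod (𝓡 m)) (𝓡 m) ∞ (fun q : ℝ × P => F q.1 q.2)
      (Set.Icc (0 : ℝ) 1 ×ˢ Set.univ) ∧
    (∀ x, F 0 x = x) ∧ (∀ x, F 1 x = g x) ∧
    ∃ K : Set P, IsCompact K ∧ ∀ t ∈ Set.Icc (0 : ℝ) 1, ∀ x ∉ K, F t x = x

/-- `f` has finite order as a mapping class: a positive power of `f` is isotopic to the identity by
an isotopy that is stationary near the boundary of the page. In particular this holds if
`f^k = id` for some `k > 0`. -/
def HasFiniteOrderMappingClass {m : ℕ} {P : Type*} [TopologicalSpace P]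
    [ChartedSpace (EuclideanSpace ℝ (Fin m)) P] (f : P ≃ₘ^∞⟮𝓡 m, 𝓡 m⟯ P) : Prop :=
  ∃ k : ℕ, 0 < k ∧ IsCompactlyIsotopicToId (m := m) (f^[k])

end

/-! A self-map of degree `N ≥ 2` forces the simplicial volume to vanish. If `h` has degree `N` and
`c` is a fundamental cycle, then `N⁻¹ • h_* c` is a fundamental cycle whose norm is at most `N⁻¹`
times that of `c`. Iterating from one fundamental cycle gives norms at most `N⁻ᵐ ‖c‖`, which tend to
`0`.

The self-map comes from the mapping torus with the identification `(x, t + 1) ∼ (f x, t)`. The naive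
map `(x, t) ↦ (x, N t)` sends `(x, t + 1)` to `(f^N x, N t)` and `(f x, t)` to `(f x, N t)`, so the
obstruction to its being well defined is `f^(N-1)`. With `N = k + 1` this is `f^k`, and the isotopy
from `f^k` to the identity, inserted in the page coordinate as `(x, t) ↦ (g t x, N t)`, removes it
(`H_eq_of_Φ_eq`). As the isotopy has compact support, near the binding the map is `(b, r e^{iα}) ↦
(b, r e^{iNα})`, which extends continuously by the identity of the binding (`selfMap_tube`,
`continuous_selfMap`).

The degree is computed over the page at time `0`. The preimages lie at the times `j / N`, `0 ≤ j <
N`. Around these the isotopy is stationary, so the map only stretches time and makes some full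
turns. It is therefore deformed to the inclusion by moving along the lines `t ↦ Φ (x, t)`, and all
`N` local degrees are `1` (`isPositiveAt_selfMap_comp`, `isPositiveAt_push`). Positivity of a cycle
is locally constant, hence spreads to all of `M` (`isPositiveAt_of_forall_Φ`).

The homological input is stated at chain level: `boundariesRel k W` consists of the chains whose
class relative to `W` vanishes. Barycentric subdivision gives `exists_decomposition`. From it follow
the two Mayer–Vietoris statements `HomologyVanishes.union` and `mem_boundariesRel_inter`, and then
the fact that top-dimensional relative classes are determined pointwise
(`mem_boundariesRel_compl_of_isCompact`, `mem_boundariesRel_of_chart`). This gives fundamental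
cycles by gluing (`exists_isFundamentalCycle`). That the local generator does not depend on the
chart is `IsPositiveSimplexAt.homologous`, proved by linearizing the transition maps. -/

/-! ## Functoriality of singular chains -/

namespace RealSingularChain

variable {k m : ℕ} {X Y Z : Type*} [TopologicalSpace X] [TopologicalSpace Y] [TopologicalSpace Z]

/-- The chain map induced by a continuous map. -/
noncomputable def push (g : C(X, Y)) : RealSingularChain k X →ₗ[ℝ] RealSingularChain k Y :=
  Finsupp.lmapDomain ℝ ℝ fun σ : SingularSimplex k X => g.comp σ

@[simp]
theorem push_single (g : C(X, Y)) (σ : SingularSimplex k X) (a : ℝ) :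
    push g (Finsupp.single σ a) = Finsupp.single (g.comp σ) a := by
  simp [push, Finsupp.mapDomain_single]

theorem boundary_single (σ : SingularSimplex (k + 1) X) (a : ℝ) :
    boundary (Finsupp.single σ a) = ∑ i : Fin (k + 2),
      (-1 : ℝ) ^ (i : ℕ) • Finsupp.single (SingularSimplex.face i σ) a := by
  simp [boundary, Finset.smul_sum, mul_comm]

theorem push_comp_apply (g : C(Y, Z)) (h : C(X, Y)) (c : RealSingularChain k X) :
    push (g.comp h) c = push g (push h c) := by
  induction c using Finsupp.induction_linear with
  | zero => simp
  | add a b ha hb => simp [ha, hb]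
  | single σ a => simp [ContinuousMap.comp_assoc]

theorem push_id_apply (c : RealSingularChain k X) : push (ContinuousMap.id X) c = c := by
  induction c using Finsupp.induction_linear with
  | zero => simp
  | add a b ha hb => simp [ha, hb]
  | single σ a => simp

theorem push_boundary (g : C(X, Y)) (c : RealSingularChain (k + 1) X) :
    push g (boundary c) = boundary (push g c) := by
  induction c using Finsupp.induction_linear with
  | zero => simp
  | add a b ha hb => simp [ha, hb]
  | single σ a =>
    simp only [push_single, boundary_single, map_sum, map_smul, SingularSimplex.face,
      ContinuousMap.comp_assoc]

end RealSingularChain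

/-! ## Chains of ordered simplices on a set of vertices -/

/-- Real chains of ordered `k`-simplices with vertices in `S`. -/
abbrev TupleChain (k : ℕ) (S : Type*) := (Fin (k + 1) → S) →₀ ℝ

namespace TupleChain

variable {k : ℕ} {S T : Type*}

/-- The simplicial boundary. -/
noncomputable def boundary : TupleChain (k + 1) S →ₗ[ℝ] TupleChain k S :=
  Finsupp.linearCombination ℝ fun v : Fin (k + 2) → S =>
    ∑ i : Fin (k + 2), (-1 : ℝ) ^ (i : ℕ) • Finsupp.single (v ∘ i.succAbove) (1 : ℝ)

theorem boundary_single (v : Fin (k + 2) → S) (a : ℝ) :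
    boundary (Finsupp.single v a) = ∑ i : Fin (k + 2),
      (-1 : ℝ) ^ (i : ℕ) • Finsupp.single (v ∘ i.succAbove) a := by
  simp [boundary, Finset.smul_sum, mul_comm]

/-- The map induced on ordered chains by a map of vertices. -/
noncomputable def map (g : S → T) : TupleChain k S →ₗ[ℝ] TupleChain k T :=
  Finsupp.lmapDomain ℝ ℝ fun v => g ∘ v

@[simp]
theorem map_single (g : S → T) (v : Fin (k + 1) → S) (a : ℝ) :
    map g (Finsupp.single v a) = Finsupp.single (g ∘ v) a := by
  simp [map, Finsupp.mapDomain_single]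

theorem map_boundary (g : S → T) (c : TupleChain (k + 1) S) :
    map g (boundary c) = boundary (map g c) := by
  induction c using Finsupp.induction_linear with
  | zero => simp
  | add a b ha hb => simp [ha, hb]
  | single v a =>
    simp only [map_single, boundary_single, map_sum, map_smul, Function.comp_assoc]

/-- The cone with apex `b`. -/
noncomputable def cone (b : S) : TupleChain k S →ₗ[ℝ] TupleChain (k + 1) S :=
  Finsupp.lmapDomain ℝ ℝ fun v => Matrix.vecCons b v

@[simp]
theorem cone_single (b : S) (v : Fin (k + 1) → S) (a : ℝ) :
    cone b (Finsupp.single v a) = Finsupp.single (Matrix.vecCons b v : Fin (k + 2) → S) a := by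
  simp [cone, Finsupp.mapDomain_single]

theorem map_cone (g : S → T) (b : S) (c : TupleChain k S) :
    map g (cone b c) = cone (g b) (map g c) := by
  induction c using Finsupp.induction_linear with
  | zero => simp
  | add a b ha hb => simp [ha, hb]
  | single v a =>
    simp only [cone_single, map_single]
    congr 1
    ext i
    refine Fin.cases ?_ (fun j => ?_) i <;> simp

theorem vecCons_comp_zero_succAbove (b : S) (v : Fin (k + 1) → S) :
    (Matrix.vecCons b v : Fin (k + 2) → S) ∘ (0 : Fin (k + 2)).succAbove = v := by
  ext i
  simp

theorem vecCons_comp_succ_succAbove (b : S) (v : Fin (k + 2) → S) (i : Fin (k + 2)) :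
    (Matrix.vecCons b v : Fin (k + 3) → S) ∘ i.succ.succAbove =
      Matrix.vecCons b (v ∘ i.succAbove) := by
  ext j
  refine Fin.cases ?_ (fun j => ?_) j <;> simp

/-- Face `0` of a cone is its base and the other faces are the cones over the faces of the base. All
chain homotopies on ordered simplices below are cones over cycles, and this identity is what
verifies them. -/
theorem boundary_cone (b : S) (c : TupleChain (k + 1) S) :
    boundary (cone b c) = c - cone b (boundary c) := by
  induction c using Finsupp.induction_linear with
  | zero => simp
  | add x y hx hy => simp only [map_add, hx, hy]; abel
  | single v a =>
    rw [cone_single, boundary_single, boundary_single, Fin.sum_univ_succ]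
    simp only [vecCons_comp_succ_succAbove, vecCons_comp_zero_succAbove, map_sum, map_smul,
      cone_single, Fin.val_succ, pow_succ, Fin.val_zero, pow_zero, one_smul]
    simp [sub_eq_add_neg]

/-- The coefficient sum of a `0`-chain. -/
noncomputable def augmentation : TupleChain 0 S →ₗ[ℝ] ℝ :=
  Finsupp.linearCombination ℝ fun _ => 1

theorem boundary_cone_zero (b : S) (c : TupleChain 0 S) :
    boundary (cone b c) = c - Finsupp.single (fun _ => b) (augmentation c) := by
  induction c using Finsupp.induction_linear with
  | zero => simp
  | add x y hx hy => simp only [map_add, hx, hy, Finsupp.single_add]; abel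
  | single v a =>
    have h : (Matrix.vecCons b v : Fin 2 → S) ∘ (Fin.succAbove 1) = fun _ => b := by
      ext i
      fin_cases i
      rfl
    rw [cone_single, boundary_single, Fin.sum_univ_two, vecCons_comp_zero_succAbove, h]
    simp [augmentation, sub_eq_add_neg]

theorem augmentation_boundary (c : TupleChain 1 S) : augmentation (boundary c) = 0 := by
  induction c using Finsupp.induction_linear with
  | zero => simp
  | add x y hx hy => simp [hx, hy]
  | single v a =>
    simp only [boundary_single, map_sum, map_smul, augmentation,
      Finsupp.linearCombination_single]
    simp

/-- Every ordered simplex is the cone from its first vertex over the rest, so the cone formula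
reduces the claim to one degree less. -/
theorem boundary_boundary : ∀ {k : ℕ} (c : TupleChain (k + 2) S), boundary (boundary c) = 0 := by
  have key : ∀ {k : ℕ} (v : Fin (k + 3) → S) (a : ℝ), Finsupp.single v a =
      cone (v 0) (Finsupp.single (Matrix.vecTail v) a) := by
    intro k v a
    rw [cone_single]
    congr 1
    exact (Matrix.cons_head_tail v).symm
  intro k
  induction k with
  | zero =>
    intro c
    induction c using Finsupp.induction_linear with
    | zero => simp
    | add x y hx hy => simp [hx, hy]
    | single v a =>
      rw [key, boundary_cone, map_sub, boundary_cone_zero, augmentation_boundary]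
      simp
  | succ k ih =>
    intro c
    induction c using Finsupp.induction_linear with
    | zero => simp
    | add x y hx hy => simp [hx, hy]
    | single v a =>
      rw [key, boundary_cone, map_sub, boundary_cone, ih]
      simp

/-! ### Barycentric subdivision and chain homotopies -/

/-- The subdivision operator defined by a choice of a centre of each ordered simplex. -/
noncomputable def sd (β : ∀ k, (Fin (k + 1) → S) → S) : ∀ k, TupleChain k S →ₗ[ℝ] TupleChain k S
  | 0 => LinearMap.id
  | k + 1 => Finsupp.linearCombination ℝ fun v : Fin (k + 2) → S =>
      cone (β (k + 1) v) (sd β k (boundary (Finsupp.single v 1)))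

theorem sd_single (β : ∀ k, (Fin (k + 1) → S) → S) (v : Fin (k + 2) → S) :
    sd β (k + 1) (Finsupp.single v 1) =
      cone (β (k + 1) v) (sd β k (boundary (Finsupp.single v 1))) := by
  simp [sd]

/-- Two linear maps that agree on ordered simplices agree. -/
theorem hom_ext {V : Type*} [AddCommGroup V] [Module ℝ V] {f g : TupleChain k S →ₗ[ℝ] V}
    (h : ∀ v, f (Finsupp.single v 1) = g (Finsupp.single v 1)) (c : TupleChain k S) :
    f c = g c :=
  congrArg (fun l : TupleChain k S →ₗ[ℝ] V => l c) (Finsupp.lhom_ext' fun v =>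
    LinearMap.ext_ring (h v))

theorem boundary_sd (β : ∀ k, (Fin (k + 1) → S) → S) :
    ∀ {k : ℕ} (c : TupleChain (k + 1) S), boundary (sd β (k + 1) c) = sd β k (boundary c) := by
  intro k
  induction k with
  | zero =>
    refine hom_ext (f := boundary ∘ₗ sd β 1) (g := sd β 0 ∘ₗ boundary) fun v => ?_
    simp only [LinearMap.comp_apply, sd_single]
    rw [boundary_cone_zero]
    simp [sd, augmentation_boundary]
  | succ k ih =>
    refine hom_ext (f := boundary ∘ₗ sd β (k + 2)) (g := sd β (k + 1) ∘ₗ boundary) fun v => ?_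
    simp only [LinearMap.comp_apply, sd_single]
    rw [boundary_cone, ih, boundary_boundary]
    simp

/-- Applied to the inclusions of faces, this naturality makes subdivision compatible with boundaries
of singular simplices. -/
theorem map_sd {β : ∀ k, (Fin (k + 1) → S) → S} {β' : ∀ k, (Fin (k + 1) → T) → T} (g : S → T)
    (hg : ∀ k v, g (β k v) = β' k (g ∘ v)) :
    ∀ {k : ℕ} (c : TupleChain k S), map g (sd β k c) = sd β' k (map g c) := by
  intro k
  induction k with
  | zero => intro c; rfl
  | succ k ih =>
    refine hom_ext (f := map g ∘ₗ sd β (k + 1)) (g := sd β' (k + 1) ∘ₗ map g) fun v => ?_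
    simp only [LinearMap.comp_apply, sd_single, map_single]
    rw [map_cone, ih, map_boundary, hg, map_single]

/-- The chain homotopy between the subdivision and the identity. -/
noncomputable def sdHomotopy (β : ∀ k, (Fin (k + 1) → S) → S) :
    ∀ k, TupleChain k S →ₗ[ℝ] TupleChain (k + 1) S
  | 0 => 0
  | k + 1 => Finsupp.linearCombination ℝ fun v : Fin (k + 2) → S =>
      cone (v 0) (Finsupp.single v 1 - sd β (k + 1) (Finsupp.single v 1) -
        sdHomotopy β k (boundary (Finsupp.single v 1)))

theorem sdHomotopy_single (β : ∀ k, (Fin (k + 1) → S) → S) (v : Fin (k + 2) → S) :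
    sdHomotopy β (k + 1) (Finsupp.single v 1) =
      cone (v 0) (Finsupp.single v 1 - sd β (k + 1) (Finsupp.single v 1) -
        sdHomotopy β k (boundary (Finsupp.single v 1))) := by
  simp [sdHomotopy]

/-- By induction the chain being coned off is a cycle, so the correction term of the cone formula
vanishes. `boundary_prism` follows the same pattern. -/
theorem boundary_sdHomotopy (β : ∀ k, (Fin (k + 1) → S) → S) :
    ∀ {k : ℕ} (c : TupleChain (k + 1) S), boundary (sdHomotopy β (k + 1) c) =
      c - sd β (k + 1) c - sdHomotopy β k (boundary c) := by
  intro k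
  induction k with
  | zero =>
    refine hom_ext (f := boundary ∘ₗ sdHomotopy β 1)
      (g := LinearMap.id - sd β 1 - sdHomotopy β 0 ∘ₗ boundary) fun v => ?_
    simp only [LinearMap.comp_apply, sdHomotopy_single, LinearMap.sub_apply, LinearMap.id_apply]
    rw [boundary_cone]
    simp only [map_sub, boundary_sd]
    simp [sd, sdHomotopy]
  | succ k ih =>
    refine hom_ext (f := boundary ∘ₗ sdHomotopy β (k + 2))
      (g := LinearMap.id - sd β (k + 2) - sdHomotopy β (k + 1) ∘ₗ boundary) fun v => ?_
    simp only [LinearMap.comp_apply, sdHomotopy_single, LinearMap.sub_apply, LinearMap.id_apply]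
    rw [boundary_cone]
    simp only [map_sub, boundary_sd, ih, boundary_boundary]
    simp

theorem map_sdHomotopy {β : ∀ k, (Fin (k + 1) → S) → S} {β' : ∀ k, (Fin (k + 1) → T) → T}
    (g : S → T) (hg : ∀ k v, g (β k v) = β' k (g ∘ v)) :
    ∀ {k : ℕ} (c : TupleChain k S), map g (sdHomotopy β k c) = sdHomotopy β' k (map g c) := by
  intro k
  induction k with
  | zero => intro c; simp [sdHomotopy]
  | succ k ih =>
    refine hom_ext (f := map g ∘ₗ sdHomotopy β (k + 1)) (g := sdHomotopy β' (k + 1) ∘ₗ map g)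
      fun v => ?_
    simp only [LinearMap.comp_apply, sdHomotopy_single, map_single]
    simp only [map_cone, map_sub, ih, map_boundary, map_sd g hg, map_single]
    rfl

/-- The chain homotopy between the maps induced by two maps of vertices. -/
noncomputable def prism (i₀ i₁ : S → T) : ∀ k, TupleChain k S →ₗ[ℝ] TupleChain (k + 1) T
  | 0 => Finsupp.linearCombination ℝ fun v : Fin 1 → S =>
      cone (i₀ (v 0)) (Finsupp.single (i₁ ∘ v) 1 - Finsupp.single (i₀ ∘ v) 1)
  | k + 1 => Finsupp.linearCombination ℝ fun v : Fin (k + 2) → S =>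
      cone (i₀ (v 0)) (Finsupp.single (i₁ ∘ v) 1 - Finsupp.single (i₀ ∘ v) 1 -
        prism i₀ i₁ k (boundary (Finsupp.single v 1)))

theorem prism_single (i₀ i₁ : S → T) (v : Fin (k + 2) → S) :
    prism i₀ i₁ (k + 1) (Finsupp.single v 1) =
      cone (i₀ (v 0)) (Finsupp.single (i₁ ∘ v) 1 - Finsupp.single (i₀ ∘ v) 1 -
        prism i₀ i₁ k (boundary (Finsupp.single v 1))) := by
  simp [prism]

theorem boundary_prism_zero (i₀ i₁ : S → T) (c : TupleChain 0 S) :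
    boundary (prism i₀ i₁ 0 c) = map i₁ c - map i₀ c := by
  refine hom_ext (f := boundary ∘ₗ prism i₀ i₁ 0) (g := map i₁ - map i₀) (fun v => ?_) c
  simp only [LinearMap.comp_apply, LinearMap.sub_apply, map_single, prism,
    Finsupp.linearCombination_single, one_smul]
  rw [boundary_cone_zero]
  simp [augmentation]

theorem boundary_prism (i₀ i₁ : S → T) :
    ∀ {k : ℕ} (c : TupleChain (k + 1) S), boundary (prism i₀ i₁ (k + 1) c) =
      map i₁ c - map i₀ c - prism i₀ i₁ k (boundary c) := by
  intro k
  induction k with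
  | zero =>
    refine hom_ext (f := boundary ∘ₗ prism i₀ i₁ 1)
      (g := map i₁ - map i₀ - prism i₀ i₁ 0 ∘ₗ boundary) fun v => ?_
    simp only [LinearMap.comp_apply, prism_single, LinearMap.sub_apply, ← map_single]
    rw [boundary_cone]
    simp only [map_sub, boundary_prism_zero, map_boundary]
    simp
  | succ k ih =>
    refine hom_ext (f := boundary ∘ₗ prism i₀ i₁ (k + 2))
      (g := map i₁ - map i₀ - prism i₀ i₁ (k + 1) ∘ₗ boundary) fun v => ?_
    simp only [LinearMap.comp_apply, prism_single, LinearMap.sub_apply, ← map_single]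
    rw [boundary_cone]
    simp only [map_sub, ih, map_boundary, boundary_boundary]
    simp

theorem map_prism {S' T' : Type*} {i₀ i₁ : S → T} {i₀' i₁' : S' → T'} (g : S → S') (h : T → T')
    (h₀ : ∀ s, h (i₀ s) = i₀' (g s)) (h₁ : ∀ s, h (i₁ s) = i₁' (g s)) :
    ∀ {k : ℕ} (c : TupleChain k S), map h (prism i₀ i₁ k c) = prism i₀' i₁' k (map g c) := by
  have e₀ : h ∘ i₀ = i₀' ∘ g := funext h₀
  have e₁ : h ∘ i₁ = i₁' ∘ g := funext h₁
  intro k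
  induction k with
  | zero =>
    refine hom_ext (f := map h ∘ₗ prism i₀ i₁ 0) (g := prism i₀' i₁' 0 ∘ₗ map g) fun v => ?_
    simp only [LinearMap.comp_apply, map_single, prism,
      Finsupp.linearCombination_single, one_smul]
    simp only [map_cone, map_sub, map_single, ← Function.comp_assoc, e₀, e₁, h₀]
    rfl
  | succ k ih =>
    refine hom_ext (f := map h ∘ₗ prism i₀ i₁ (k + 1)) (g := prism i₀' i₁' (k + 1) ∘ₗ map g)
      fun v => ?_
    simp only [LinearMap.comp_apply, map_single, prism_single]
    simp only [map_cone, map_sub, ih, map_boundary, map_single, ← Function.comp_assoc, e₀, e₁, h₀]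
    rfl

end TupleChain

/-! ## Affine simplices in standard simplices -/

/-- The affine map between standard simplices with prescribed values at the vertices. -/
noncomputable def stdSimplex.affine {k m : ℕ} (w : Fin (m + 1) → stdSimplex ℝ (Fin (k + 1))) :
    C(stdSimplex ℝ (Fin (m + 1)), stdSimplex ℝ (Fin (k + 1))) where
  toFun t := ⟨fun l => ∑ i, t i * w i l, fun l => Finset.sum_nonneg fun i _ =>
      mul_nonneg (t.2.1 i) ((w i).2.1 l), by
    rw [Finset.sum_comm]
    simp_rw [← Finset.mul_sum, stdSimplex.sum_eq_one, mul_one, stdSimplex.sum_eq_one]⟩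
  continuous_toFun := by
    refine Continuous.subtype_mk (continuous_pi fun l => continuous_finsetSum _ fun i _ => ?_) _
    exact ((continuous_apply i).comp continuous_subtype_val).mul continuous_const

namespace stdSimplex

variable {k m l : ℕ}

theorem affine_apply (w : Fin (m + 1) → stdSimplex ℝ (Fin (k + 1))) (t : stdSimplex ℝ (Fin (m + 1)))
    (j : Fin (k + 1)) : affine w t j = ∑ i, t i * w i j := rfl

theorem sum_map_mul {k m : ℕ} (f : Fin (k + 1) → Fin (m + 1)) (s : stdSimplex ℝ (Fin (k + 1)))
    (a : Fin (m + 1) → ℝ) : ∑ j, stdSimplex.map f s j * a j = ∑ i, s i * a (f i) := by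
  simp only [map_coe, FunOnFinite.linearMap_apply_apply, Finset.sum_mul]
  rw [← Finset.sum_fiberwise Finset.univ f]
  refine Finset.sum_congr rfl fun j _ => Finset.sum_congr rfl fun i hi => ?_
  rw [(Finset.mem_filter.1 hi).2]

theorem affine_vertex : affine (fun i : Fin (k + 1) => vertex (S := ℝ) i) = ContinuousMap.id _ := by
  ext t j
  simp [affine_apply, Pi.single_apply]

theorem affine_const (p : stdSimplex ℝ (Fin (k + 1))) (t : stdSimplex ℝ (Fin (m + 1))) :
    affine (fun _ => p) t = p := by
  ext j
  rw [affine_apply, ← Finset.sum_mul, sum_eq_one, one_mul]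

theorem affine_map (w : Fin (m + 1) → stdSimplex ℝ (Fin (k + 1))) (f : Fin (l + 1) → Fin (m + 1))
    (t : stdSimplex ℝ (Fin (l + 1))) : affine w (map f t) = affine (w ∘ f) t := by
  ext j
  exact sum_map_mul f t fun i => w i j

theorem map_affine (w : Fin (m + 1) → stdSimplex ℝ (Fin (k + 1))) (f : Fin (k + 1) → Fin (l + 1))
    (t : stdSimplex ℝ (Fin (m + 1))) : map f (affine w t) = affine (map f ∘ w) t := by
  ext j
  simp only [map_coe, FunOnFinite.linearMap_apply_apply, affine_apply, Function.comp_apply,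
    Finset.mul_sum]
  rw [Finset.sum_comm]
  exact Finset.sum_congr rfl fun y _ => rfl

theorem vertex_comp_succAbove (i : Fin (k + 2)) :
    (fun j : Fin (k + 2) => vertex (S := ℝ) j) ∘ i.succAbove =
      map i.succAbove ∘ fun j : Fin (k + 1) => vertex (S := ℝ) j := by
  ext j : 1
  simp

/-- The centre of an ordered simplex. -/
noncomputable def centre (k : ℕ) (m : ℕ) (w : Fin (m + 1) → stdSimplex ℝ (Fin (k + 1))) :
    stdSimplex ℝ (Fin (k + 1)) :=
  affine w barycenter

theorem map_centre (f : Fin (k + 1) → Fin (l + 1)) (m : ℕ)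
    (w : Fin (m + 1) → stdSimplex ℝ (Fin (k + 1))) :
    map f (centre k m w) = centre l m (map f ∘ w) :=
  map_affine w f _

/-! ### The `ℓ¹`-distance on standard simplices -/

/-- The `ℓ¹`-distance. -/
noncomputable def distOne (s t : stdSimplex ℝ (Fin (k + 1))) : ℝ := ∑ i, |s i - t i|

theorem distOne_comm (s t : stdSimplex ℝ (Fin (k + 1))) : distOne s t = distOne t s :=
  Finset.sum_congr rfl fun _ _ => abs_sub_comm _ _

theorem distOne_nonneg (s t : stdSimplex ℝ (Fin (k + 1))) : 0 ≤ distOne s t :=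
  Finset.sum_nonneg fun _ _ => abs_nonneg _

theorem distOne_self (s : stdSimplex ℝ (Fin (k + 1))) : distOne s s = 0 := by simp [distOne]

theorem distOne_le_two (s t : stdSimplex ℝ (Fin (k + 1))) : distOne s t ≤ 2 := by
  calc distOne s t ≤ ∑ i, (s i + t i) := Finset.sum_le_sum fun i _ => by
        have h₁ := s.2.1 i
        have h₂ := t.2.1 i
        rw [abs_le]
        constructor <;> linarith [show (0 : ℝ) ≤ s i from h₁, show (0 : ℝ) ≤ t i from h₂]
    _ = 2 := by rw [Finset.sum_add_distrib, sum_eq_one, sum_eq_one]; norm_num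

theorem dist_le_distOne (s t : stdSimplex ℝ (Fin (k + 1))) : dist s t ≤ distOne s t := by
  rw [Subtype.dist_eq]
  refine (dist_pi_le_iff (distOne_nonneg s t)).2 fun i => ?_
  rw [Real.dist_eq]
  exact Finset.single_le_sum (f := fun i => |s i - t i|) (fun _ _ => abs_nonneg _)
    (Finset.mem_univ i)

theorem distOne_map_le (f : Fin (k + 1) → Fin (l + 1)) (s t : stdSimplex ℝ (Fin (k + 1))) :
    distOne (map f s) (map f t) ≤ distOne s t := by
  unfold distOne
  simp only [map_coe, FunOnFinite.linearMap_apply_apply, ← Finset.sum_sub_distrib]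
  rw [← Finset.sum_fiberwise Finset.univ f]
  exact Finset.sum_le_sum fun j _ => Finset.abs_sum_le_sum_abs _ _

/-- Since `|a - b| = a + b - 2 min a b`, the distance is `2 - 2 ∑ min (1/(k+1)) (s i)`. Some
coordinate of `s` is at least the average `1/(k+1)`, so the sum of the minima is at least `1/(k+1)`.
-/
theorem distOne_barycenter_le (s : stdSimplex ℝ (Fin (k + 1))) :
    distOne barycenter s ≤ 2 * (k / (k + 1) : ℝ) := by
  have hb : ∀ i, (barycenter : stdSimplex ℝ (Fin (k + 1))) i = (k + 1 : ℝ)⁻¹ := fun i => by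
    change (Fintype.card (Fin (k + 1)) : ℝ)⁻¹ = _
    simp
  have hk : (0 : ℝ) < k + 1 := by positivity
  obtain ⟨i₀, hi₀⟩ : ∃ i, (k + 1 : ℝ)⁻¹ ≤ s i := by
    by_contra! h
    have : ∑ i, s i < ∑ _i : Fin (k + 1), (k + 1 : ℝ)⁻¹ :=
      Finset.sum_lt_sum_of_nonempty Finset.univ_nonempty fun i _ => h i
    rw [sum_eq_one] at this
    simp [hk.ne'] at this
  have hmin : (k + 1 : ℝ)⁻¹ ≤ ∑ i, min (k + 1 : ℝ)⁻¹ (s i) := by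
    refine le_trans (le_of_eq (min_eq_left hi₀).symm)
      (Finset.single_le_sum (f := fun i => min (k + 1 : ℝ)⁻¹ (s i)) (fun i _ => ?_)
        (Finset.mem_univ i₀))
    exact le_min (by positivity) (s.2.1 i)
  have hsum : distOne barycenter s = 2 - 2 * ∑ i, min (k + 1 : ℝ)⁻¹ (s i) := by
    have : ∀ i, |(barycenter : stdSimplex ℝ (Fin (k + 1))) i - s i| =
        (barycenter : stdSimplex ℝ (Fin (k + 1))) i + s i - 2 * min (k + 1 : ℝ)⁻¹ (s i) := by
      intro i
      rw [hb]
      rcases le_total (k + 1 : ℝ)⁻¹ (s i) with h | h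
      · rw [min_eq_left h, abs_of_nonpos (by linarith)]; ring
      · rw [min_eq_right h, abs_of_nonneg (by linarith)]; ring
    unfold distOne
    rw [Finset.sum_congr rfl fun i _ => this i, Finset.sum_sub_distrib, Finset.sum_add_distrib,
      sum_eq_one, sum_eq_one, ← Finset.mul_sum]
    ring
  have : 2 * (k / (k + 1) : ℝ) = 2 - 2 * (k + 1 : ℝ)⁻¹ := by field_simp; ring
  rw [hsum, this]
  linarith

/-- The positive and negative parts `p`, `q` of `s - t` have equal mass `μ`, half the distance of
`s` and `t`. Transporting `p` to `q` by the product coupling writes `μ` times the difference of the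
images as `∑ p i q j (w i - w j)`. The factor `2` in the hypothesis is the distance between two
vertices of a standard simplex. -/
theorem distOne_affine_le (w : Fin (m + 1) → stdSimplex ℝ (Fin (k + 1))) {r : ℝ}
    (hw : ∀ i j, distOne (w i) (w j) ≤ 2 * r) (s t : stdSimplex ℝ (Fin (m + 1))) :
    distOne (affine w s) (affine w t) ≤ r * distOne s t := by
  set p : Fin (m + 1) → ℝ := fun i => max (s i - t i) 0 with hp
  set q : Fin (m + 1) → ℝ := fun i => max (t i - s i) 0 with hq
  have hp0 : ∀ i, 0 ≤ p i := fun i => le_max_right _ _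
  have hq0 : ∀ i, 0 ≤ q i := fun i => le_max_right _ _
  have hpq : ∀ i, p i - q i = s i - t i := fun i => by
    simp only [hp, hq]
    rcases le_total (s i) (t i) with h | h
    · rw [max_eq_right (by linarith), max_eq_left (by linarith)]; ring
    · rw [max_eq_left (by linarith), max_eq_right (by linarith)]; ring
  have hpq' : ∀ i, p i + q i = |s i - t i| := fun i => by
    simp only [hp, hq]
    rcases le_total (s i) (t i) with h | h
    · rw [max_eq_right (by linarith), max_eq_left (by linarith), abs_of_nonpos (by linarith)]; ring
    · rw [max_eq_left (by linarith), max_eq_right (by linarith), abs_of_nonneg (by linarith)]; ring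
  have hsum : ∑ i, p i = ∑ i, q i := by
    rw [← sub_eq_zero, ← Finset.sum_sub_distrib, Finset.sum_congr rfl fun i _ => hpq i,
      Finset.sum_sub_distrib, sum_eq_one, sum_eq_one, sub_self]
  set μ := ∑ i, p i with hμ
  have hd : distOne s t = 2 * μ := by
    unfold distOne
    rw [← Finset.sum_congr rfl fun i _ => hpq' i, Finset.sum_add_distrib, ← hsum]
    ring
  have hμ0 : 0 ≤ μ := Finset.sum_nonneg fun i _ => hp0 i
  rcases hμ0.eq_or_lt with h0 | h0
  · have hst : s = t := by
      ext i
      have : distOne s t = 0 := by rw [hd, ← h0, mul_zero]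
      have := (Finset.sum_eq_zero_iff_of_nonneg fun i _ => abs_nonneg _).1 this i
        (Finset.mem_univ i)
      exact sub_eq_zero.1 (abs_eq_zero.1 this)
    rw [hst, distOne_self, distOne_self, mul_zero]
  · have hdiff : ∀ l, μ * (affine w s l - affine w t l) =
        ∑ i, ∑ j, p i * q j * (w i l - w j l) := by
      intro l
      have e₁ : affine w s l - affine w t l = ∑ i, p i * w i l - ∑ i, q i * w i l := by
        rw [affine_apply, affine_apply, ← Finset.sum_sub_distrib, ← Finset.sum_sub_distrib]
        exact Finset.sum_congr rfl fun i _ => by rw [← sub_mul, ← sub_mul, hpq]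
      have e₂ : ∑ i, ∑ j, p i * q j * (w i l - w j l) =
          (∑ i, p i * w i l) * ∑ j, q j - (∑ i, p i) * ∑ j, q j * w j l := by
        rw [Finset.sum_mul_sum, Finset.sum_mul_sum, ← Finset.sum_sub_distrib]
        refine Finset.sum_congr rfl fun i _ => ?_
        rw [← Finset.sum_sub_distrib]
        exact Finset.sum_congr rfl fun j _ => by ring
      rw [e₁, e₂, ← hsum]
      ring
    have hle : μ * distOne (affine w s) (affine w t) ≤ μ * (r * distOne s t) := by
      calc μ * distOne (affine w s) (affine w t)
          = ∑ l, |μ * (affine w s l - affine w t l)| := by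
            unfold distOne
            rw [Finset.mul_sum]
            exact Finset.sum_congr rfl fun l _ => by rw [abs_mul, abs_of_nonneg hμ0]
        _ ≤ ∑ l, ∑ i, ∑ j, p i * q j * |w i l - w j l| := by
            refine Finset.sum_le_sum fun l _ => ?_
            rw [hdiff]
            refine (Finset.abs_sum_le_sum_abs _ _).trans (Finset.sum_le_sum fun i _ => ?_)
            refine (Finset.abs_sum_le_sum_abs _ _).trans (Finset.sum_le_sum fun j _ => ?_)
            rw [abs_mul, abs_of_nonneg (mul_nonneg (hp0 i) (hq0 j))]
        _ = ∑ i, ∑ j, p i * q j * distOne (w i) (w j) := by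
            rw [Finset.sum_comm]
            refine Finset.sum_congr rfl fun i _ => ?_
            rw [Finset.sum_comm]
            refine Finset.sum_congr rfl fun j _ => ?_
            rw [distOne, Finset.mul_sum]
        _ ≤ ∑ i, ∑ j, p i * q j * (2 * r) :=
            Finset.sum_le_sum fun i _ => Finset.sum_le_sum fun j _ =>
              mul_le_mul_of_nonneg_left (hw i j) (mul_nonneg (hp0 i) (hq0 j))
        _ = μ * (r * distOne s t) := by
            simp_rw [← Finset.sum_mul, ← Finset.mul_sum]
            rw [← Finset.sum_mul, ← hsum, hd]
            ring
    exact le_of_mul_le_mul_left hle h0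

end stdSimplex

/-! ## Realization of ordered simplices -/

namespace TupleChain

variable {k m : ℕ} {T : Type*} [TopologicalSpace T]

/-- The singular chain obtained by realizing ordered simplices as singular simplices. -/
noncomputable def realize (r : (Fin (m + 1) → T) → SingularSimplex m T) :
    TupleChain m T →ₗ[ℝ] RealSingularChain m T :=
  Finsupp.lmapDomain ℝ ℝ r

@[simp]
theorem realize_single (r : (Fin (m + 1) → T) → SingularSimplex m T) (v : Fin (m + 1) → T) (a : ℝ) :
    realize r (Finsupp.single v a) = Finsupp.single (r v) a := by
  simp [realize, Finsupp.mapDomain_single]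

theorem boundary_realize {r : ∀ m, (Fin (m + 1) → T) → SingularSimplex m T}
    (hr : ∀ m w i, (r (m + 1) w).face i = r m (w ∘ i.succAbove)) (c : TupleChain (m + 1) T) :
    RealSingularChain.boundary (realize (r (m + 1)) c) = realize (r m) (boundary c) := by
  refine hom_ext (f := RealSingularChain.boundary ∘ₗ realize (r (m + 1)))
    (g := realize (r m) ∘ₗ boundary) (fun v => ?_) c
  simp only [LinearMap.comp_apply, realize_single, RealSingularChain.boundary_single,
    boundary_single, map_sum, map_smul, hr]

theorem push_realize {T' : Type*} [TopologicalSpace T']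
    {r : (Fin (m + 1) → T) → SingularSimplex m T} {r' : (Fin (m + 1) → T') → SingularSimplex m T'}
    (g : C(T, T')) (hr : ∀ w, g.comp (r w) = r' (g ∘ w)) (c : TupleChain m T) :
    RealSingularChain.push g (realize r c) = realize r' (map g c) := by
  refine hom_ext (f := RealSingularChain.push g ∘ₗ realize r)
    (g := realize r' ∘ₗ map g) (fun v => ?_) c
  simp [hr]

end TupleChain

namespace RealSingularChain

open TupleChain (realize)

variable {k m : ℕ} {X Y : Type*} [TopologicalSpace X] [TopologicalSpace Y]

/-- The inclusion of a face into a standard simplex. -/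
noncomputable def faceMap (i : Fin (k + 2)) :
    C(stdSimplex ℝ (Fin (k + 1)), stdSimplex ℝ (Fin (k + 2))) :=
  ⟨stdSimplex.map i.succAbove, stdSimplex.continuous_map _⟩

/-- The vertices of a standard simplex. -/
noncomputable def vertices (k : ℕ) (i : Fin (k + 1)) : stdSimplex ℝ (Fin (k + 1)) :=
  stdSimplex.vertex i

theorem vertices_comp_succAbove (i : Fin (k + 2)) :
    vertices (k + 1) ∘ i.succAbove = faceMap i ∘ vertices k :=
  stdSimplex.vertex_comp_succAbove i

theorem affine_face (m : ℕ) (w : Fin (m + 2) → stdSimplex ℝ (Fin (k + 1))) (i : Fin (m + 2)) :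
    SingularSimplex.face i (stdSimplex.affine w) = stdSimplex.affine (w ∘ i.succAbove) := by
  ext t : 1
  exact stdSimplex.affine_map w i.succAbove t

theorem faceMap_comp_affine (i : Fin (k + 2)) (w : Fin (m + 1) → stdSimplex ℝ (Fin (k + 1))) :
    (faceMap i).comp (stdSimplex.affine w) = stdSimplex.affine (faceMap i ∘ w) := by
  ext t : 1
  exact stdSimplex.map_affine w i.succAbove t

theorem hom_ext {V : Type*} [AddCommGroup V] [Module ℝ V] {f g : RealSingularChain k X →ₗ[ℝ] V}
    (h : ∀ σ, f (Finsupp.single σ 1) = g (Finsupp.single σ 1)) (c : RealSingularChain k X) :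
    f c = g c :=
  congrArg (fun l : RealSingularChain k X →ₗ[ℝ] V => l c) (Finsupp.lhom_ext' fun v =>
    LinearMap.ext_ring (h v))

theorem boundary_boundary (c : RealSingularChain (k + 2) X) : boundary (boundary c) = 0 := by
  refine hom_ext (f := boundary ∘ₗ boundary) (g := 0) (fun σ => ?_) c
  have : Finsupp.single σ 1 = push σ (realize stdSimplex.affine
      (Finsupp.single (vertices (k + 2)) 1)) := by
    rw [TupleChain.realize_single, push_single]
    congr 1
    change _ = σ.comp (stdSimplex.affine fun i => stdSimplex.vertex i)
    rw [stdSimplex.affine_vertex, ContinuousMap.comp_id]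
  rw [this, LinearMap.comp_apply, ← push_boundary, ← push_boundary,
    TupleChain.boundary_realize (r := fun m => stdSimplex.affine) affine_face,
    TupleChain.boundary_realize (r := fun m => stdSimplex.affine) affine_face,
    TupleChain.boundary_boundary]
  simp

theorem single_eq_push (σ : SingularSimplex k X) : Finsupp.single σ 1 =
    push σ (realize stdSimplex.affine (Finsupp.single (vertices k) 1)) := by
  rw [TupleChain.realize_single, push_single]
  congr 1
  change _ = σ.comp (stdSimplex.affine fun i => stdSimplex.vertex i)
  rw [stdSimplex.affine_vertex, ContinuousMap.comp_id]

/-! ### Barycentric subdivision of singular chains -/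

/-- Barycentric subdivision. -/
noncomputable def sd : RealSingularChain k X →ₗ[ℝ] RealSingularChain k X :=
  Finsupp.linearCombination ℝ fun σ => push σ (realize stdSimplex.affine
    (TupleChain.sd (stdSimplex.centre k) k (Finsupp.single (vertices k) 1)))

/-- The chain homotopy from barycentric subdivision to the identity. -/
noncomputable def sdHomotopy : RealSingularChain k X →ₗ[ℝ] RealSingularChain (k + 1) X :=
  Finsupp.linearCombination ℝ fun σ => push σ (realize stdSimplex.affine
    (TupleChain.sdHomotopy (stdSimplex.centre k) k (Finsupp.single (vertices k) 1)))

theorem sd_single (σ : SingularSimplex k X) : sd (Finsupp.single σ 1) =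
    push σ (realize stdSimplex.affine
      (TupleChain.sd (stdSimplex.centre k) k (Finsupp.single (vertices k) 1))) := by
  simp [sd]

theorem sdHomotopy_single (σ : SingularSimplex k X) : sdHomotopy (Finsupp.single σ 1) =
    push σ (realize stdSimplex.affine
      (TupleChain.sdHomotopy (stdSimplex.centre k) k (Finsupp.single (vertices k) 1))) := by
  simp [sdHomotopy]

/-- Naturality under the face inclusions turns the subdivided boundary of `σ` into the image of a
chain in the standard simplex. Identities for singular chains thereby follow from those for ordered
simplices. -/
theorem sd_boundary_single (σ : SingularSimplex (k + 1) X) :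
    sd (boundary (Finsupp.single σ 1)) = push σ (realize stdSimplex.affine
      (TupleChain.sd (stdSimplex.centre (k + 1)) k
        (TupleChain.boundary (Finsupp.single (vertices (k + 1)) 1)))) := by
  rw [boundary_single, TupleChain.boundary_single]
  simp only [map_sum, map_smul, sd_single]
  refine Finset.sum_congr rfl fun i _ => ?_
  rw [vertices_comp_succAbove, ← TupleChain.map_single,
    ← TupleChain.map_sd (faceMap i) (stdSimplex.map_centre i.succAbove),
    ← TupleChain.push_realize (faceMap i) (faceMap_comp_affine i), ← push_comp_apply]
  rfl

theorem sdHomotopy_boundary_single (σ : SingularSimplex (k + 1) X) :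
    sdHomotopy (boundary (Finsupp.single σ 1)) = push σ (realize stdSimplex.affine
      (TupleChain.sdHomotopy (stdSimplex.centre (k + 1)) k
        (TupleChain.boundary (Finsupp.single (vertices (k + 1)) 1)))) := by
  rw [boundary_single, TupleChain.boundary_single]
  simp only [map_sum, map_smul, sdHomotopy_single]
  refine Finset.sum_congr rfl fun i _ => ?_
  rw [vertices_comp_succAbove, ← TupleChain.map_single,
    ← TupleChain.map_sdHomotopy (faceMap i) (stdSimplex.map_centre i.succAbove),
    ← TupleChain.push_realize (faceMap i) (faceMap_comp_affine i), ← push_comp_apply]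
  rfl

theorem boundary_sd (c : RealSingularChain (k + 1) X) : boundary (sd c) = sd (boundary c) := by
  refine hom_ext (f := boundary ∘ₗ sd) (g := sd ∘ₗ boundary) (fun σ => ?_) c
  rw [LinearMap.comp_apply, LinearMap.comp_apply, sd_boundary_single, sd_single, ← push_boundary,
    TupleChain.boundary_realize (r := fun m => stdSimplex.affine) affine_face,
    TupleChain.boundary_sd]

theorem boundary_sdHomotopy (c : RealSingularChain (k + 1) X) :
    boundary (sdHomotopy c) = c - sd c - sdHomotopy (boundary c) := by
  refine hom_ext (f := boundary ∘ₗ sdHomotopy)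
    (g := LinearMap.id - sd - sdHomotopy ∘ₗ boundary) (fun σ => ?_) c
  simp only [LinearMap.comp_apply, LinearMap.sub_apply, LinearMap.id_apply]
  rw [sdHomotopy_boundary_single, sdHomotopy_single, sd_single, ← push_boundary,
    TupleChain.boundary_realize (r := fun m => stdSimplex.affine) affine_face,
    TupleChain.boundary_sdHomotopy, single_eq_push σ]
  simp only [map_sub]

/-! ### Homotopy invariance -/

/-- Realization of ordered simplices in the product of two standard simplices. -/
noncomputable def affineProd (k m : ℕ)
    (w : Fin (m + 1) → stdSimplex ℝ (Fin (k + 1)) × stdSimplex ℝ (Fin (1 + 1))) :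
    SingularSimplex m (stdSimplex ℝ (Fin (k + 1)) × stdSimplex ℝ (Fin (1 + 1))) :=
  (stdSimplex.affine (Prod.fst ∘ w)).prodMk (stdSimplex.affine (Prod.snd ∘ w))

theorem affineProd_face (m : ℕ)
    (w : Fin (m + 2) → stdSimplex ℝ (Fin (k + 1)) × stdSimplex ℝ (Fin (1 + 1))) (i : Fin (m + 2)) :
    SingularSimplex.face i (affineProd k (m + 1) w) = affineProd k m (w ∘ i.succAbove) := by
  ext t : 1
  exact Prod.ext (stdSimplex.affine_map (Prod.fst ∘ w) i.succAbove t)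
    (stdSimplex.affine_map (Prod.snd ∘ w) i.succAbove t)

/-- The standard prism on the `k`-simplex. -/
noncomputable def stdPrism (k : ℕ) :
    RealSingularChain (k + 1) (stdSimplex ℝ (Fin (k + 1)) × stdSimplex ℝ (Fin (1 + 1))) :=
  realize (affineProd k (k + 1)) (TupleChain.prism (fun s => (s, stdSimplex.vertex 0))
    (fun s => (s, stdSimplex.vertex 1)) k (Finsupp.single (vertices k) 1))

/-- The homotopy applied to a simplex in its first variable. -/
noncomputable def simplexHomotopy (H : C(X × stdSimplex ℝ (Fin (1 + 1)), Y))
    (σ : SingularSimplex k X) :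
    C(stdSimplex ℝ (Fin (k + 1)) × stdSimplex ℝ (Fin (1 + 1)), Y) :=
  H.comp (σ.prodMap (ContinuousMap.id _))

/-- The prism operator of a homotopy. -/
noncomputable def prism (H : C(X × stdSimplex ℝ (Fin (1 + 1)), Y)) :
    RealSingularChain k X →ₗ[ℝ] RealSingularChain (k + 1) Y :=
  Finsupp.linearCombination ℝ fun σ => push (simplexHomotopy H σ) (stdPrism k)

theorem prism_single (H : C(X × stdSimplex ℝ (Fin (1 + 1)), Y)) (σ : SingularSimplex k X) :
    prism H (Finsupp.single σ 1) = push (simplexHomotopy H σ) (stdPrism k) := by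
  simp [prism]

/-- The map at the end `j` of a homotopy. -/
noncomputable def homotopyEnd (H : C(X × stdSimplex ℝ (Fin (1 + 1)), Y)) (j : Fin (1 + 1)) : C(X, Y) :=
  H.comp ((ContinuousMap.id X).prodMk (ContinuousMap.const X (stdSimplex.vertex j)))

theorem push_realize_end (H : C(X × stdSimplex ℝ (Fin (1 + 1)), Y)) (σ : SingularSimplex k X)
    (j : Fin (1 + 1)) : push (simplexHomotopy H σ) (realize (affineProd k k)
      (TupleChain.map (fun s => (s, stdSimplex.vertex j)) (Finsupp.single (vertices k) 1))) =
    push (homotopyEnd H j) (Finsupp.single σ 1) := by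
  rw [TupleChain.map_single, TupleChain.realize_single, push_single, push_single]
  congr 1
  ext t : 1
  have h₁ : stdSimplex.affine (fun i : Fin (k + 1) => stdSimplex.vertex (S := ℝ) i) t = t := by
    rw [stdSimplex.affine_vertex]; rfl
  have h₂ : stdSimplex.affine (fun _ : Fin (k + 1) => stdSimplex.vertex (S := ℝ) j) t =
    stdSimplex.vertex j := stdSimplex.affine_const _ _
  change H (σ (stdSimplex.affine (fun i : Fin (k + 1) => stdSimplex.vertex (S := ℝ) i) t),
    stdSimplex.affine (fun _ : Fin (k + 1) => stdSimplex.vertex (S := ℝ) j) t) =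
    H (σ t, stdSimplex.vertex j)
  rw [h₁, h₂]

theorem prism_boundary_single (H : C(X × stdSimplex ℝ (Fin (1 + 1)), Y))
    (σ : SingularSimplex (k + 1) X) : prism H (boundary (Finsupp.single σ 1)) =
      push (simplexHomotopy H σ) (realize (affineProd (k + 1) (k + 1))
        (TupleChain.prism (fun s => (s, stdSimplex.vertex 0)) (fun s => (s, stdSimplex.vertex 1)) k
        (TupleChain.boundary (Finsupp.single (vertices (k + 1)) 1)))) := by
  rw [boundary_single, TupleChain.boundary_single]
  simp only [map_sum, map_smul, prism_single]
  refine Finset.sum_congr rfl fun i _ => ?_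
  rw [vertices_comp_succAbove, ← TupleChain.map_single,
    ← TupleChain.map_prism (i₀ := fun s => (s, stdSimplex.vertex 0))
      (i₁ := fun s => (s, stdSimplex.vertex 1)) (faceMap i)
      ((faceMap i).prodMap (ContinuousMap.id (stdSimplex ℝ (Fin (1 + 1)))))
      (fun _ => rfl) (fun _ => rfl),
    ← TupleChain.push_realize (r := affineProd k (k + 1))
      ((faceMap i).prodMap (ContinuousMap.id (stdSimplex ℝ (Fin (1 + 1)))))
      (fun w => ?_), ← push_comp_apply]
  · rfl
  · ext t : 1
    exact Prod.ext (stdSimplex.map_affine (Prod.fst ∘ w) i.succAbove t) rfl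

theorem boundary_prism (H : C(X × stdSimplex ℝ (Fin (1 + 1)), Y))
    (c : RealSingularChain (k + 1) X) : boundary (prism H c) =
      push (homotopyEnd H 1) c - push (homotopyEnd H 0) c - prism H (boundary c) := by
  refine hom_ext (f := boundary ∘ₗ prism H)
    (g := push (homotopyEnd H 1) - push (homotopyEnd H 0) - prism H ∘ₗ boundary) (fun σ => ?_) c
  simp only [LinearMap.comp_apply, LinearMap.sub_apply]
  rw [prism_boundary_single, prism_single, ← push_boundary, stdPrism,
    TupleChain.boundary_realize (r := affineProd (k + 1)) affineProd_face,
    TupleChain.boundary_prism]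
  rw [map_sub, map_sub, map_sub, map_sub, push_realize_end, push_realize_end]

end RealSingularChain

/-! ## Supports of chains and relative boundaries -/

namespace RealSingularChain

variable {k m : ℕ} {X Y : Type*} [TopologicalSpace X] [TopologicalSpace Y]

/-- The chains whose simplices lie in `W`. -/
noncomputable def chainsIn (k : ℕ) (W : Set X) : Submodule ℝ (RealSingularChain k X) :=
  Finsupp.supported ℝ ℝ {σ : SingularSimplex k X | Set.range σ ⊆ W}

/-- The chains that are boundaries modulo chains in `W`. -/
noncomputable def boundariesRel (k : ℕ) (W : Set X) : Submodule ℝ (RealSingularChain k X) :=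
  chainsIn k W ⊔ LinearMap.range boundary

theorem single_mem_chainsIn {W : Set X} {σ : SingularSimplex k X} (h : Set.range σ ⊆ W) (a : ℝ) :
    Finsupp.single σ a ∈ chainsIn k W :=
  Finsupp.single_mem_supported ℝ a h

theorem chainsIn_mono {V W : Set X} (h : V ⊆ W) : chainsIn k V ≤ chainsIn k W :=
  Finsupp.supported_mono fun _ hσ => hσ.trans h

theorem chainsIn_univ (c : RealSingularChain k X) : c ∈ chainsIn k (Set.univ : Set X) :=
  fun _ _ => Set.subset_univ _

theorem mem_chainsIn_inter {V W : Set X} {c : RealSingularChain k X} :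
    c ∈ chainsIn k (V ∩ W) ↔ c ∈ chainsIn k V ∧ c ∈ chainsIn k W :=
  ⟨fun h => ⟨chainsIn_mono Set.inter_subset_left h, chainsIn_mono Set.inter_subset_right h⟩,
    fun h _ hσ => Set.subset_inter (h.1 hσ) (h.2 hσ)⟩

theorem chainsIn_empty {c : RealSingularChain k X} (h : c ∈ chainsIn k (∅ : Set X)) : c = 0 := by
  rw [← Finsupp.support_eq_empty, Finset.eq_empty_iff_forall_notMem]
  intro σ hσ
  exact (h hσ) ⟨stdSimplex.vertex 0, rfl⟩

theorem linearCombination_mem {V : Type*} [AddCommGroup V] [Module ℝ V]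
    {N : Submodule ℝ V} {W : Set X} {f : SingularSimplex k X → V}
    (hf : ∀ σ : SingularSimplex k X, Set.range σ ⊆ W → f σ ∈ N) {c : RealSingularChain k X}
    (hc : c ∈ chainsIn k W) : Finsupp.linearCombination ℝ f c ∈ N := by
  rw [Finsupp.linearCombination_apply]
  exact Submodule.sum_mem _ fun σ hσ => N.smul_mem _ (hf σ (hc hσ))

theorem push_mem {V : Set X} {W : Set Y} (g : C(X, Y)) (h : Set.MapsTo g V W)
    {c : RealSingularChain k X} (hc : c ∈ chainsIn k V) : push g c ∈ chainsIn k W := by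
  have : push g c = Finsupp.linearCombination ℝ (fun σ => Finsupp.single (g.comp σ) (1 : ℝ)) c :=
    hom_ext (f := push g) (g := Finsupp.linearCombination ℝ
      (fun σ : SingularSimplex k X => Finsupp.single (g.comp σ) (1 : ℝ))) (fun σ => by simp) c
  rw [this]
  refine linearCombination_mem (fun σ hσ => single_mem_chainsIn ?_ 1) hc
  rintro _ ⟨t, rfl⟩
  exact h (hσ ⟨t, rfl⟩)

theorem push_mem_of_range {W : Set Y} (g : C(X, Y)) (h : Set.range g ⊆ W)
    (c : RealSingularChain k X) : push g c ∈ chainsIn k W :=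
  push_mem g (fun _ _ => h ⟨_, rfl⟩) (chainsIn_univ c)

theorem boundary_mem {W : Set X} {c : RealSingularChain (k + 1) X} (hc : c ∈ chainsIn (k + 1) W) :
    boundary c ∈ chainsIn k W := by
  refine linearCombination_mem (fun σ hσ => Submodule.sum_mem _ fun i _ =>
    Submodule.smul_mem _ _ (single_mem_chainsIn ?_ 1)) hc
  rintro _ ⟨t, rfl⟩
  exact hσ ⟨_, rfl⟩

theorem sd_mem {W : Set X} {c : RealSingularChain k X} (hc : c ∈ chainsIn k W) :
    sd c ∈ chainsIn k W :=
  linearCombination_mem (fun σ hσ => push_mem_of_range σ hσ _) hc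

theorem sdHomotopy_mem {W : Set X} {c : RealSingularChain k X} (hc : c ∈ chainsIn k W) :
    sdHomotopy c ∈ chainsIn (k + 1) W :=
  linearCombination_mem (fun σ hσ => push_mem_of_range σ hσ _) hc

theorem prism_mem {V : Set X} {W : Set Y} (H : C(X × stdSimplex ℝ (Fin (1 + 1)), Y))
    (h : ∀ x ∈ V, ∀ u, H (x, u) ∈ W) {c : RealSingularChain k X} (hc : c ∈ chainsIn k V) :
    prism H c ∈ chainsIn (k + 1) W := by
  refine linearCombination_mem (fun σ hσ => push_mem_of_range _ ?_ _) hc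
  rintro _ ⟨⟨t, u⟩, rfl⟩
  exact h _ (hσ ⟨t, rfl⟩) u

theorem mem_boundariesRel {W : Set X} {c : RealSingularChain k X} :
    c ∈ boundariesRel k W ↔ ∃ d : RealSingularChain (k + 1) X, c - boundary d ∈ chainsIn k W := by
  rw [boundariesRel, Submodule.mem_sup]
  constructor
  · rintro ⟨y, hy, _, ⟨d, rfl⟩, rfl⟩
    exact ⟨d, by simpa using hy⟩
  · rintro ⟨d, hd⟩
    exact ⟨_, hd, _, ⟨d, rfl⟩, by simp⟩

theorem chainsIn_le_boundariesRel (W : Set X) : chainsIn k W ≤ boundariesRel k W := le_sup_left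

theorem boundary_mem_boundariesRel (W : Set X) (d : RealSingularChain (k + 1) X) :
    boundary d ∈ boundariesRel k W :=
  Submodule.mem_sup_right ⟨d, rfl⟩

theorem boundariesRel_mono {V W : Set X} (h : V ⊆ W) : boundariesRel k V ≤ boundariesRel k W :=
  sup_le_sup_right (chainsIn_mono h) _

theorem push_mem_boundariesRel {V : Set X} {W : Set Y} (g : C(X, Y)) (h : Set.MapsTo g V W)
    {c : RealSingularChain k X} (hc : c ∈ boundariesRel k V) : push g c ∈ boundariesRel k W := by
  obtain ⟨d, hd⟩ := mem_boundariesRel.1 hc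
  refine mem_boundariesRel.2 ⟨push g d, ?_⟩
  rw [← push_boundary, ← map_sub]
  exact push_mem g h hd

theorem homologousAt_iff {x : X} {c c' : RealSingularChain k X} :
    HomologousAt x c c' ↔ c - c' ∈ boundariesRel k {x}ᶜ := by
  rw [mem_boundariesRel]
  refine exists_congr fun d => ⟨fun h σ hσ => ?_, fun h σ hσ => ?_⟩
  · exact Set.subset_compl_singleton_iff.2 (h σ hσ)
  · exact Set.subset_compl_singleton_iff.1 (h hσ)

/-- The ends of a homotopy induce the same class relative to `W` if the boundary stays in `W`. -/
theorem push_sub_push_mem {V : Set X} {W : Set Y} (H : C(X × stdSimplex ℝ (Fin (1 + 1)), Y))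
    (h : ∀ x ∈ V, ∀ u, H (x, u) ∈ W) {c : RealSingularChain (k + 1) X}
    (hc : boundary c ∈ chainsIn k V) :
    push (homotopyEnd H 1) c - push (homotopyEnd H 0) c ∈ boundariesRel (k + 1) W := by
  refine mem_boundariesRel.2 ⟨prism H c, ?_⟩
  rw [boundary_prism, sub_sub_cancel]
  exact prism_mem H h hc

/-! ### Small chains -/

/-- The singular simplices of the form `σ ∘ ρ` with `ρ` a contraction by the factor `r`. -/
def reparametrizations (σ : SingularSimplex k X) (r : ℝ) : Set (SingularSimplex k X) :=
  {σ' | ∃ ρ : C(stdSimplex ℝ (Fin (k + 1)), stdSimplex ℝ (Fin (k + 1))), σ' = σ.comp ρ ∧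
    ∀ s t, stdSimplex.distOne (ρ s) (ρ t) ≤ r * stdSimplex.distOne s t}

theorem tuple_map_mem {S T : Type*} (g : S → T) {A : Set (Fin (k + 1) → S)}
    {B : Set (Fin (k + 1) → T)} (h : ∀ v ∈ A, g ∘ v ∈ B) {c : TupleChain k S}
    (hc : c ∈ Finsupp.supported ℝ ℝ A) : TupleChain.map g c ∈ Finsupp.supported ℝ ℝ B := by
  classical
  refine (Finsupp.mem_supported _ _).2 fun w hw => ?_
  have := Finsupp.mapDomain_support hw
  obtain ⟨v, hv, rfl⟩ := Finset.mem_image.1 this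
  exact h v (hc hv)

theorem tuple_cone_mem {S : Type*} (b : S) {A : Set (Fin (k + 1) → S)}
    {B : Set (Fin (k + 2) → S)} (h : ∀ v ∈ A, Matrix.vecCons b v ∈ B) {c : TupleChain k S}
    (hc : c ∈ Finsupp.supported ℝ ℝ A) : TupleChain.cone b c ∈ Finsupp.supported ℝ ℝ B := by
  classical
  refine (Finsupp.mem_supported _ _).2 fun w hw => ?_
  have := Finsupp.mapDomain_support hw
  obtain ⟨v, hv, rfl⟩ := Finset.mem_image.1 this
  exact h v (hc hv)

/-- Two vertices of a simplex of the subdivision either both lie in a subdivided face, where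
induction applies and `k / (k + 1)` increases with `k`, or one of them is the barycentre. -/
theorem sd_vertices_mem (k : ℕ) :
    TupleChain.sd (stdSimplex.centre k) k (Finsupp.single (vertices k) 1) ∈
      Finsupp.supported ℝ ℝ {w : Fin (k + 1) → stdSimplex ℝ (Fin (k + 1)) |
        ∀ i j, stdSimplex.distOne (w i) (w j) ≤ 2 * (k / (k + 1) : ℝ)} := by
  induction k with
  | zero =>
    refine Finsupp.single_mem_supported ℝ 1 fun i j => ?_
    rw [show i = j from Fin.ext (by omega), stdSimplex.distOne_self]
    simp
  | succ k ih =>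
    rw [TupleChain.sd_single, TupleChain.boundary_single]
    simp only [map_sum, map_smul]
    refine Submodule.sum_mem _ fun i _ => Submodule.smul_mem _ _ ?_
    rw [vertices_comp_succAbove, ← TupleChain.map_single,
      ← TupleChain.map_sd (faceMap i) (stdSimplex.map_centre i.succAbove)]
    have hcentre : stdSimplex.centre (k + 1) (k + 1) (vertices (k + 1)) = stdSimplex.barycenter := by
      change stdSimplex.affine (fun i => stdSimplex.vertex i) _ = _
      rw [stdSimplex.affine_vertex]
      rfl
    have hc := stdSimplex.distOne_barycenter_le (k := k + 1)
    rw [hcentre]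
    refine tuple_cone_mem _ (A := {v | ∀ i j, stdSimplex.distOne (v i) (v j) ≤
      2 * (((k + 1 : ℕ) : ℝ) / ((k + 1 : ℕ) + 1))}) ?_ (tuple_map_mem _ ?_ ih)
    · intro v hv i j
      refine Fin.cases ?_ (fun i => ?_) i <;> refine Fin.cases ?_ (fun j => ?_) j
      · simp only [Matrix.cons_val_zero, stdSimplex.distOne_self]; positivity
      · simpa using hc (v j)
      · rw [stdSimplex.distOne_comm]; simpa using hc (v i)
      · exact hv i j
    · intro v hv i j
      refine (stdSimplex.distOne_map_le _ _ _).trans ((hv i j).trans ?_)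
      have : (k / (k + 1) : ℝ) ≤ ((k + 1 : ℕ) : ℝ) / ((k + 1 : ℕ) + 1) := by
        rw [div_le_div_iff₀ (by positivity) (by positivity)]
        push_cast
        nlinarith
      linarith

/-- Subdividing once more precomposes with an affine map that contracts by `k / (k + 1)`. Recording
only the Lipschitz constant of the reparametrization suffices for smallness. -/
theorem sd_iterate_single_mem (σ : SingularSimplex k X) (m : ℕ) :
    (sd^[m]) (Finsupp.single σ 1) ∈
      Finsupp.supported ℝ ℝ (reparametrizations σ ((k / (k + 1) : ℝ) ^ m)) := by
  classical
  induction m with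
  | zero => exact Finsupp.single_mem_supported ℝ 1 ⟨ContinuousMap.id _, rfl, by simp⟩
  | succ m ih =>
    rw [Function.iterate_succ_apply']
    rw [sd, Finsupp.linearCombination_apply]
    refine Submodule.sum_mem _ fun σ' hσ' => Submodule.smul_mem _ _ ?_
    obtain ⟨ρ, rfl, hρ⟩ := ih hσ'
    refine (Finsupp.mem_supported _ _).2 fun τ hτ => ?_
    obtain ⟨τ', hτ', rfl⟩ := Finset.mem_image.1 (Finsupp.mapDomain_support hτ)
    obtain ⟨w, hw, rfl⟩ := Finset.mem_image.1 (Finsupp.mapDomain_support hτ')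
    refine ⟨ρ.comp (stdSimplex.affine w), rfl, fun s t => (hρ _ _).trans ?_⟩
    rw [pow_succ, mul_assoc]
    exact mul_le_mul_of_nonneg_left
      (stdSimplex.distOne_affine_le w (sd_vertices_mem k hw) s t) (by positivity)

theorem sd_iterate_mem {W : Set X} {c : RealSingularChain k X} (hc : c ∈ chainsIn k W) (m : ℕ) :
    (sd^[m]) c ∈ chainsIn k W := by
  induction m with
  | zero => exact hc
  | succ m ih => rw [Function.iterate_succ_apply']; exact sd_mem ih

theorem sd_iterate_linear (m : ℕ) : ∃ L : RealSingularChain k X →ₗ[ℝ] RealSingularChain k X,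
    ∀ c, L c = (sd^[m]) c :=
  ⟨sd ^ m, fun c => by rw [Module.End.pow_apply]⟩

theorem exists_sd_iterate_single_mem {U V : Set X} (hU : IsOpen U) (hV : IsOpen V)
    {σ : SingularSimplex k X} (hσ : Set.range σ ⊆ U ∪ V) :
    ∃ m, (sd^[m]) (Finsupp.single σ 1) ∈ chainsIn k U ⊔ chainsIn k V := by
  obtain ⟨δ, hδ, hball⟩ := lebesgue_number_lemma_of_metric
    (s := (Set.univ : Set (stdSimplex ℝ (Fin (k + 1))))) (c := fun b : Bool => σ ⁻¹' (cond b U V))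
    isCompact_univ (fun b => by cases b <;> exact IsOpen.preimage σ.continuous (by assumption))
    (fun t _ => by
      rcases hσ ⟨t, rfl⟩ with h | h
      · exact Set.mem_iUnion.2 ⟨true, h⟩
      · exact Set.mem_iUnion.2 ⟨false, h⟩)
  have hr : (k / (k + 1) : ℝ) < 1 := by rw [div_lt_one (by positivity)]; linarith
  -- The standard simplex has `ℓ¹`-diameter at most `2`, so contraction by less than `δ / 2` puts
  -- each small simplex into a ball of the Lebesgue radius `δ`.
  obtain ⟨m, hm⟩ := exists_pow_lt_of_lt_one (show (0 : ℝ) < δ / 2 by positivity) hr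
  refine ⟨m, ?_⟩
  have key : Finsupp.supported ℝ ℝ (reparametrizations σ ((k / (k + 1) : ℝ) ^ m)) ≤
      chainsIn k U ⊔ chainsIn k V := by
    rw [chainsIn, chainsIn, ← Finsupp.supported_union]
    refine Finsupp.supported_mono ?_
    rintro _ ⟨ρ, rfl, hρ⟩
    obtain ⟨b, hb⟩ := hball (ρ (stdSimplex.vertex 0)) (Set.mem_univ _)
    have hsub : Set.range (σ.comp ρ) ⊆ cond b U V := by
      rintro _ ⟨t, rfl⟩
      refine hb ?_
      rw [Metric.mem_ball]
      refine (stdSimplex.dist_le_distOne _ _).trans_lt ((hρ _ _).trans_lt ?_)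
      have := mul_le_mul_of_nonneg_left (stdSimplex.distOne_le_two t (stdSimplex.vertex 0))
        (show (0 : ℝ) ≤ (k / (k + 1) : ℝ) ^ m by positivity)
      linarith
    cases b
    · exact Or.inr hsub
    · exact Or.inl hsub
  exact key (sd_iterate_single_mem σ m)

theorem exists_sd_iterate_mem {U V : Set X} (hU : IsOpen U) (hV : IsOpen V)
    {c : RealSingularChain k X} (hc : c ∈ chainsIn k (U ∪ V)) :
    ∃ m, (sd^[m]) c ∈ chainsIn k U ⊔ chainsIn k V := by
  have hstep : ∀ (c : RealSingularChain k X) (m j : ℕ), (sd^[m]) c ∈ chainsIn k U ⊔ chainsIn k V →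
      (sd^[j + m]) c ∈ chainsIn k U ⊔ chainsIn k V := by
    intro c m j h
    rw [Function.iterate_add_apply]
    obtain ⟨u, hu, v, hv, huv⟩ := Submodule.mem_sup.1 h
    obtain ⟨L, hL⟩ := sd_iterate_linear (X := X) (k := k) j
    rw [← huv, ← hL, map_add, hL, hL]
    exact Submodule.add_mem_sup (sd_iterate_mem hu j) (sd_iterate_mem hv j)
  have : chainsIn k (U ∪ V) = Submodule.span ℝ
      ((fun σ => Finsupp.single σ (1 : ℝ)) '' {σ : SingularSimplex k X | Set.range σ ⊆ U ∪ V}) :=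
    Finsupp.supported_eq_span_single ℝ _
  rw [this] at hc
  induction hc using Submodule.span_induction with
  | mem x hx =>
    obtain ⟨σ, hσ, rfl⟩ := hx
    exact exists_sd_iterate_single_mem hU hV hσ
  | zero => exact ⟨0, Submodule.zero_mem _⟩
  | add x y _ _ hx hy =>
    obtain ⟨a, ha⟩ := hx
    obtain ⟨b, hb⟩ := hy
    refine ⟨a + b, ?_⟩
    obtain ⟨L, hL⟩ := sd_iterate_linear (X := X) (k := k) (a + b)
    rw [← hL, map_add, hL, hL]
    refine Submodule.add_mem _ ?_ (hstep y b a hb)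
    rw [add_comm]
    exact hstep x a b ha
  | smul r x _ hx =>
    obtain ⟨a, ha⟩ := hx
    refine ⟨a, ?_⟩
    obtain ⟨L, hL⟩ := sd_iterate_linear (X := X) (k := k) a
    rw [← hL, map_smul, hL]
    exact Submodule.smul_mem _ _ ha

/-- The theorem of small simplices for a cover by two open sets. -/
theorem exists_decomposition {U V : Set X} (hU : IsOpen U) (hV : IsOpen V)
    {c : RealSingularChain (k + 1) X} (hc : c ∈ chainsIn (k + 1) (U ∪ V))
    (hb : boundary c ∈ chainsIn k U ⊔ chainsIn k V) :
    ∃ u ∈ chainsIn (k + 1) U, ∃ v ∈ chainsIn (k + 1) V, ∃ g ∈ chainsIn (k + 2) (U ∪ V),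
      c = u + v + boundary g := by
  obtain ⟨m, hm⟩ := exists_sd_iterate_mem hU hV hc
  induction m generalizing c with
  | zero =>
    obtain ⟨u, hu, v, hv, huv⟩ := Submodule.mem_sup.1 hm
    exact ⟨u, hu, v, hv, 0, Submodule.zero_mem _, by simpa using huv.symm⟩
  | succ m ih =>
    obtain ⟨a, ha, b, hb', hab⟩ := Submodule.mem_sup.1 hb
    obtain ⟨u, hu, v, hv, g, hg, h⟩ := ih (c := sd c) (sd_mem hc)
      (by
        rw [boundary_sd, ← hab, map_add]
        exact Submodule.add_mem_sup (sd_mem ha) (sd_mem hb'))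
      (by rwa [Function.iterate_succ_apply] at hm)
    -- With `T` the subdivision homotopy, `c = sd c + T ∂c + ∂ T c`. The middle term splits because
    -- `∂c = a + b` does; hence the assumption on the boundary.
    refine ⟨u + sdHomotopy a, Submodule.add_mem _ hu (sdHomotopy_mem ha), v + sdHomotopy b,
      Submodule.add_mem _ hv (sdHomotopy_mem hb'), g + sdHomotopy c,
      Submodule.add_mem _ hg (sdHomotopy_mem hc), ?_⟩
    rw [map_add, boundary_sdHomotopy, ← hab, map_add, h]
    abel

/-! ### Mayer–Vietoris arguments -/

/-- Vanishing of the relative homology of `(X, W)` in the positive degree `k + 1`. -/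
def HomologyVanishes (k : ℕ) (W : Set X) : Prop :=
  ∀ c : RealSingularChain (k + 1) X, boundary c ∈ chainsIn k W → c ∈ boundariesRel (k + 1) W

/-- This is exactness of `H_{k+2}(X,U) ⊕ H_{k+2}(X,V) → H_{k+2}(X,U∪V) → H_{k+1}(X,U∩V)`. Splitting
`∂z` into `u` and `v` gives a relative cycle `u` modulo `U ∩ V`. If `d` bounds it, then `d` and `z -
g - d` are relative cycles modulo `U` and `V`. -/
theorem HomologyVanishes.union {U V : Set X} (hU : IsOpen U) (hV : IsOpen V)
    (h₁ : HomologyVanishes (k + 1) U) (h₂ : HomologyVanishes (k + 1) V)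
    (h₃ : HomologyVanishes k (U ∩ V)) : HomologyVanishes (k + 1) (U ∪ V) := by
  intro z hz
  obtain ⟨u, hu, v, hv, g, hg, h⟩ := exists_decomposition hU hV hz
    (by rw [boundary_boundary]; exact Submodule.zero_mem _)
  have hbuv : boundary u = -boundary v := by
    have := congrArg boundary h
    rw [boundary_boundary, map_add, map_add, boundary_boundary, add_zero] at this
    exact eq_neg_of_add_eq_zero_left this.symm
  obtain ⟨d, hd⟩ := mem_boundariesRel.1 (h₃ u (mem_chainsIn_inter.2
    ⟨boundary_mem hu, hbuv ▸ Submodule.neg_mem _ (boundary_mem hv)⟩))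
  obtain ⟨hdU, hdV⟩ := mem_chainsIn_inter.1 hd
  have m₁ : d ∈ boundariesRel (k + 2) (U ∪ V) :=
    boundariesRel_mono Set.subset_union_left (h₁ d (by
      have := Submodule.sub_mem _ hu hdU
      rwa [sub_sub_cancel] at this))
  have m₂ : z - g - d ∈ boundariesRel (k + 2) (U ∪ V) :=
    boundariesRel_mono Set.subset_union_right (h₂ _ (by
      rw [map_sub, map_sub, h]
      have := Submodule.add_mem _ hv hdV
      convert this using 1
      abel))
  have m₃ : g ∈ boundariesRel (k + 2) (U ∪ V) := chainsIn_le_boundariesRel _ hg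
  have := Submodule.add_mem _ (Submodule.add_mem _ m₂ m₁) m₃
  convert this using 1
  abel

/-- This is exactness of `H_{k+1}(X,U∪V) → H_k(X,U∩V) → H_k(X,U) ⊕ H_k(X,V)`. The difference of the
two fillings `a`, `b` is a relative cycle modulo `U ∪ V`, hence it is `u + v` up to a boundary, and
the corrected filling `a - u` serves for both sets. -/
theorem mem_boundariesRel_inter {U V : Set X} (hU : IsOpen U) (hV : IsOpen V)
    {z : RealSingularChain k X} (h₁ : z ∈ boundariesRel k U) (h₂ : z ∈ boundariesRel k V)
    (h₃ : HomologyVanishes k (U ∪ V)) : z ∈ boundariesRel k (U ∩ V) := by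
  obtain ⟨a, ha⟩ := mem_boundariesRel.1 h₁
  obtain ⟨b, hb⟩ := mem_boundariesRel.1 h₂
  have hab : boundary (a - b) = (z - boundary b) - (z - boundary a) := by rw [map_sub]; abel
  obtain ⟨e, he⟩ := mem_boundariesRel.1 (h₃ (a - b) (by
    rw [hab]
    exact Submodule.sub_mem _ (chainsIn_mono Set.subset_union_right hb)
      (chainsIn_mono Set.subset_union_left ha)))
  obtain ⟨u, hu, v, hv, g, hg, h⟩ := exists_decomposition hU hV he (by
    rw [map_sub, boundary_boundary, sub_zero, hab]
    exact Submodule.sub_mem _ (Submodule.mem_sup_right hb) (Submodule.mem_sup_left ha))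
  refine mem_boundariesRel.2 ⟨a - u, mem_chainsIn_inter.2 ⟨?_, ?_⟩⟩
  · have := Submodule.add_mem _ ha (boundary_mem hu)
    convert this using 1
    rw [map_sub]
    abel
  · have := Submodule.sub_mem _ hb (boundary_mem hv)
    convert this using 1
    have h' : a - u = b + v + boundary g + boundary e := by
      rw [sub_eq_iff_eq_add] at h
      rw [sub_eq_iff_eq_add] at h
      rw [h]
      abel
    rw [h']
    simp only [map_add, boundary_boundary]
    abel

end RealSingularChain

/-! ## Relative homology of complements in a normed space -/

namespace RealSingularChain

variable {k m : ℕ} {X Y : Type*} [TopologicalSpace X] [TopologicalSpace Y]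

/-- A homotopy parametrized by the unit interval, reparametrized by the standard `1`-simplex. -/
noncomputable def homotopyOfIcc (H : X × ℝ → Y)
    (hH : ContinuousOn H (Set.univ ×ˢ Set.Icc 0 1)) : C(X × stdSimplex ℝ (Fin (1 + 1)), Y) where
  toFun q := H (q.1, q.2 1)
  continuous_toFun := by
    refine hH.comp_continuous (continuous_fst.prodMk
      ((continuous_apply (1 : Fin (1 + 1))).comp (continuous_subtype_val.comp continuous_snd)))
      fun q => ⟨Set.mem_univ _, q.2.2.1 1, stdSimplex.le_one q.2 1⟩

/-- Homotopic maps induce the same class relative to `W` if the boundary stays in `W`. -/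
theorem push_sub_push_mem_of_homotopy {V : Set X} {W : Set Y} (H : X × ℝ → Y)
    (hH : ContinuousOn H (Set.univ ×ˢ Set.Icc 0 1))
    (h : ∀ x ∈ V, ∀ u ∈ Set.Icc (0 : ℝ) 1, H (x, u) ∈ W) (g₀ g₁ : C(X, Y))
    (h₀ : ∀ x, H (x, 0) = g₀ x) (h₁ : ∀ x, H (x, 1) = g₁ x)
    {c : RealSingularChain (k + 1) X} (hc : boundary c ∈ chainsIn k V) :
    push g₁ c - push g₀ c ∈ boundariesRel (k + 1) W := by
  have e₀ : homotopyEnd (homotopyOfIcc H hH) 0 = g₀ := by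
    ext x
    rw [← h₀]
    change H (x, (Pi.single (0 : Fin (1 + 1)) (1 : ℝ) : Fin (1 + 1) → ℝ) 1) = _
    simp
  have e₁ : homotopyEnd (homotopyOfIcc H hH) 1 = g₁ := by
    ext x
    rw [← h₁]
    change H (x, (Pi.single (1 : Fin (1 + 1)) (1 : ℝ) : Fin (1 + 1) → ℝ) 1) = _
    simp
  rw [← e₀, ← e₁]
  exact push_sub_push_mem _ (fun x hx u => h x hx _ ⟨u.2.1 1, stdSimplex.le_one u 1⟩) hc

theorem isCompact_range_simplex (σ : SingularSimplex k X) : IsCompact (Set.range σ) :=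
  isCompact_range σ.continuous

/-- A chain that avoids a point avoids a neighbourhood of it. -/
theorem exists_isOpen_avoiding [T2Space X] {x : X} {c : RealSingularChain k X}
    (hc : c ∈ chainsIn k {x}ᶜ) : ∃ O : Set X, IsOpen O ∧ x ∈ O ∧ c ∈ chainsIn k Oᶜ := by
  refine ⟨⋂ σ ∈ c.support, (Set.range σ)ᶜ, isOpen_biInter_finset fun σ _ =>
    (isCompact_range_simplex σ).isClosed.isOpen_compl, ?_, fun σ hσ => ?_⟩
  · refine Set.mem_iInter₂.2 fun σ hσ hx => ?_
    exact hc hσ hx rfl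
  · refine Set.subset_compl_comm.1 (Set.biInter_subset_of_mem hσ)

theorem boundary_single_const (x : X) (k : ℕ) :
    boundary (Finsupp.single (ContinuousMap.const _ x : SingularSimplex (k + 1) X) 1) =
      (if Even (k + 2) then (0 : ℝ) else 1) •
        Finsupp.single (ContinuousMap.const _ x : SingularSimplex k X) 1 := by
  rw [boundary_single, ← Fin.sum_neg_one_pow, Finset.sum_smul]
  rfl

theorem push_const (x : Y) (c : RealSingularChain k X) :
    push (ContinuousMap.const X x) c = Finsupp.linearCombination ℝ (fun _ => (1 : ℝ)) c •
      Finsupp.single (ContinuousMap.const _ x : SingularSimplex k Y) 1 := by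
  refine hom_ext (f := push (ContinuousMap.const X x))
    (g := LinearMap.toSpanSingleton ℝ _ (Finsupp.single
      (ContinuousMap.const _ x : SingularSimplex k Y) 1) ∘ₗ
      Finsupp.linearCombination ℝ (fun _ => (1 : ℝ))) (fun σ => ?_) c
  simp only [push_single, LinearMap.comp_apply, Finsupp.linearCombination_single,
    LinearMap.toSpanSingleton_apply, smul_eq_mul, mul_one, one_smul]
  rfl

/-- Depending on the parity of the degree, a constant simplex either is the boundary of the constant
simplex one degree higher, or has nonzero boundary; in the latter case a cycle must have coefficient
sum zero. -/
theorem push_const_mem_range {x : Y} {c : RealSingularChain (k + 1) X} (hc : boundary c = 0) :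
    push (ContinuousMap.const X x) c ∈ LinearMap.range (boundary (k := k + 1) (X := Y)) := by
  by_cases hk : Even (k + 2)
  · have := boundary_single_const x (k + 1)
    rw [if_neg (by simpa [Nat.even_add_one] using hk), one_smul] at this
    rw [push_const, ← this]
    exact Submodule.smul_mem _ _ ⟨_, rfl⟩
  · have h : boundary (push (ContinuousMap.const X x) c) = 0 := by
      rw [← push_boundary, hc, map_zero]
    rw [push_const] at h ⊢
    rw [map_smul, boundary_single_const, if_neg hk, one_smul, smul_eq_zero,
      Finsupp.single_eq_zero] at h
    rw [h.resolve_right one_ne_zero, zero_smul]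
    exact Submodule.zero_mem _

/-! ### Convex sets, and complements of compact sets in Euclidean space. -/

variable {E : Type*} [NormedAddCommGroup E] [NormedSpace ℝ E]

/-- The linear contraction of `E` to a point `p` of `U` preserves `U`. If `U` is empty, the chain is
an absolute cycle and any `p` works, since constant cycles of positive degree bound. -/
theorem homologyVanishes_of_convex {U : Set E} (hU : Convex ℝ U) : HomologyVanishes k U := by
  intro z hz
  have key : ∀ p : E, (U.Nonempty → p ∈ U) →
      push (ContinuousMap.const E p) z - push (ContinuousMap.id E) z ∈ boundariesRel (k + 1) U := by
    intro p hp
    refine push_sub_push_mem_of_homotopy (V := U) (fun q => (1 - q.2) • q.1 + q.2 • p)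
      (by fun_prop) (fun x hx u hu => ?_) _ _ (fun x => by simp) (fun x => by simp) hz
    exact hU hx (hp ⟨x, hx⟩) (by linarith [hu.2]) hu.1 (by ring)
  rcases U.eq_empty_or_nonempty with rfl | ⟨p, hp⟩
  · have h := Submodule.sub_mem _ (Submodule.mem_sup_right (push_const_mem_range (x := (0 : E))
      (chainsIn_empty hz))) (key 0 fun h => absurd rfl h.ne_empty)
    rwa [sub_sub_cancel, push_id_apply] at h
  · have h := Submodule.sub_mem _ (chainsIn_le_boundariesRel U (push_mem_of_range
      (ContinuousMap.const E p) (by rintro _ ⟨_, rfl⟩; exact hp) z)) (key p fun _ => hp)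
    rwa [sub_sub_cancel, push_id_apply] at h

theorem iUnion_fin_succ {α : Type*} (U : Fin (m + 1) → Set α) :
    ⋃ i, U i = U 0 ∪ ⋃ i : Fin m, U i.succ := by
  ext x
  simp [Fin.exists_fin_succ]

/-- A union of `m + 1` convex open sets has no relative homology in degrees above `m`. -/
theorem homologyVanishes_iUnion_of_convex : ∀ (m : ℕ) (U : Fin (m + 1) → Set E),
    (∀ i, IsOpen (U i)) → (∀ i, Convex ℝ (U i)) → ∀ k, m ≤ k → HomologyVanishes k (⋃ i, U i) := by
  intro m
  induction m with
  | zero =>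
    intro U _ hc k _
    rw [iUnion_fin_succ]
    simpa using homologyVanishes_of_convex (hc 0)
  | succ m ih =>
    intro U ho hc k hk
    obtain ⟨k, rfl⟩ : ∃ l, k = l + 1 := ⟨k - 1, by omega⟩
    rw [iUnion_fin_succ]
    refine HomologyVanishes.union (ho 0) (isOpen_iUnion fun i => ho i.succ)
      (homologyVanishes_of_convex (hc 0))
      (ih _ (fun i => ho _) (fun i => hc _) _ (by omega)) ?_
    rw [Set.inter_iUnion]
    exact ih _ (fun i => (ho _).inter (ho _)) (fun i => (hc _).inter (hc _)) _ (by omega)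

/-- The complement of `p` is covered by `n + 1` open half-spaces, `x i < p i` for each `i` and `∑ (x
i - p i) > 0`: if all `x i ≥ p i` and the sum is not positive, then `x = p`. -/
theorem homologyVanishes_compl_singleton {n k : ℕ} (hk : n ≤ k) (p : EuclideanSpace ℝ (Fin n)) :
    HomologyVanishes k {p}ᶜ := by
  let ℓ : Fin (n + 1) → EuclideanSpace ℝ (Fin n) → ℝ :=
    Fin.cons (fun x => -∑ i, (x i - p i)) fun i x => x i - p i
  have hcont : ∀ i, Continuous (ℓ i) := by
    intro i
    refine Fin.cases ?_ (fun i => ?_) i <;> simp only [ℓ, Fin.cons_zero, Fin.cons_succ] <;> fun_prop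
  have hconv : ∀ i, Convex ℝ {x | ℓ i x < 0} := by
    intro i x hx y hy a b ha hb hab
    have hlin : ℓ i (a • x + b • y) = a * ℓ i x + b * ℓ i y := by
      have hb' : b = 1 - a := by linarith
      subst hb'
      refine Fin.cases ?_ (fun i => ?_) i
      · simp only [ℓ, Fin.cons_zero, PiLp.add_apply, PiLp.smul_apply, smul_eq_mul]
        rw [mul_neg, mul_neg, Finset.mul_sum, Finset.mul_sum, ← neg_add, ← Finset.sum_add_distrib]
        congr 1
        exact Finset.sum_congr rfl fun j _ => by ring
      · simp only [ℓ, Fin.cons_succ, PiLp.add_apply, PiLp.smul_apply, smul_eq_mul]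
        ring
    change ℓ i _ < 0
    rw [hlin]
    have hx' : ℓ i x < 0 := hx
    have hy' : ℓ i y < 0 := hy
    rcases ha.eq_or_lt with rfl | ha
    · have : b = 1 := by linarith
      subst this; linarith
    · have := mul_neg_of_pos_of_neg ha hx'
      have := mul_nonpos_of_nonneg_of_nonpos hb hy'.le
      linarith
  have hunion : ({p}ᶜ : Set (EuclideanSpace ℝ (Fin n))) = ⋃ i, {x | ℓ i x < 0} := by
    ext x
    rw [iUnion_fin_succ]
    simp only [ℓ, Fin.cons_zero, Fin.cons_succ, Set.mem_compl_iff, Set.mem_singleton_iff,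
      Set.mem_union, Set.mem_ofPred_eq, Set.mem_iUnion]
    constructor
    · intro hx
      by_contra! h
      refine hx (PiLp.ext fun i => ?_)
      have h0 : ∑ i, (x i - p i) = 0 := le_antisymm (by linarith [h.1])
        (Finset.sum_nonneg fun i _ => h.2 i)
      exact sub_eq_zero.1 ((Finset.sum_eq_zero_iff_of_nonneg fun i _ => h.2 i).1 h0 i
        (Finset.mem_univ i))
    · rintro h rfl
      simp at h
  rw [hunion]
  exact homologyVanishes_iUnion_of_convex n _
    (fun i => isOpen_lt (hcont i) continuous_const) hconv k hk

/-- Relative classes of the complement of a bounded star-shaped set are determined at the centre. -/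
theorem mem_boundariesRel_of_starConvex {K : Set E} {p : E} (hK : StarConvex ℝ p K)
    (hbd : Bornology.IsBounded K) {z : RealSingularChain (k + 1) E}
    (hz : boundary z ∈ chainsIn k Kᶜ) (hp : z ∈ boundariesRel (k + 1) {p}ᶜ) :
    z ∈ boundariesRel (k + 1) Kᶜ := by
  obtain ⟨d, hd⟩ := mem_boundariesRel.1 hp
  obtain ⟨O, hO, hpO, hdO⟩ := exists_isOpen_avoiding hd
  obtain ⟨δ, hδ, hball⟩ := Metric.isOpen_iff.1 hO p hpO
  obtain ⟨R, hR, hKR⟩ := hbd.subset_ball_lt 0 p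
  -- Dilations centred at `p` by factors at least `1` preserve the complement of `K`. This factor
  -- moves every point at distance at least `δ` from `p` to distance at least `δ + R`, hence out of
  -- `K`.
  let ψ : C(E, E) := ⟨fun x => p + (1 + R / δ) • (x - p), by fun_prop⟩
  have h₁ : push ψ z - push (ContinuousMap.id E) z ∈ boundariesRel (k + 1) Kᶜ := by
    refine push_sub_push_mem_of_homotopy (V := Kᶜ) (W := Kᶜ)
      (fun q => p + (1 + q.2 * (R / δ)) • (q.1 - p)) (by fun_prop) (fun x hx u hu hmem => hx ?_)
      _ _ (fun x => by simp) (fun x => by simp [ψ]) hz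
    have hpos : 0 < 1 + u * (R / δ) := by have := hu.1; positivity
    have hle : 1 ≤ 1 + u * (R / δ) := by
      have : 0 ≤ u * (R / δ) := mul_nonneg hu.1 (by positivity)
      linarith
    have := hK.add_smul_sub_mem hmem (t := (1 + u * (R / δ))⁻¹) (by positivity)
      (inv_le_one_of_one_le₀ hle)
    simpa [smul_smul, hpos.ne'] using this
  have h₂ : push ψ (z - boundary d) ∈ chainsIn (k + 1) Kᶜ := by
    refine push_mem (V := Oᶜ) (W := Kᶜ) ψ (fun x hx hmem => hx (hball ?_)) hdO
    have h3 : ‖(1 + R / δ) • (x - p)‖ < R := by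
      have := hKR hmem
      rw [Metric.mem_ball, dist_eq_norm] at this
      simpa [ψ] using this
    rw [norm_smul, Real.norm_eq_abs, abs_of_pos (by positivity)] at h3
    rw [Metric.mem_ball, dist_eq_norm]
    by_contra! h4
    have : (1 + R / δ) * δ ≤ (1 + R / δ) * ‖x - p‖ := mul_le_mul_of_nonneg_left h4 (by positivity)
    have h5 : (1 + R / δ) * δ = δ + R := by field_simp
    linarith
  have h₃ : push ψ z ∈ boundariesRel (k + 1) Kᶜ := by
    refine mem_boundariesRel.2 ⟨push ψ d, ?_⟩
    rwa [← push_boundary, ← map_sub]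
  have := Submodule.sub_mem _ h₃ h₁
  rwa [sub_sub_cancel, push_id_apply] at this

theorem homologyVanishes_univ : HomologyVanishes k (Set.univ : Set X) :=
  fun z _ => chainsIn_le_boundariesRel _ (chainsIn_univ z)

/-- Induction by `mem_boundariesRel_inter`: the hypothesis one degree higher concerns the complement
of `K 0 ∩ ⋃ K i.succ`, which is again a union of `m` compact convex sets. -/
theorem homologyVanishes_compl_iUnion {n : ℕ} :
    ∀ (m : ℕ) (K : Fin m → Set (EuclideanSpace ℝ (Fin n))), (∀ i, IsCompact (K i)) →
      (∀ i, Convex ℝ (K i)) → ∀ k, n ≤ k → HomologyVanishes k (⋃ i, K i)ᶜ := by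
  have base : ∀ (K : Set (EuclideanSpace ℝ (Fin n))), IsCompact K → Convex ℝ K → ∀ k, n ≤ k →
      HomologyVanishes k Kᶜ := by
    intro K hK hconv k hk z hz
    rcases K.eq_empty_or_nonempty with rfl | ⟨p, hp⟩
    · rw [Set.compl_empty]
      exact homologyVanishes_univ z (chainsIn_univ _)
    · exact mem_boundariesRel_of_starConvex (hconv.starConvex hp) hK.isBounded hz
        (homologyVanishes_compl_singleton hk p z (chainsIn_mono (by simpa using hp) hz))
  intro m
  induction m with
  | zero =>
    intro K _ _ k _
    simpa using homologyVanishes_univ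
  | succ m ih =>
    intro K hK hconv k hk z hz
    have hcl : IsClosed (⋃ i : Fin m, K i.succ) :=
      isClosed_iUnion_of_finite fun i => (hK i.succ).isClosed
    rw [iUnion_fin_succ, Set.compl_union] at hz ⊢
    obtain ⟨hz₁, hz₂⟩ := mem_chainsIn_inter.1 hz
    refine mem_boundariesRel_inter (hK 0).isClosed.isOpen_compl hcl.isOpen_compl
      (base _ (hK 0) (hconv 0) k hk z hz₁)
      (ih _ (fun i => hK _) (fun i => hconv _) k hk z hz₂) ?_
    rw [← Set.compl_inter, Set.inter_iUnion]
    exact ih _ (fun i => (hK 0).inter (hK i.succ)) (fun i => (hconv 0).inter (hconv i.succ))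
      _ (by omega)

theorem mem_boundariesRel_compl_iUnion {n : ℕ} :
    ∀ (m : ℕ) (K : Fin m → Set (EuclideanSpace ℝ (Fin n))), (∀ i, IsCompact (K i)) →
      (∀ i, Convex ℝ (K i)) → ∀ z : RealSingularChain n (EuclideanSpace ℝ (Fin n)),
      (∀ i, z ∈ boundariesRel n (K i)ᶜ) → z ∈ boundariesRel n (⋃ i, K i)ᶜ := by
  intro m
  induction m with
  | zero =>
    intro K _ _ z _
    refine chainsIn_le_boundariesRel _ ?_
    simpa using chainsIn_univ z
  | succ m ih =>
    intro K hK hconv z hz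
    have hcl : IsClosed (⋃ i : Fin m, K i.succ) :=
      isClosed_iUnion_of_finite fun i => (hK i.succ).isClosed
    rw [iUnion_fin_succ, Set.compl_union]
    refine mem_boundariesRel_inter (hK 0).isClosed.isOpen_compl hcl.isOpen_compl (hz 0)
      (ih _ (fun i => hK _) (fun i => hconv _) z fun i => hz _) ?_
    rw [← Set.compl_inter, Set.inter_iUnion]
    exact homologyVanishes_compl_iUnion m _ (fun i => (hK 0).inter (hK i.succ))
      (fun i => (hconv 0).inter (hconv i.succ)) _ le_rfl

/-- Top-dimensional relative classes in Euclidean space are determined locally. -/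
theorem mem_boundariesRel_compl_of_isCompact {n : ℕ} {K : Set (EuclideanSpace ℝ (Fin n))}
    (hK : IsCompact K) {z : RealSingularChain n (EuclideanSpace ℝ (Fin n))}
    (hz : ∀ x ∈ K, z ∈ boundariesRel n {x}ᶜ) : z ∈ boundariesRel n Kᶜ := by
  -- The remainder left by a filling at `x` is a finite chain with compact simplices missing `x`, so
  -- it misses a ball around `x`. Finitely many such balls, which are convex, cover `K`.
  have hloc : ∀ x ∈ K, ∃ r > 0, z ∈ boundariesRel n (Metric.closedBall x r)ᶜ := by
    intro x hx
    obtain ⟨d, hd⟩ := mem_boundariesRel.1 (hz x hx)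
    obtain ⟨O, hO, hxO, hdO⟩ := exists_isOpen_avoiding hd
    obtain ⟨r, hr, hball⟩ := Metric.nhds_basis_closedBall.mem_iff.1 (hO.mem_nhds hxO)
    exact ⟨r, hr, mem_boundariesRel.2 ⟨d, chainsIn_mono (Set.compl_subset_compl.2 hball) hdO⟩⟩
  choose! r hr hrz using hloc
  obtain ⟨t, htK, ht⟩ := hK.elim_nhds_subcover (fun x => Metric.closedBall x (r x))
    fun x hx => Metric.closedBall_mem_nhds x (hr x hx)
  let e := t.equivFin.symm
  refine boundariesRel_mono ?_ (mem_boundariesRel_compl_iUnion t.card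
    (fun i => Metric.closedBall (e i : EuclideanSpace ℝ (Fin n)) (r (e i)))
    (fun i => isCompact_closedBall _ _) (fun i => convex_closedBall _ _) z
    fun i => hrz _ (htK _ (e i).2))
  refine Set.compl_subset_compl.2 fun x hx => ?_
  obtain ⟨y, hy, hxy⟩ := Set.mem_iUnion₂.1 (ht hx)
  refine Set.mem_iUnion.2 ⟨e.symm ⟨y, hy⟩, ?_⟩
  simpa using hxy

end RealSingularChain

/-! ## Excision and localization in charts -/

namespace RealSingularChain

variable {k m : ℕ} {X Y : Type*} [TopologicalSpace X] [TopologicalSpace Y]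

theorem mem_chainsIn_of_push {j : C(X, Y)} (hj : Function.Injective j) {W : Set Y}
    {c : RealSingularChain k X} (hc : push j c ∈ chainsIn k W) : c ∈ chainsIn k (j ⁻¹' W) := by
  classical
  intro σ hσ
  have hinj : Function.Injective fun σ : SingularSimplex k X => j.comp σ := fun _ _ h =>
    ContinuousMap.ext fun t => hj (DFunLike.congr_fun h t)
  have : j.comp σ ∈ (push j c).support := by
    change _ ∈ (Finsupp.mapDomain _ c).support
    rw [Finsupp.mapDomain_support_of_injective hinj]
    exact Finset.mem_image_of_mem _ hσ
  rintro _ ⟨t, rfl⟩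
  exact hc this ⟨t, rfl⟩

theorem exists_push_eq {j : C(X, Y)} (hj : Topology.IsEmbedding j) {c : RealSingularChain k Y}
    (hc : c ∈ chainsIn k (Set.range j)) : ∃ c' : RealSingularChain k X, push j c' = c := by
  have : c ∈ LinearMap.range (push j : RealSingularChain k X →ₗ[ℝ] RealSingularChain k Y) := by
    have h := linearCombination_mem (N := LinearMap.range
      (push j : RealSingularChain k X →ₗ[ℝ] RealSingularChain k Y))
      (f := fun σ => Finsupp.single σ (1 : ℝ)) (fun σ hσ => ?_) hc
    · have e : Finsupp.linearCombination ℝ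
          (fun σ : SingularSimplex k Y => Finsupp.single σ (1 : ℝ)) c = c := by
        rw [Finsupp.linearCombination_apply]
        simp
      rwa [e] at h
    · refine ⟨Finsupp.single (⟨fun t => hj.toHomeomorph.symm ⟨σ t, hσ ⟨t, rfl⟩⟩, ?_⟩) 1, ?_⟩
      · exact hj.toHomeomorph.symm.continuous.comp (σ.continuous.subtype_mk _)
      · rw [push_single]
        congr 1
        ext t
        exact congrArg Subtype.val (hj.toHomeomorph.apply_symm_apply ⟨σ t, hσ ⟨t, rfl⟩⟩)
  exact this

/-- Excision: relative cycles modulo the complement of `K` come from a neighbourhood of `K`. -/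
theorem exists_sub_push_mem {j : C(X, Y)} (hj : Topology.IsOpenEmbedding j) {K : Set Y}
    (hK : IsClosed K) (hKj : K ⊆ Set.range j) {z : RealSingularChain (k + 1) Y}
    (hz : boundary z ∈ chainsIn k Kᶜ) : ∃ u : RealSingularChain (k + 1) X,
      z - push j u ∈ boundariesRel (k + 1) Kᶜ := by
  have hcover : Set.range j ∪ Kᶜ = Set.univ := by
    rw [Set.eq_univ_iff_forall]
    intro x
    by_cases hx : x ∈ K
    · exact Or.inl (hKj hx)
    · exact Or.inr hx
  obtain ⟨u, hu, v, hv, g, -, h⟩ := exists_decomposition hj.isOpen_range hK.isOpen_compl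
    (c := z) (hcover ▸ chainsIn_univ z) (Submodule.mem_sup_right hz)
  obtain ⟨u, rfl⟩ := exists_push_eq hj.isEmbedding hu
  refine ⟨u, ?_⟩
  have : z - push j u = v + boundary g := by rw [h]; abel
  rw [this]
  exact Submodule.add_mem _ (chainsIn_le_boundariesRel _ hv) (boundary_mem_boundariesRel _ g)

/-- Excision: relative boundaries modulo the complement of `L` are boundaries near `L`. -/
theorem mem_boundariesRel_of_push {j : C(X, Y)} (hj : Topology.IsOpenEmbedding j) {L : Set Y}
    (hL : IsClosed L) (hLj : L ⊆ Set.range j) {u : RealSingularChain k X}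
    (hu : push j u ∈ boundariesRel k Lᶜ) : u ∈ boundariesRel k (j ⁻¹' L)ᶜ := by
  have hcover : Set.range j ∪ Lᶜ = Set.univ := by
    rw [Set.eq_univ_iff_forall]
    intro x
    by_cases hx : x ∈ L
    · exact Or.inl (hLj hx)
    · exact Or.inr hx
  obtain ⟨d, hd⟩ := mem_boundariesRel.1 hu
  obtain ⟨a, ha, b, hb, g, -, h⟩ := exists_decomposition hj.isOpen_range hL.isOpen_compl
    (c := d) (hcover ▸ chainsIn_univ d) (by
      have h1 : boundary d = push j u - (push j u - boundary d) := by abel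
      rw [h1]
      exact Submodule.sub_mem _ (Submodule.mem_sup_left (push_mem_of_range j subset_rfl u))
        (Submodule.mem_sup_right hd))
  obtain ⟨a, rfl⟩ := exists_push_eq hj.isEmbedding ha
  refine mem_boundariesRel.2 ⟨a, mem_chainsIn_of_push (W := Lᶜ) hj.injective ?_⟩
  have := Submodule.add_mem _ hd (boundary_mem hb)
  convert this using 1
  rw [h, map_sub, push_boundary, map_add, map_add, boundary_boundary]
  abel

variable {M : Type*} [TopologicalSpace M] [T2Space M]

/-- A relative cycle near a compact subset of the domain of a chart can be read in the chart. -/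
theorem exists_chart_transfer [T2Space Y] (e : OpenPartialHomeomorph M Y) {K : Set M}
    (hK : IsCompact K) (hKe : K ⊆ e.source) {z : RealSingularChain (k + 1) M}
    (hz : boundary z ∈ chainsIn k Kᶜ) : ∃ y : RealSingularChain (k + 1) Y,
      boundary y ∈ chainsIn k (e '' K)ᶜ ∧ ∀ L ⊆ K, IsCompact L →
        (z ∈ boundariesRel (k + 1) Lᶜ ↔ y ∈ boundariesRel (k + 1) (e '' L)ᶜ) := by
  -- The target of the chart is an open subset of both `Y` and, through `e.symm`, of `M`. Excision
  -- is applied to both open embeddings.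
  let i : C(e.target, Y) := ⟨Subtype.val, continuous_subtype_val⟩
  have hi : Topology.IsOpenEmbedding i := e.open_target.isOpenEmbedding_subtypeVal
  let j : C(e.target, M) := ⟨fun y => e.symm y, e.continuousOn_symm.domRestrict⟩
  have hj : Topology.IsOpenEmbedding j := by
    have : (j : e.target → M) = Subtype.val ∘ e.toHomeomorphSourceTarget.symm := by
      ext y
      rfl
    rw [this]
    exact e.open_source.isOpenEmbedding_subtypeVal.comp
      e.toHomeomorphSourceTarget.symm.isOpenEmbedding
  have hjr : Set.range j = e.source := by
    ext x
    refine ⟨?_, fun hx => ⟨⟨e x, e.map_source hx⟩, e.left_inv hx⟩⟩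
    rintro ⟨y, rfl⟩
    exact e.map_target y.2
  have hir : Set.range i = e.target := Subtype.range_coe
  have hpre : ∀ L ⊆ e.source, i ⁻¹' (e '' L) = j ⁻¹' L := by
    intro L hL
    ext y
    constructor
    · rintro ⟨x, hx, hxy⟩
      have : j y = x := by
        change e.symm (i y) = x
        rw [← hxy]
        exact e.left_inv (hL hx)
      change j y ∈ L
      rwa [this]
    · intro hy
      exact ⟨j y, hy, e.right_inv y.2⟩
  have himage : ∀ L ⊆ e.source, IsCompact L → IsCompact (e '' L) := fun L hL hc =>
    hc.image_of_continuousOn (e.continuousOn.mono hL)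
  obtain ⟨u, hu⟩ := exists_sub_push_mem hj hK.isClosed (hjr ▸ hKe) hz
  refine ⟨push i u, ?_, fun L hLK hL => ?_⟩
  · obtain ⟨d, hd⟩ := mem_boundariesRel.1 hu
    have h₁ : push j (boundary u) ∈ chainsIn k Kᶜ := by
      have := Submodule.sub_mem _ hz (boundary_mem hd)
      rw [map_sub, map_sub, boundary_boundary, sub_zero, sub_sub_cancel] at this
      rwa [push_boundary]
    rw [← push_boundary]
    refine push_mem (V := (j ⁻¹' K)ᶜ) (W := (e '' K)ᶜ) i (fun y hy hmem => hy ?_) (mem_chainsIn_of_push hj.injective h₁)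
    have : y ∈ i ⁻¹' (e '' K) := hmem
    rwa [hpre K hKe] at this
  · have hLs := hLK.trans hKe
    have h₀ : z - push j u ∈ boundariesRel (k + 1) Lᶜ :=
      boundariesRel_mono (Set.compl_subset_compl.2 hLK) hu
    constructor
    · intro h
      have h₁ := Submodule.sub_mem _ h h₀
      rw [sub_sub_cancel] at h₁
      have h₂ := mem_boundariesRel_of_push hj hL.isClosed (hjr ▸ hLs) h₁
      rw [← hpre L hLs] at h₂
      exact push_mem_boundariesRel i (fun y hy => hy) h₂
    · intro h
      have h₂ := mem_boundariesRel_of_push hi (himage L hLs hL).isClosed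
        (by rw [hir]; rintro _ ⟨x, hx, rfl⟩; exact e.map_source (hLs hx)) h
      rw [hpre L hLs] at h₂
      have h₁ : push j u ∈ boundariesRel (k + 1) Lᶜ :=
        push_mem_boundariesRel j (fun y hy => hy) h₂
      have := Submodule.add_mem _ h₀ h₁
      rwa [sub_add_cancel] at this

/-- Top-dimensional relative classes near a compact subset of a chart are determined locally. -/
theorem mem_boundariesRel_of_chart {n : ℕ}
    (e : OpenPartialHomeomorph M (EuclideanSpace ℝ (Fin (n + 1)))) {K : Set M} (hK : IsCompact K)
    (hKe : K ⊆ e.source) {z : RealSingularChain (n + 1) M} (hz : boundary z ∈ chainsIn n Kᶜ)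
    (hloc : ∀ x ∈ K, z ∈ boundariesRel (n + 1) {x}ᶜ) : z ∈ boundariesRel (n + 1) Kᶜ := by
  obtain ⟨y, -, hy⟩ := exists_chart_transfer e hK hKe hz
  refine (hy K subset_rfl hK).2 (mem_boundariesRel_compl_of_isCompact
    (hK.image_of_continuousOn (e.continuousOn.mono hKe)) ?_)
  rintro _ ⟨x, hx, rfl⟩
  have := (hy {x} (by simpa using hx) isCompact_singleton).1 (hloc x hx)
  rwa [Set.image_singleton] at this

/-- Relative classes near a compact subset of a chart that is convex in the chart are determined
at any of its points. -/
theorem mem_boundariesRel_of_convex_chart {E : Type*} [NormedAddCommGroup E] [NormedSpace ℝ E]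
    (e : OpenPartialHomeomorph M E) {K : Set M} (hK : IsCompact K)
    (hKe : K ⊆ e.source) (hconv : Convex ℝ (e '' K)) {z : RealSingularChain (k + 1) M}
    (hz : boundary z ∈ chainsIn k Kᶜ) {p : M} (hp : p ∈ K)
    (hzp : z ∈ boundariesRel (k + 1) {p}ᶜ) : z ∈ boundariesRel (k + 1) Kᶜ := by
  obtain ⟨y, hby, hy⟩ := exists_chart_transfer e hK hKe hz
  refine (hy K subset_rfl hK).2 (mem_boundariesRel_of_starConvex
    (hconv.starConvex (Set.mem_image_of_mem e hp))
    (hK.image_of_continuousOn (e.continuousOn.mono hKe)).isBounded hby ?_)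
  have := (hy {p} (by simpa using hp) isCompact_singleton).1 hzp
  rwa [Set.image_singleton] at this

end RealSingularChain

/-! ## Path-connectedness of the matrices of positive determinant -/

namespace Matrix

variable {n : ℕ}

theorem joinedIn_mul {A A' B B' : Matrix (Fin n) (Fin n) ℝ}
    (h : JoinedIn {M : Matrix (Fin n) (Fin n) ℝ | M.det ≠ 0} A A')
    (h' : JoinedIn {M : Matrix (Fin n) (Fin n) ℝ | M.det ≠ 0} B B') :
    JoinedIn {M : Matrix (Fin n) (Fin n) ℝ | M.det ≠ 0} (A * B) (A' * B') := by
  obtain ⟨γ, hγ⟩ := h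
  obtain ⟨δ, hδ⟩ := h'
  refine ⟨⟨⟨fun t => γ t * δ t, γ.continuous.mul δ.continuous⟩, by simp, by simp⟩, fun t => ?_⟩
  change (γ t * δ t).det ≠ 0
  rw [det_mul]
  exact mul_ne_zero (hγ t) (hδ t)

/-- The reflection along a vector. -/
noncomputable def reflection (v : Fin n → ℝ) : Matrix (Fin n) (Fin n) ℝ :=
  1 - (2 / (v ⬝ᵥ v)) • vecMulVec v v

theorem reflection_mul_self {v : Fin n → ℝ} (hv : v ⬝ᵥ v ≠ 0) :
    reflection v * reflection v = 1 := by
  have h : vecMulVec v v * vecMulVec v v = (v ⬝ᵥ v) • vecMulVec v v := by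
    rw [vecMulVec_mul_vecMulVec, vecMulVec_smul]
  rw [reflection, mul_sub, mul_one, sub_mul, one_mul, smul_mul_smul_comm, h,
    smul_smul]
  have : 2 / (v ⬝ᵥ v) * (2 / (v ⬝ᵥ v)) * (v ⬝ᵥ v) = 2 / (v ⬝ᵥ v) + 2 / (v ⬝ᵥ v) := by
    field_simp; norm_num
  rw [this, add_smul]
  abel

theorem reflection_single (i : Fin n) :
    reflection (Pi.single i 1) = diagonal (Function.update 1 i (-1)) := by
  ext a b
  simp only [reflection, sub_apply, smul_apply, vecMulVec_apply, smul_eq_mul, diagonal_apply,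
    one_apply, single_dotProduct, Pi.single_eq_same, one_mul]
  by_cases hab : a = b
  · subst hab
    by_cases ha : a = i
    · subst ha; simp; norm_num
    · simp [ha]
  · by_cases ha : a = i
    · subst ha
      simp [hab]
    · simp [hab, ha]

/-- The vectors `(1 - u) e_i + u e_j` never vanish, so the reflections along them form a path of
invertible matrices. -/
theorem joinedIn_reflection (i j : Fin n) :
    JoinedIn {M : Matrix (Fin n) (Fin n) ℝ | M.det ≠ 0}
      (diagonal (Function.update 1 i (-1))) (diagonal (Function.update 1 j (-1))) := by
  rcases eq_or_ne i j with rfl | hij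
  · refine JoinedIn.refl ?_
    change (diagonal _).det ≠ 0
    rw [← reflection_single]
    have := congrArg det (reflection_mul_self (v := Pi.single i (1 : ℝ)) (by simp))
    rw [det_mul, det_one] at this
    exact left_ne_zero_of_mul_eq_one this
  let v : ℝ → Fin n → ℝ := fun u => Pi.single i (1 - u) + Pi.single j u
  have hvv : ∀ u, v u ⬝ᵥ v u = (1 - u) ^ 2 + u ^ 2 := fun u => by
    simp only [v, add_dotProduct, single_dotProduct, Pi.add_apply, Pi.single_eq_same,
      Pi.single_eq_of_ne hij, Pi.single_eq_of_ne hij.symm]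
    ring
  have hv : ∀ u, v u ⬝ᵥ v u ≠ 0 := fun u => by
    rw [hvv]
    nlinarith [sq_nonneg (2 * u - 1)]
  have hvc : Continuous v := by
    refine continuous_pi fun l => ?_
    simp only [v, Pi.add_apply, Pi.single_apply]
    split_ifs <;> fun_prop
  refine JoinedIn.ofLine (f := fun u => reflection (v u)) ?_ ?_ ?_ ?_
  · refine Continuous.continuousOn (continuous_const.sub (Continuous.smul
      (continuous_const.div (hvc.dotProduct hvc) hv) ?_))
    exact hvc.matrix_vecMulVec hvc
  · simp [v, ← reflection_single]
  · simp [v, ← reflection_single]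
  · rintro _ ⟨u, _, rfl⟩
    have := congrArg det (reflection_mul_self (hv u))
    rw [det_mul, det_one] at this
    exact left_ne_zero_of_mul_eq_one this

theorem joinedIn_diagonal_update (i : Fin n) {a b : ℝ} (hab : 0 < a * b) :
    JoinedIn {M : Matrix (Fin n) (Fin n) ℝ | M.det ≠ 0}
      (diagonal (Function.update 1 i a)) (diagonal (Function.update 1 i b)) := by
  refine JoinedIn.ofLine (f := fun u => diagonal (Function.update 1 i ((1 - u) * a + u * b)))
    ?_ (by simp) (by simp) ?_
  · exact (Continuous.matrix_diagonal (continuous_const.update i (by fun_prop))).continuousOn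
  · rintro _ ⟨u, hu, rfl⟩
    change det _ ≠ 0
    rw [det_diagonal, Finset.prod_update_of_mem (Finset.mem_univ i)]
    simp only [Pi.one_apply, Finset.prod_const_one, mul_one]
    have ha : a ≠ 0 := left_ne_zero_of_mul hab.ne'
    intro h
    have h1 : 0 < a * a := mul_self_pos.2 ha
    have : (1 - u) * (a * a) + u * (a * b) = 0 := by
      linear_combination a * h
    rcases hu.1.eq_or_lt with rfl | hu0
    · simp [ha] at this
    · have := mul_pos hu0 hab
      have := mul_nonneg (sub_nonneg.2 hu.2) h1.le
      linarith

/-- Invertible matrices are products of transvections, which contract to `1`, and diagonal matrices,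
whose entries deform to `±1`. All reflections in coordinate hyperplanes are joined to the one with
index `0`, which squares to `1`, so the dichotomy is closed under products. -/
theorem joinedIn_one_or {A : Matrix (Fin (n + 1)) (Fin (n + 1)) ℝ} (hA : A.det ≠ 0) :
    JoinedIn {M : Matrix (Fin (n + 1)) (Fin (n + 1)) ℝ | M.det ≠ 0} A 1 ∨
    JoinedIn {M : Matrix (Fin (n + 1)) (Fin (n + 1)) ℝ | M.det ≠ 0} A
      (diagonal (Function.update 1 0 (-1))) := by
  have hS : diagonal (Function.update 1 0 (-1)) * diagonal (Function.update 1 0 (-1)) =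
      (1 : Matrix (Fin (n + 1)) (Fin (n + 1)) ℝ) := by
    rw [← reflection_single]
    exact reflection_mul_self (by simp)
  have hmul : ∀ A B : Matrix (Fin (n + 1)) (Fin (n + 1)) ℝ,
      (JoinedIn {M : Matrix (Fin (n + 1)) (Fin (n + 1)) ℝ | M.det ≠ 0} A 1 ∨
        JoinedIn {M : Matrix (Fin (n + 1)) (Fin (n + 1)) ℝ | M.det ≠ 0} A
          (diagonal (Function.update 1 0 (-1)))) →
      (JoinedIn {M : Matrix (Fin (n + 1)) (Fin (n + 1)) ℝ | M.det ≠ 0} B 1 ∨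
        JoinedIn {M : Matrix (Fin (n + 1)) (Fin (n + 1)) ℝ | M.det ≠ 0} B
          (diagonal (Function.update 1 0 (-1)))) →
      (JoinedIn {M : Matrix (Fin (n + 1)) (Fin (n + 1)) ℝ | M.det ≠ 0} (A * B) 1 ∨
        JoinedIn {M : Matrix (Fin (n + 1)) (Fin (n + 1)) ℝ | M.det ≠ 0} (A * B)
          (diagonal (Function.update 1 0 (-1)))) := by
    rintro A B (hA | hA) (hB | hB)
    · exact Or.inl (by simpa using joinedIn_mul hA hB)
    · exact Or.inr (by simpa using joinedIn_mul hA hB)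
    · exact Or.inr (by simpa using joinedIn_mul hA hB)
    · exact Or.inl (hS ▸ joinedIn_mul hA hB)
  refine diagonal_transvection_induction_of_det_ne_zero (fun A =>
    JoinedIn {M : Matrix (Fin (n + 1)) (Fin (n + 1)) ℝ | M.det ≠ 0} A 1 ∨
    JoinedIn {M : Matrix (Fin (n + 1)) (Fin (n + 1)) ℝ | M.det ≠ 0} A
      (diagonal (Function.update 1 0 (-1)))) A hA ?_ ?_ ?_
  · intro D hD
    have hDi : ∀ i, D i ≠ 0 := by
      rw [det_diagonal] at hD
      exact fun i => Finset.prod_ne_zero_iff.1 hD i (Finset.mem_univ i)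
    have hsingle : ∀ i, JoinedIn {M : Matrix (Fin (n + 1)) (Fin (n + 1)) ℝ | M.det ≠ 0}
        (diagonal (Function.update 1 i (D i))) 1 ∨
        JoinedIn {M : Matrix (Fin (n + 1)) (Fin (n + 1)) ℝ | M.det ≠ 0}
        (diagonal (Function.update 1 i (D i))) (diagonal (Function.update 1 0 (-1))) := by
      intro i
      rcases lt_or_gt_of_ne (hDi i) with h | h
      · exact Or.inr ((joinedIn_diagonal_update i (by linarith)).trans (joinedIn_reflection i 0))
      · refine Or.inl ?_
        have := joinedIn_diagonal_update i (a := D i) (b := 1) (by linarith)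
        rwa [show Function.update (1 : Fin (n + 1) → ℝ) i 1 = 1 from
          Function.update_eq_self i (1 : Fin (n + 1) → ℝ), diagonal_one'] at this
    have hfin : ∀ s : Finset (Fin (n + 1)),
        JoinedIn {M : Matrix (Fin (n + 1)) (Fin (n + 1)) ℝ | M.det ≠ 0}
          (diagonal fun i => if i ∈ s then D i else 1) 1 ∨
        JoinedIn {M : Matrix (Fin (n + 1)) (Fin (n + 1)) ℝ | M.det ≠ 0}
          (diagonal fun i => if i ∈ s then D i else 1) (diagonal (Function.update 1 0 (-1))) := by
      intro s
      induction s using Finset.induction_on with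
      | empty =>
        refine Or.inl ?_
        simp only [Finset.notMem_empty, if_false, diagonal_one]
        exact JoinedIn.refl (by simp)
      | insert i s hi ih =>
        have : (diagonal fun l => if l ∈ insert i s then D l else 1) =
            diagonal (Function.update 1 i (D i)) * diagonal fun l => if l ∈ s then D l else 1 := by
          rw [diagonal_mul_diagonal]
          congr 1
          ext l
          by_cases hl : l = i
          · subst hl; simp [hi]
          · simp [hl]
        rw [this]
        exact hmul _ _ (hsingle i) ih
    simpa using hfin Finset.univ
  · intro t
    refine Or.inl (JoinedIn.ofLine (f := fun u => transvection t.i t.j ((1 - u) * t.c)) ?_ ?_ ?_ ?_)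
    · refine Continuous.continuousOn (continuous_matrix fun a b => ?_)
      simp only [transvection, add_apply, single_apply]
      split_ifs <;> fun_prop
    · simp [TransvectionStruct.toMatrix]
    · simp
    · rintro _ ⟨u, _, rfl⟩
      change det _ ≠ 0
      rw [det_transvection_of_ne _ _ t.hij]
      exact one_ne_zero
  · intro A B _ _ hA hB
    exact hmul A B hA hB

/-- The space of matrices of positive determinant is path-connected. -/
theorem joinedIn_det_pos {A B : Matrix (Fin (n + 1)) (Fin (n + 1)) ℝ} (hA : 0 < A.det)
    (hB : 0 < B.det) : JoinedIn {M : Matrix (Fin (n + 1)) (Fin (n + 1)) ℝ | 0 < M.det} A B := by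
  -- By the intermediate value theorem a path of invertible matrices keeps the sign of the
  -- determinant; this excludes the reflection as an endpoint.
  have hpos : ∀ {A B : Matrix (Fin (n + 1)) (Fin (n + 1)) ℝ}, 0 < A.det →
      ∀ γ : Path A B, (∀ t, (γ t).det ≠ 0) → ∀ t, 0 < (γ t).det := by
    intro A B hA γ hγ t
    by_contra! h
    obtain ⟨s, hs⟩ := mem_range_of_exists_le_of_exists_ge (γ.continuous.matrix_det)
      ⟨t, h⟩ ⟨0, by simpa using hA.le⟩
    exact hγ s hs
  have key : ∀ {A : Matrix (Fin (n + 1)) (Fin (n + 1)) ℝ}, 0 < A.det →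
      JoinedIn {M : Matrix (Fin (n + 1)) (Fin (n + 1)) ℝ | 0 < M.det} A 1 := by
    intro A hA
    rcases joinedIn_one_or hA.ne' with ⟨γ, hγ⟩ | ⟨γ, hγ⟩
    · exact ⟨γ, hpos hA γ hγ⟩
    · have := hpos hA γ hγ 1
      rw [γ.target, det_diagonal, Finset.prod_update_of_mem (Finset.mem_univ _)] at this
      norm_num at this
  exact (key hA).trans (key hB).symm

end Matrix

/-! ## Affine simplices in charts -/

open RealSingularChain Matrix

/-- The displacement from the point with barycentric coordinates `t` to the one with barycentric
coordinates `s` in the affine simplex whose edge vectors are the rows of `A`. -/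
noncomputable def simplexOffset {n : ℕ} (A : Matrix (Fin n) (Fin n) ℝ)
    (t s : stdSimplex ℝ (Fin (n + 1))) : EuclideanSpace ℝ (Fin n) :=
  WithLp.toLp 2 ((fun j : Fin n => s j.succ - t j.succ) ᵥ* A)

section Offset

variable {n : ℕ}

theorem stdSimplex_ext_succ {s t : stdSimplex ℝ (Fin (n + 1))}
    (h : ∀ j : Fin n, s j.succ = t j.succ) : s = t := by
  ext i
  refine Fin.cases ?_ h i
  have hs := stdSimplex.sum_eq_one s
  have ht := stdSimplex.sum_eq_one t
  rw [Fin.sum_univ_succ] at hs ht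
  rw [Finset.sum_congr rfl fun j _ => h j] at hs
  linarith

theorem simplexOffset_self (A : Matrix (Fin n) (Fin n) ℝ) (t : stdSimplex ℝ (Fin (n + 1))) :
    simplexOffset A t t = 0 := by
  rw [simplexOffset, show (fun j : Fin n => t j.succ - t j.succ) = 0 from funext fun _ =>
    sub_self _, Matrix.zero_vecMul]
  rfl

theorem simplexOffset_eq_zero {A : Matrix (Fin n) (Fin n) ℝ} (hA : A.det ≠ 0)
    {t s : stdSimplex ℝ (Fin (n + 1))} (h : simplexOffset A t s = 0) : s = t := by
  have h' : (fun j : Fin n => s j.succ - t j.succ) ᵥ* A = 0 := by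
    simpa [simplexOffset] using h
  have := Matrix.eq_zero_of_vecMul_eq_zero hA h'
  exact stdSimplex_ext_succ fun j => sub_eq_zero.1 (congrFun this j)

theorem simplexOffset_smul (A : Matrix (Fin n) (Fin n) ℝ) (r : ℝ)
    (t s : stdSimplex ℝ (Fin (n + 1))) : simplexOffset (r • A) t s = r • simplexOffset A t s := by
  simp [simplexOffset, Matrix.vecMul_smul]

theorem simplexOffset_add (A : Matrix (Fin n) (Fin n) ℝ) (t t' s : stdSimplex ℝ (Fin (n + 1))) :
    simplexOffset A t t' + simplexOffset A t' s = simplexOffset A t s := by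
  simp only [simplexOffset, ← WithLp.toLp_add, ← Matrix.add_vecMul]
  congr 2
  ext j
  simp

theorem continuous_simplexOffset :
    Continuous fun q : Matrix (Fin n) (Fin n) ℝ × stdSimplex ℝ (Fin (n + 1)) ×
      stdSimplex ℝ (Fin (n + 1)) => simplexOffset q.1 q.2.1 q.2.2 := by
  refine (PiLp.continuous_toLp 2 _).comp (Continuous.matrix_vecMul ?_ continuous_fst)
  refine continuous_pi fun j => Continuous.sub ?_ ?_
  · exact (continuous_apply j.succ).comp (continuous_subtype_val.comp
      (continuous_snd.comp continuous_snd))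
  · exact (continuous_apply j.succ).comp (continuous_subtype_val.comp
      (continuous_fst.comp continuous_snd))

theorem sum_smul_eq_add_offset (v : Fin (n + 1) → EuclideanSpace ℝ (Fin n))
    (t s : stdSimplex ℝ (Fin (n + 1))) : ∑ i, s i • v i = ∑ i, t i • v i +
      simplexOffset (Matrix.of fun i j : Fin n => (v i.succ - v 0) j) t s := by
  have h : ∀ s : stdSimplex ℝ (Fin (n + 1)), ∑ i, s i • v i =
      v 0 + ∑ j : Fin n, s j.succ • (v j.succ - v 0) := by
    intro s
    have hs := stdSimplex.sum_eq_one s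
    rw [Fin.sum_univ_succ] at hs ⊢
    simp only [smul_sub, Finset.sum_sub_distrib, ← Finset.sum_smul]
    rw [show s 0 = 1 - ∑ j : Fin n, s j.succ by linarith, sub_smul, one_smul]
    abel
  rw [h s, h t, add_assoc]
  congr 1
  ext l
  simp [simplexOffset, Matrix.vecMul, dotProduct, sub_mul]

/-- The convex combination of two points of a standard simplex. -/
noncomputable def stdSimplex.segmentMap {k : ℕ} (t s : stdSimplex ℝ (Fin (k + 1)))
    (u : unitInterval) : stdSimplex ℝ (Fin (k + 1)) :=
  ⟨fun i => (1 - u : ℝ) * t i + u * s i, convex_stdSimplex ℝ _ t.2 s.2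
    (sub_nonneg.2 u.2.2) u.2.1 (by ring)⟩

theorem stdSimplex.continuous_segmentMap {k : ℕ} :
    Continuous fun q : stdSimplex ℝ (Fin (k + 1)) × stdSimplex ℝ (Fin (k + 1)) × unitInterval =>
      stdSimplex.segmentMap q.1 q.2.1 q.2.2 := by
  refine Continuous.subtype_mk (continuous_pi fun i => ?_) _
  have h₁ : Continuous fun q : stdSimplex ℝ (Fin (k + 1)) × stdSimplex ℝ (Fin (k + 1)) ×
      unitInterval => q.1 i := (continuous_apply i).comp (continuous_subtype_val.comp continuous_fst)
  have h₂ : Continuous fun q : stdSimplex ℝ (Fin (k + 1)) × stdSimplex ℝ (Fin (k + 1)) ×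
      unitInterval => q.2.1 i := (continuous_apply i).comp (continuous_subtype_val.comp
        (continuous_fst.comp continuous_snd))
  have h₃ : Continuous fun q : stdSimplex ℝ (Fin (k + 1)) × stdSimplex ℝ (Fin (k + 1)) ×
      unitInterval => (q.2.2 : ℝ) := continuous_subtype_val.comp
        (continuous_snd.comp continuous_snd)
  exact ((continuous_const.sub h₃).mul h₁).add (h₃.mul h₂)

theorem simplexOffset_segmentMap (A : Matrix (Fin n) (Fin n) ℝ)
    (t s : stdSimplex ℝ (Fin (n + 1))) (u : unitInterval) :
    simplexOffset A t (stdSimplex.segmentMap t s u) = (u : ℝ) • simplexOffset A t s := by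
  rw [simplexOffset, simplexOffset, ← WithLp.toLp_smul, ← Matrix.smul_vecMul]
  congr 2
  ext j
  change (1 - u : ℝ) * t j.succ + u * s j.succ - t j.succ = u * (s j.succ - t j.succ)
  ring

end Offset

/-! ### Homotopies of a simplex whose faces avoid a point. -/

namespace RealSingularChain

variable {k : ℕ} {M : Type*} [TopologicalSpace M]

theorem boundary_single_id_mem : boundary (Finsupp.single (ContinuousMap.id _ :
    SingularSimplex (k + 1) (stdSimplex ℝ (Fin (k + 2)))) 1) ∈
      chainsIn k {s : stdSimplex ℝ (Fin (k + 2)) | ∃ i, s i = 0} := by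
  rw [boundary_single]
  refine Submodule.sum_mem _ fun i _ => Submodule.smul_mem _ _ (single_mem_chainsIn ?_ 1)
  rintro _ ⟨s, rfl⟩
  refine ⟨i, ?_⟩
  change stdSimplex.map i.succAbove s i = 0
  rw [stdSimplex.map_coe, FunOnFinite.linearMap_apply_apply]
  refine Finset.sum_eq_zero fun j hj => ?_
  exact absurd (Finset.mem_filter.1 hj).2 (Fin.succAbove_ne i j)

theorem boundary_single_mem_of_forall {W : Set M} {τ : SingularSimplex (k + 1) M}
    (h : ∀ s, (∃ i, s i = 0) → τ s ∈ W) : boundary (Finsupp.single τ 1) ∈ chainsIn k W := by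
  have : Finsupp.single τ (1 : ℝ) = push τ (Finsupp.single (ContinuousMap.id _) 1) := by
    rw [push_single]
    rfl
  rw [this, ← push_boundary]
  exact push_mem τ (fun s hs => h s hs) boundary_single_id_mem

/-- Two simplices that are homotopic with faces avoiding `x` are homologous at `x`. -/
theorem single_sub_single_mem_of_homotopy {x : M}
    (G : stdSimplex ℝ (Fin (k + 2)) × unitInterval → M) (hG : Continuous G)
    (hx : ∀ s u, G (s, u) = x → ∀ i, 0 < s i) {τ τ' : SingularSimplex (k + 1) M}
    (h₀ : ∀ s, G (s, 0) = τ s) (h₁ : ∀ s, G (s, 1) = τ' s) :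
    Finsupp.single τ 1 - Finsupp.single τ' 1 ∈ boundariesRel (k + 1) {x}ᶜ := by
  have h := push_sub_push_mem_of_homotopy (V := {s : stdSimplex ℝ (Fin (k + 2)) | ∃ i, s i = 0})
    (W := {x}ᶜ) (fun q => G (q.1, Set.projIcc 0 1 zero_le_one q.2))
    (hG.comp (continuous_fst.prodMk (continuous_projIcc.comp continuous_snd))).continuousOn
    (fun s hs u _ hmem => by
      obtain ⟨i, hi⟩ := hs
      exact (hx _ _ hmem i).ne' hi) τ τ'
    (fun s => by rw [← h₀]; congr 2; exact Set.projIcc_left _)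
    (fun s => by rw [← h₁]; congr 2; exact Set.projIcc_right _)
    (boundary_single_id_mem (k := k))
  have := Submodule.neg_mem _ h
  rw [neg_sub, push_single, push_single] at this
  exact this

end RealSingularChain

/-! ### Affine simplices in a single chart. -/

section ChartSimplex

variable {k : ℕ} {M : Type*} [TopologicalSpace M]

/-- Read in the chart `e`, the simplex `τ` is affine with edge matrix `A`, and it takes the value
`x` at the point with barycentric coordinates `t`. -/
def IsChartSimplex {n : ℕ} (e : OpenPartialHomeomorph M (EuclideanSpace ℝ (Fin n))) (x : M)
    (t : stdSimplex ℝ (Fin (n + 1))) (A : Matrix (Fin n) (Fin n) ℝ) (τ : SingularSimplex n M) :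
    Prop :=
  τ t = x ∧ ∀ s, τ s ∈ e.source ∧ e (τ s) = e x + simplexOffset A t s

/-- Vertices are traded for an edge matrix and the barycentric position of `x`. In these parameters
deformations that keep `x` inside the simplex are paths of matrices and of interior points. -/
theorem SmoothOrientation.isPositiveSimplexAt_iff {n : ℕ}
    [ChartedSpace (EuclideanSpace ℝ (Fin n)) M] (o : SmoothOrientation n M) {x : M}
    {τ : SingularSimplex n M} : o.IsPositiveSimplexAt x τ ↔ ∃ e ∈ o.charts, ∃ t A,
      (∀ i, 0 < t i) ∧ 0 < A.det ∧ IsChartSimplex e x t A τ := by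
  constructor
  · rintro ⟨e, he, v, hv, hτ, t, ht, hx⟩
    refine ⟨e, he, t, _, ht, hv, hx, fun s => ⟨(hτ s).1, ?_⟩⟩
    rw [(hτ s).2, ← hx, (hτ t).2]
    exact sum_smul_eq_add_offset v t s
  · rintro ⟨e, he, t, A, ht, hA, hx, hτ⟩
    let v : Fin (n + 1) → EuclideanSpace ℝ (Fin n) := fun i =>
      e x + simplexOffset A t (stdSimplex.vertex i)
    have hv : (Matrix.of fun i j : Fin n => (v i.succ - v 0) j) = A := by
      have : ∀ i : Fin n, v i.succ - v 0 = WithLp.toLp 2 (A i) := by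
        intro i
        have h1 : v i.succ - v 0 = simplexOffset A (stdSimplex.vertex 0)
            (stdSimplex.vertex i.succ) := by
          simp only [v, add_sub_add_left_eq_sub]
          exact sub_eq_of_eq_add' (simplexOffset_add A t _ _).symm
        rw [h1, simplexOffset]
        congr 1
        have : (fun j : Fin n => stdSimplex.vertex (S := ℝ) i.succ j.succ -
            stdSimplex.vertex (S := ℝ) (0 : Fin (n + 1)) j.succ) = Pi.single i 1 := by
          ext j
          simp [Pi.single_apply]
        rw [this, Matrix.single_one_vecMul]
        rfl
      ext i j
      rw [Matrix.of_apply, this]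
    refine ⟨e, he, v, by rwa [hv], fun s => ⟨(hτ s).1, ?_⟩, t, ht, hx⟩
    have hsum : ∑ i, s i • v i = e x + ∑ i, s i • simplexOffset A t (stdSimplex.vertex i) := by
      simp only [v, smul_add, Finset.sum_add_distrib, ← Finset.sum_smul, stdSimplex.sum_eq_one,
        one_smul]
    rw [(hτ s).2, hsum]
    congr 1
    have h2 := sum_smul_eq_add_offset v t s
    rw [hv, hsum] at h2
    have ht0 : ∑ i, t i • v i = e x := by
      have h3 : ∀ l, (∑ i, t i • v i) l = (e x) l := by
        intro l
        simp only [v, smul_add, Finset.sum_add_distrib, ← Finset.sum_smul, stdSimplex.sum_eq_one,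
          one_smul, PiLp.add_apply, add_eq_left]
        have : ∀ i, (t i • simplexOffset A t (stdSimplex.vertex i)) l =
            ∑ j : Fin n, t i * (stdSimplex.vertex (S := ℝ) i j.succ - t j.succ) * A j l := by
          intro i
          simp only [simplexOffset, PiLp.smul_apply, smul_eq_mul, Matrix.vecMul, dotProduct,
            Finset.mul_sum]
          exact Finset.sum_congr rfl fun j _ => by ring
        rw [WithLp.ofLp_sum, Finset.sum_apply, Finset.sum_congr rfl fun i _ => this i,
          Finset.sum_comm]
        refine Finset.sum_eq_zero fun j _ => ?_
        rw [← Finset.sum_mul]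
        have : ∑ i, t i * (stdSimplex.vertex (S := ℝ) i j.succ - t j.succ) = 0 := by
          simp only [mul_sub, Finset.sum_sub_distrib, ← Finset.sum_mul, stdSimplex.sum_eq_one]
          simp [Pi.single_apply]
        rw [this, zero_mul]
      exact PiLp.ext h3
    rw [ht0] at h2
    exact (add_left_cancel h2).symm

theorem IsChartSimplex.eq_iff {n : ℕ} {e : OpenPartialHomeomorph M (EuclideanSpace ℝ (Fin n))}
    {x : M} {t : stdSimplex ℝ (Fin (n + 1))} {A : Matrix (Fin n) (Fin n) ℝ}
    {τ : SingularSimplex n M} (h : IsChartSimplex e x t A τ) (hA : A.det ≠ 0) {s} :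
    τ s = x ↔ s = t := by
  refine ⟨fun hs => simplexOffset_eq_zero hA ?_, fun hs => hs ▸ h.1⟩
  have := (h.2 s).2
  rw [hs] at this
  exact (left_eq_add.1 this)

theorem IsChartSimplex.mem_source {n : ℕ}
    {e : OpenPartialHomeomorph M (EuclideanSpace ℝ (Fin n))}
    {x : M} {t : stdSimplex ℝ (Fin (n + 1))} {A : Matrix (Fin n) (Fin n) ℝ}
    {τ : SingularSimplex n M} (h : IsChartSimplex e x t A τ) : x ∈ e.source :=
  h.1 ▸ (h.2 t).1

theorem IsChartSimplex.scale_mem {n : ℕ} {e : OpenPartialHomeomorph M (EuclideanSpace ℝ (Fin n))}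
    {x : M} {t : stdSimplex ℝ (Fin (n + 1))} {A : Matrix (Fin n) (Fin n) ℝ}
    {τ : SingularSimplex n M} (h : IsChartSimplex e x t A τ) (r : unitInterval) (s) :
    e.symm (e x + (r : ℝ) • simplexOffset A t s) = τ (stdSimplex.segmentMap t s r) := by
  rw [← simplexOffset_segmentMap, ← (h.2 _).2, e.left_inv (h.2 _).1]

/-- Shrinking an affine simplex towards an interior point. -/
theorem IsChartSimplex.homologous_scale
    {e : OpenPartialHomeomorph M (EuclideanSpace ℝ (Fin (k + 1)))}
    {x : M} {t : stdSimplex ℝ (Fin (k + 2))} {A : Matrix (Fin (k + 1)) (Fin (k + 1)) ℝ}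
    {τ : SingularSimplex (k + 1) M} (h : IsChartSimplex e x t A τ) (hA : A.det ≠ 0)
    (ht : ∀ i, 0 < t i) {r : ℝ} (hr : 0 < r) (hr1 : r ≤ 1) {τ' : SingularSimplex (k + 1) M}
    (hτ' : ∀ s, τ' s = e.symm (e x + r • simplexOffset A t s)) :
    Finsupp.single τ 1 - Finsupp.single τ' 1 ∈ boundariesRel (k + 1) {x}ᶜ := by
  let ρ : unitInterval → unitInterval := fun u => ⟨1 - u * (1 - r), by
    have := u.2.2; have := u.2.1; nlinarith, by
    have := mul_nonneg u.2.1 (sub_nonneg.2 hr1); linarith⟩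
  have hρ : Continuous ρ := Continuous.subtype_mk (by fun_prop) _
  refine single_sub_single_mem_of_homotopy
    (fun q => τ (stdSimplex.segmentMap t q.1 (ρ q.2))) ?_ (fun s u hs => ?_) (fun s => ?_)
    (fun s => ?_)
  · exact τ.continuous.comp (stdSimplex.continuous_segmentMap.comp
      (continuous_const.prodMk (continuous_fst.prodMk (hρ.comp continuous_snd))))
  · have h1 := (h.eq_iff hA).1 hs
    have h2 := simplexOffset_segmentMap A t s (ρ u)
    simp only at h1
    rw [h1, simplexOffset_self] at h2
    have hpos : (0 : ℝ) < 1 - u * (1 - r) := by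
      have := u.2.2; have := u.2.1; nlinarith
    rw [simplexOffset_eq_zero hA ((smul_eq_zero.1 h2.symm).resolve_left hpos.ne')]
    exact ht
  · simp only [← h.scale_mem]
    simp only [ρ, Set.Icc.coe_zero, zero_mul, sub_zero, one_smul]
    rw [← (h.2 s).2, e.left_inv (h.2 s).1]
  · simp only [← h.scale_mem]
    rw [hτ']
    simp [ρ]

theorem exists_offset_bound {n : ℕ} {γ : unitInterval → Matrix (Fin n) (Fin n) ℝ}
    (hγ : Continuous γ) {t : unitInterval → stdSimplex ℝ (Fin (n + 1))} (ht : Continuous t) :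
    ∃ R : ℝ, 0 < R ∧ ∀ u s, ‖simplexOffset (γ u) (t u) s‖ < R := by
  have hc : Continuous fun q : unitInterval × stdSimplex ℝ (Fin (n + 1)) =>
      ‖simplexOffset (γ q.1) (t q.1) q.2‖ :=
    (continuous_simplexOffset.comp ((hγ.comp continuous_fst).prodMk
      ((ht.comp continuous_fst).prodMk continuous_snd))).norm
  obtain ⟨R, hR⟩ := (isCompact_range hc).bddAbove
  refine ⟨max R 0 + 1, by positivity, fun u s => ?_⟩
  have := hR ⟨(u, s), rfl⟩
  linarith [le_max_left R 0]

/-- Positive affine simplices around a point in the same chart are homologous at the point. -/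
theorem IsChartSimplex.homologous_of_same_chart
    {e : OpenPartialHomeomorph M (EuclideanSpace ℝ (Fin (k + 1)))}
    {x : M} {t t' : stdSimplex ℝ (Fin (k + 2))} {A A' : Matrix (Fin (k + 1)) (Fin (k + 1)) ℝ}
    {τ τ' : SingularSimplex (k + 1) M} (h : IsChartSimplex e x t A τ) (hA : 0 < A.det)
    (ht : ∀ i, 0 < t i) (h' : IsChartSimplex e x t' A' τ') (hA' : 0 < A'.det)
    (ht' : ∀ i, 0 < t' i) :
    Finsupp.single τ 1 - Finsupp.single τ' 1 ∈ boundariesRel (k + 1) {x}ᶜ := by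
  obtain ⟨γ, hγ⟩ := Matrix.joinedIn_det_pos hA hA'
  have hγd : ∀ u, 0 < (γ u).det := hγ
  have hx := h.mem_source
  have htc : Continuous fun u => stdSimplex.segmentMap t t' u :=
    stdSimplex.continuous_segmentMap.comp (continuous_const.prodMk
      (continuous_const.prodMk continuous_id))
  have htpos : ∀ u i, 0 < stdSimplex.segmentMap t t' u i := fun u i => by
    change 0 < (1 - u : ℝ) * t i + u * t' i
    rcases u.2.1.eq_or_lt with h0 | h0
    · rw [← h0]; simpa using ht i
    · have := mul_pos h0 (ht' i)
      have := mul_nonneg (sub_nonneg.2 u.2.2) (ht i).le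
      linarith
  obtain ⟨R, hR, hRb⟩ := exists_offset_bound γ.continuous htc
  obtain ⟨δ, hδ, hball⟩ := Metric.isOpen_iff.1 e.open_target _ (e.map_source hx)
  -- The intermediate simplices need not fit into the chart. Both ends are first shrunk by one
  -- factor `r` that keeps the whole family inside the ball of radius `δ`.
  obtain ⟨r, hr, hr1, hrR⟩ : ∃ r : ℝ, 0 < r ∧ r ≤ 1 ∧ r * R ≤ δ := by
    refine ⟨min 1 (δ / R), by positivity, min_le_left _ _, ?_⟩
    calc min 1 (δ / R) * R ≤ δ / R * R := mul_le_mul_of_nonneg_right (min_le_right _ _) hR.le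
      _ = δ := by field_simp
  have htarget : ∀ u s, e x + r • simplexOffset (γ u) (stdSimplex.segmentMap t t' u) s ∈
      e.target := fun u s => hball (by
    rw [Metric.mem_ball, dist_eq_norm, add_sub_cancel_left, norm_smul, Real.norm_eq_abs,
      abs_of_pos hr]
    exact (mul_lt_mul_of_pos_left (hRb u s) hr).trans_le hrR)
  let G : stdSimplex ℝ (Fin (k + 2)) × unitInterval → M := fun q =>
    e.symm (e x + r • simplexOffset (γ q.2) (stdSimplex.segmentMap t t' q.2) q.1)
  have hG : Continuous G := by
    refine e.continuousOn_symm.comp_continuous (continuous_const.add (Continuous.const_smul ?_ r))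
      (fun q => htarget q.2 q.1)
    exact continuous_simplexOffset.comp ((γ.continuous.comp continuous_snd).prodMk
      ((htc.comp continuous_snd).prodMk continuous_fst))
  have hGx : ∀ s u, G (s, u) = x → ∀ i, 0 < s i := by
    intro s u hs
    have h1 := congrArg e hs
    simp only [G] at h1
    rw [e.right_inv (htarget u s), add_eq_left] at h1
    rw [simplexOffset_eq_zero (hγd u).ne' ((smul_eq_zero.1 h1).resolve_left hr.ne')]
    exact htpos u
  have hs0 : stdSimplex.segmentMap t t' 0 = t := by
    ext i
    change (1 - ((0 : unitInterval) : ℝ)) * t i + ((0 : unitInterval) : ℝ) * t' i = t i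
    simp
  have hs1 : stdSimplex.segmentMap t t' 1 = t' := by
    ext i
    change (1 - ((1 : unitInterval) : ℝ)) * t i + ((1 : unitInterval) : ℝ) * t' i = t' i
    simp
  let σ : unitInterval → SingularSimplex (k + 1) M := fun u =>
    ⟨fun s => G (s, u), hG.comp (continuous_id.prodMk continuous_const)⟩
  have m₁ := h.homologous_scale hA.ne' ht hr hr1 (τ' := σ 0) (fun s => by simp [σ, G, hs0])
  have m₂ := h'.homologous_scale hA'.ne' ht' hr hr1 (τ' := σ 1) (fun s => by simp [σ, G, hs1])
  have m₃ := single_sub_single_mem_of_homotopy G hG hGx (τ := σ 0) (τ' := σ 1)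
    (fun _ => rfl) (fun _ => rfl)
  have := Submodule.sub_mem _ (Submodule.add_mem _ m₁ m₃) m₂
  convert this using 1
  abel

end ChartSimplex

/-! ## The local orientation generators -/

section LinearMaps

variable {n : ℕ}

/-- The matrix of a linear map acting on row vectors. -/
noncomputable def rowMatrix (L : EuclideanSpace ℝ (Fin n) →L[ℝ] EuclideanSpace ℝ (Fin n)) :
    Matrix (Fin n) (Fin n) ℝ :=
  Matrix.of fun i l => L (EuclideanSpace.single i 1) l

theorem map_toLp_eq (L : EuclideanSpace ℝ (Fin n) →L[ℝ] EuclideanSpace ℝ (Fin n))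
    (c : Fin n → ℝ) : L (WithLp.toLp 2 c) = WithLp.toLp 2 (c ᵥ* rowMatrix L) := by
  have h : WithLp.toLp 2 c = ∑ i, c i • EuclideanSpace.single i (1 : ℝ) := by
    ext l
    simp [Pi.single_apply]
  rw [h, map_sum]
  ext l
  simp [Matrix.vecMul, dotProduct, rowMatrix]

theorem det_rowMatrix (L : EuclideanSpace ℝ (Fin n) →L[ℝ] EuclideanSpace ℝ (Fin n)) :
    (rowMatrix L).det = L.det := by
  have : rowMatrix L = (LinearMap.toMatrix (EuclideanSpace.basisFun (Fin n) ℝ).toBasis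
      (EuclideanSpace.basisFun (Fin n) ℝ).toBasis (L : _ →ₗ[ℝ] _))ᵀ := by
    ext i j
    simp [rowMatrix, LinearMap.toMatrix_apply]
  rw [this, Matrix.det_transpose, LinearMap.det_toMatrix]

theorem map_simplexOffset (L : EuclideanSpace ℝ (Fin n) →L[ℝ] EuclideanSpace ℝ (Fin n))
    (A : Matrix (Fin n) (Fin n) ℝ) (t s : stdSimplex ℝ (Fin (n + 1))) :
    L (simplexOffset A t s) = simplexOffset (A * rowMatrix L) t s := by
  rw [simplexOffset, map_toLp_eq, Matrix.vecMul_vecMul]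
  rfl

end LinearMaps

/-! ### Change of chart and independence of the local generator. -/

section Orientation

variable {k : ℕ} {M : Type*} [TopologicalSpace M]

/-- An affine simplex in a chart is homologous to an affine simplex in any other chart. -/
theorem IsChartSimplex.exists_homologous_in_chart
    {e e' : OpenPartialHomeomorph M (EuclideanSpace ℝ (Fin (k + 1)))}
    {x : M} {t : stdSimplex ℝ (Fin (k + 2))} {A : Matrix (Fin (k + 1)) (Fin (k + 1)) ℝ}
    {τ : SingularSimplex (k + 1) M} (h : IsChartSimplex e x t A τ) (hA : 0 < A.det)
    (ht : ∀ i, 0 < t i) (hx' : x ∈ e'.source) (hdet : 0 < (fderiv ℝ (e' ∘ e.symm) (e x)).det) :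
    ∃ τ' A', 0 < A'.det ∧ IsChartSimplex e' x t A' τ' ∧
      Finsupp.single τ 1 - Finsupp.single τ' 1 ∈ boundariesRel (k + 1) {x}ᶜ := by
  have hx := h.mem_source
  set φ : EuclideanSpace ℝ (Fin (k + 1)) → EuclideanSpace ℝ (Fin (k + 1)) := e' ∘ e.symm with hφ
  set y := e x with hy
  set L := fderiv ℝ φ y with hL
  have hφy : φ y = e' x := by simp [hφ, hy, e.left_inv hx]
  have hdiff : HasFDerivAt φ L y := by
    refine DifferentiableAt.hasFDerivAt ?_
    -- Differentiability is encoded in the determinant: otherwise `fderiv` takes its default value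
    -- `0`, whose determinant is `0` as the dimension is positive.
    by_contra hnd
    rw [hL, fderiv_zero_of_not_differentiableAt hnd] at hdet
    rw [← det_rowMatrix, show rowMatrix (0 : EuclideanSpace ℝ (Fin (k + 1)) →L[ℝ]
      EuclideanSpace ℝ (Fin (k + 1))) = 0 from rfl, Matrix.det_zero] at hdet
    exact hdet.false
  obtain ⟨C, hC, hCL⟩ : ∃ C : ℝ, 0 < C ∧ ∀ v, ‖v‖ ≤ C * ‖L v‖ := by
    let L' := L.toContinuousLinearEquivOfDetNeZero hdet.ne'
    refine ⟨‖(L'.symm : EuclideanSpace ℝ (Fin (k + 1)) →L[ℝ] EuclideanSpace ℝ (Fin (k + 1)))‖ + 1,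
      by positivity, fun v => ?_⟩
    have h1 := (L'.symm : EuclideanSpace ℝ (Fin (k + 1)) →L[ℝ]
      EuclideanSpace ℝ (Fin (k + 1))).le_opNorm (L v)
    have h2 : (L'.symm : EuclideanSpace ℝ (Fin (k + 1)) →L[ℝ]
      EuclideanSpace ℝ (Fin (k + 1))) (L v) = v := L'.symm_apply_apply v
    rw [h2] at h1
    nlinarith [norm_nonneg (L v)]
  -- As `‖v‖ ≤ C ‖L v‖`, this makes the linearization error at most half of `‖L v‖`, so
  -- interpolation with the linear part cannot create new zeros.
  have herr := hdiff.isLittleO.def (show (0 : ℝ) < 1 / (2 * C) by positivity)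
  have hsrc : ∀ᶠ z in nhds y, z ∈ (e.symm.trans e').source :=
    (e.symm.trans e').open_source.mem_nhds (by
      rw [OpenPartialHomeomorph.trans_source, OpenPartialHomeomorph.symm_source]
      refine ⟨e.map_source hx, ?_⟩
      change e.symm y ∈ e'.source
      rwa [hy, e.left_inv hx])
  obtain ⟨δ₀, hδ₀, hδ⟩ := Metric.eventually_nhds_iff.1 (herr.and hsrc)
  obtain ⟨ρ, hρ, hball⟩ := Metric.isOpen_iff.1 e'.open_target _ (e'.map_source hx')
  obtain ⟨R, hR, hRb⟩ := exists_offset_bound (γ := fun _ => A) continuous_const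
    (t := fun _ => t) continuous_const
  obtain ⟨δ, hδp, hδle, hδρ⟩ : ∃ δ : ℝ, 0 < δ ∧ δ ≤ δ₀ ∧ (‖L‖ + 1 / (2 * C)) * δ ≤ ρ := by
    refine ⟨min δ₀ (ρ / (‖L‖ + 1 / (2 * C))), by positivity, min_le_left _ _, ?_⟩
    calc (‖L‖ + 1 / (2 * C)) * min δ₀ (ρ / (‖L‖ + 1 / (2 * C)))
        ≤ (‖L‖ + 1 / (2 * C)) * (ρ / (‖L‖ + 1 / (2 * C))) :=
          mul_le_mul_of_nonneg_left (min_le_right _ _) (by positivity)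
      _ = ρ := by field_simp
  obtain ⟨r, hr, hr1, hrR⟩ : ∃ r : ℝ, 0 < r ∧ r ≤ 1 ∧ r * R ≤ δ := by
    refine ⟨min 1 (δ / R), by positivity, min_le_left _ _, ?_⟩
    calc min 1 (δ / R) * R ≤ δ / R * R := mul_le_mul_of_nonneg_right (min_le_right _ _) hR.le
      _ = δ := by field_simp
  let w : stdSimplex ℝ (Fin (k + 2)) → EuclideanSpace ℝ (Fin (k + 1)) := fun s =>
    r • simplexOffset A t s
  have hwc : Continuous w := Continuous.const_smul (continuous_simplexOffset.comp
    (continuous_const.prodMk (continuous_const.prodMk continuous_id))) r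
  have hw : ∀ s, ‖w s‖ < δ := fun s => by
    rw [norm_smul, Real.norm_eq_abs, abs_of_pos hr]
    exact (mul_lt_mul_of_pos_left (hRb 0 s) hr).trans_le hrR
  have hdist : ∀ s, dist (y + w s) y < δ₀ := fun s => by
    rw [dist_eq_norm, add_sub_cancel_left]
    exact (hw s).trans_le hδle
  let err : stdSimplex ℝ (Fin (k + 2)) → EuclideanSpace ℝ (Fin (k + 1)) := fun s =>
    φ (y + w s) - e' x - L (w s)
  have herr' : ∀ s, ‖err s‖ ≤ 1 / (2 * C) * ‖w s‖ := fun s => by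
    have := (hδ (hdist s)).1
    rwa [add_sub_cancel_left, hφy] at this
  have hsrc' : ∀ s, y + w s ∈ (e.symm.trans e').source := fun s => (hδ (hdist s)).2
  have herrc : Continuous err := by
    refine Continuous.sub (Continuous.sub ?_ continuous_const) (L.continuous.comp hwc)
    exact (e.symm.trans e').continuousOn.comp_continuous (continuous_const.add hwc) hsrc'
  have htarget : ∀ s (u : unitInterval),
      e' x + ((1 - u : ℝ) • err s + L (w s)) ∈ e'.target := fun s u => hball (by
    rw [Metric.mem_ball, dist_eq_norm, add_sub_cancel_left]
    calc ‖(1 - u : ℝ) • err s + L (w s)‖ ≤ ‖(1 - u : ℝ) • err s‖ + ‖L (w s)‖ := norm_add_le _ _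
      _ ≤ 1 / (2 * C) * ‖w s‖ + ‖L‖ * ‖w s‖ := by
          refine add_le_add ?_ (L.le_opNorm _)
          rw [norm_smul, Real.norm_eq_abs, abs_of_nonneg (sub_nonneg.2 u.2.2)]
          refine le_trans (mul_le_of_le_one_left (norm_nonneg _) ?_) (herr' s)
          linarith [u.2.1]
      _ = (‖L‖ + 1 / (2 * C)) * ‖w s‖ := by ring
      _ < (‖L‖ + 1 / (2 * C)) * δ := mul_lt_mul_of_pos_left (hw s) (by positivity)
      _ ≤ ρ := hδρ)
  -- In the chart `e'` the homotopy leads from the shrunk simplex, seen through the transition map,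
  -- to its linearization, which is affine.
  let G : stdSimplex ℝ (Fin (k + 2)) × unitInterval → M := fun q =>
    e'.symm (e' x + ((1 - q.2 : ℝ) • err q.1 + L (w q.1)))
  have hG : Continuous G := by
    have hu : Continuous fun q : stdSimplex ℝ (Fin (k + 2)) × unitInterval => (1 - q.2 : ℝ) :=
      continuous_const.sub (continuous_subtype_val.comp continuous_snd)
    exact e'.continuousOn_symm.comp_continuous (continuous_const.add (Continuous.add
      (hu.smul (herrc.comp continuous_fst))
      (L.continuous.comp (hwc.comp continuous_fst)))) fun q => htarget q.1 q.2
  have hGx : ∀ s u, G (s, u) = x → ∀ i, 0 < s i := by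
    intro s u hs
    have h1 := congrArg e' hs
    simp only [G] at h1
    rw [e'.right_inv (htarget s u), add_eq_left] at h1
    have h2 : ‖L (w s)‖ ≤ ‖L (w s)‖ / 2 := by
      have h3 : ‖L (w s)‖ = ‖(1 - u : ℝ) • err s‖ := by
        rw [eq_neg_of_add_eq_zero_right h1, norm_neg]
      calc ‖L (w s)‖ = ‖(1 - u : ℝ) • err s‖ := h3
        _ ≤ 1 / (2 * C) * ‖w s‖ := by
          rw [norm_smul, Real.norm_eq_abs, abs_of_nonneg (sub_nonneg.2 u.2.2)]
          refine le_trans (mul_le_of_le_one_left (norm_nonneg _) ?_) (herr' s)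
          linarith [u.2.1]
        _ ≤ 1 / (2 * C) * (C * ‖L (w s)‖) :=
          mul_le_mul_of_nonneg_left (hCL _) (by positivity)
        _ = ‖L (w s)‖ / 2 := by field_simp
    have h4 : ‖L (w s)‖ = 0 := by linarith [norm_nonneg (L (w s))]
    have h5 : w s = 0 := by
      have := hCL (w s)
      rw [h4, mul_zero] at this
      exact norm_le_zero_iff.1 this
    rw [simplexOffset_eq_zero hA.ne' ((smul_eq_zero.1 h5).resolve_left hr.ne')]
    exact ht
  let σ : unitInterval → SingularSimplex (k + 1) M := fun u =>
    ⟨fun s => G (s, u), hG.comp (continuous_id.prodMk continuous_const)⟩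
  have hσ0 : ∀ s, σ 0 s = e.symm (y + r • simplexOffset A t s) := by
    intro s
    have h1 : σ 0 s = e'.symm (φ (y + w s)) := by
      simp only [σ, G, ContinuousMap.coe_mk, Set.Icc.coe_zero, sub_zero, one_smul, err]
      congr 1
      abel
    rw [h1]
    have h2 := hsrc' s
    rw [OpenPartialHomeomorph.trans_source] at h2
    exact e'.left_inv h2.2
  have m₁ := h.homologous_scale hA.ne' ht hr hr1 hσ0
  have m₂ := single_sub_single_mem_of_homotopy G hG hGx (τ := σ 0) (τ' := σ 1)
    (fun _ => rfl) (fun _ => rfl)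
  have hσ1 : ∀ s, σ 1 s = e'.symm (e' x + simplexOffset (r • A * rowMatrix L) t s) := by
    intro s
    rw [← map_simplexOffset, simplexOffset_smul]
    simp [σ, G, w]
  have htarget1 : ∀ s, e' x + simplexOffset (r • A * rowMatrix L) t s ∈ e'.target := by
    intro s
    have := htarget s 1
    rw [← map_simplexOffset, simplexOffset_smul]
    simpa [w] using this
  refine ⟨σ 1, r • A * rowMatrix L, ?_, ⟨?_, fun s => ?_⟩, ?_⟩
  · rw [Matrix.det_mul, Matrix.det_smul, det_rowMatrix]
    positivity
  · rw [hσ1, simplexOffset_self, add_zero, e'.left_inv hx']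
  · rw [hσ1]
    exact ⟨e'.map_target (htarget1 s), e'.right_inv (htarget1 s)⟩
  · have := Submodule.add_mem _ m₁ m₂
    convert this using 1
    abel

variable [ChartedSpace (EuclideanSpace ℝ (Fin (k + 1))) M]

namespace SmoothOrientation

variable (o : SmoothOrientation (k + 1) M)

/-- All positive simplices at a point define the same local class. -/
theorem IsPositiveSimplexAt.homologous {o : SmoothOrientation (k + 1) M} {x : M}
    {τ τ' : SingularSimplex (k + 1) M} (h : o.IsPositiveSimplexAt x τ)
    (h' : o.IsPositiveSimplexAt x τ') :
    Finsupp.single τ 1 - Finsupp.single τ' 1 ∈ boundariesRel (k + 1) {x}ᶜ := by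
  obtain ⟨e, he, t, A, ht, hA, hτ⟩ := o.isPositiveSimplexAt_iff.1 h
  obtain ⟨e', he', t', A', ht', hA', hτ'⟩ := o.isPositiveSimplexAt_iff.1 h'
  obtain ⟨τ₁, A₁, hA₁, hτ₁, hm⟩ := hτ.exists_homologous_in_chart hA ht hτ'.mem_source
    (o.det_pos e he e' he' _ (by
      rw [OpenPartialHomeomorph.trans_source, OpenPartialHomeomorph.symm_source]
      refine ⟨e.map_source hτ.mem_source, ?_⟩
      change e.symm (e x) ∈ e'.source
      rw [e.left_inv hτ.mem_source]
      exact hτ'.mem_source))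
  have := Submodule.add_mem _ hm (hτ₁.homologous_of_same_chart hA₁ ht hτ' hA' ht')
  rwa [sub_add_sub_cancel] at this

/-- The chain `c` represents the local orientation generator at `x`. -/
def IsPositiveAt (x : M) (c : RealSingularChain (k + 1) M) : Prop :=
  ∃ τ : SingularSimplex (k + 1) M, o.IsPositiveSimplexAt x τ ∧
    RealSingularChain.HomologousAt x c (Finsupp.single τ 1)

variable {o}

theorem IsPositiveSimplexAt.isPositiveAt {x : M} {τ : SingularSimplex (k + 1) M}
    (h : o.IsPositiveSimplexAt x τ) : o.IsPositiveAt x (Finsupp.single τ 1) :=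
  ⟨τ, h, homologousAt_iff.2 (by rw [sub_self]; exact Submodule.zero_mem _)⟩

theorem IsPositiveAt.sub_mem {x : M} {c c' : RealSingularChain (k + 1) M}
    (h : o.IsPositiveAt x c) (h' : o.IsPositiveAt x c') :
    c - c' ∈ boundariesRel (k + 1) {x}ᶜ := by
  obtain ⟨τ, hτ, hc⟩ := h
  obtain ⟨τ', hτ', hc'⟩ := h'
  have := Submodule.sub_mem _ (Submodule.add_mem _ (homologousAt_iff.1 hc) (hτ.homologous hτ'))
    (homologousAt_iff.1 hc')
  convert this using 1
  abel

theorem IsPositiveAt.of_sub_mem {x : M} {c c' : RealSingularChain (k + 1) M}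
    (h : o.IsPositiveAt x c) (h' : c' - c ∈ boundariesRel (k + 1) {x}ᶜ) : o.IsPositiveAt x c' := by
  obtain ⟨τ, hτ, hc⟩ := h
  refine ⟨τ, hτ, homologousAt_iff.2 ?_⟩
  have := Submodule.add_mem _ h' (homologousAt_iff.1 hc)
  rwa [sub_add_sub_cancel] at this

/-- The edge matrix is invertible, so `x` is hit exactly once, at an interior point. In particular
the faces of `τ` avoid `x`. -/
theorem IsPositiveSimplexAt.exists_center {n : ℕ} [ChartedSpace (EuclideanSpace ℝ (Fin n)) M]
    {o : SmoothOrientation n M} {x : M} {τ : SingularSimplex n M}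
    (h : o.IsPositiveSimplexAt x τ) :
    ∃ t : stdSimplex ℝ (Fin (n + 1)), (∀ i, 0 < t i) ∧ ∀ s, τ s = x ↔ s = t := by
  obtain ⟨e, he, t, A, ht, hA, hτ⟩ := o.isPositiveSimplexAt_iff.1 h
  exact ⟨t, ht, fun s => hτ.eq_iff hA.ne'⟩

theorem boundary_single_mem_compl {K : Set M} {τ : SingularSimplex (k + 1) M}
    (h : ∀ x ∈ K, o.IsPositiveSimplexAt x τ) :
    boundary (Finsupp.single τ 1) ∈ chainsIn k Kᶜ := by
  refine boundary_single_mem_of_forall fun s ⟨i, hi⟩ hs => ?_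
  obtain ⟨t, ht, hst⟩ := (h _ hs).exists_center
  rw [(hst s).1 rfl] at hi
  exact (ht i).ne' hi

variable (o)

/-- Around every point there are arbitrarily small simplices that are positive at all points of a
compact neighbourhood that is convex in a chart. -/
theorem exists_local_model (x : M) {O : Set M} (hO : O ∈ nhds x) :
    ∃ e ∈ o.charts, ∃ (τ : SingularSimplex (k + 1) M) (K : Set M), K ∈ nhds x ∧ IsCompact K ∧
      K ⊆ e.source ∧ Convex ℝ (e '' K) ∧ Set.range τ ⊆ O ∧
      ∀ x' ∈ K, o.IsPositiveSimplexAt x' τ := by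
  obtain ⟨e, he, hx⟩ := o.exists_mem_source x
  set y := e x with hy
  have hnhds : e.target ∩ e.symm ⁻¹' O ∈ nhds y :=
    Filter.inter_mem (e.open_target.mem_nhds (e.map_source hx))
      ((e.continuousAt_symm (e.map_source hx)).preimage_mem_nhds (by rwa [e.left_inv hx]))
  obtain ⟨ρ, hρ, hball⟩ := Metric.mem_nhds_iff.1 hnhds
  let b : stdSimplex ℝ (Fin (k + 2)) := stdSimplex.barycenter
  have hb : ∀ i, b i = (k + 2 : ℝ)⁻¹ := fun i => by
    change (Fintype.card (Fin (k + 2)) : ℝ)⁻¹ = _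
    simp
  obtain ⟨R, hR, hRb⟩ := exists_offset_bound
    (γ := fun _ => (1 : Matrix (Fin (k + 1)) (Fin (k + 1)) ℝ)) continuous_const
    (t := fun _ => b) continuous_const
  obtain ⟨r, hr, hrR⟩ : ∃ r : ℝ, 0 < r ∧ r * R ≤ ρ := ⟨ρ / R, by positivity, by field_simp; rfl⟩
  let A : Matrix (Fin (k + 1)) (Fin (k + 1)) ℝ := r • 1
  have hA : 0 < A.det := by simp only [A, Matrix.det_smul, Matrix.det_one]; positivity
  have hmem : ∀ s, y + simplexOffset A b s ∈ Metric.ball y ρ := fun s => by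
    rw [Metric.mem_ball, dist_eq_norm, add_sub_cancel_left, simplexOffset_smul, norm_smul,
      Real.norm_eq_abs, abs_of_pos hr]
    exact (mul_lt_mul_of_pos_left (hRb 0 s) hr).trans_le hrR
  let τ : SingularSimplex (k + 1) M := ⟨fun s => e.symm (y + simplexOffset A b s),
    e.continuousOn_symm.comp_continuous (continuous_const.add (continuous_simplexOffset.comp
      (continuous_const.prodMk (continuous_const.prodMk continuous_id))))
      fun s => (hball (hmem s)).1⟩
  have hτ : ∀ s, τ s = e.symm (y + simplexOffset A b s) := fun _ => rfl
  -- Moving by at most `δ` from the centre changes each of the last `k + 1` barycentric coordinates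
  -- by at most `1/(2(k+2)²)`. Each change and their sum are less than `1/(k+2)`, so all coordinates
  -- stay positive.
  let δ : ℝ := min (ρ / 2) (r / (2 * (k + 2) ^ 2))
  have hδ : 0 < δ := by positivity
  have hKt : Metric.closedBall y δ ⊆ e.target := fun z hz =>
    (hball (Metric.closedBall_subset_ball
      (lt_of_le_of_lt (min_le_left _ _) (by linarith)) hz)).1
  have himage : e '' (e.symm '' Metric.closedBall y δ) = Metric.closedBall y δ := by
    rw [← Set.image_comp]
    exact (Set.image_congr fun z hz => e.right_inv (hKt hz)).trans (Set.image_id _)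
  refine ⟨e, he, τ, e.symm '' Metric.closedBall y δ, ?_, ?_, ?_, ?_, ?_, ?_⟩
  · rw [e.symm.image_eq_target_inter_inv_preimage hKt]
    exact Filter.inter_mem (e.open_source.mem_nhds hx)
      ((e.continuousAt hx).preimage_mem_nhds (Metric.closedBall_mem_nhds _ hδ))
  · exact (isCompact_closedBall _ _).image_of_continuousOn (e.continuousOn_symm.mono hKt)
  · rintro _ ⟨z, hz, rfl⟩
    exact e.map_target (hKt hz)
  · rw [himage]
    exact convex_closedBall _ _
  · rintro _ ⟨s, rfl⟩
    exact (hball (hmem s)).2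
  · rintro _ ⟨z, hz, rfl⟩
    have hzn : ‖z - y‖ ≤ r / (2 * (k + 2) ^ 2) := by
      rw [← dist_eq_norm]
      exact (Metric.mem_closedBall.1 hz).trans (min_le_right _ _)
    let c : Fin (k + 1) → ℝ := fun j => (z - y) j / r
    have hc : ∀ j, |c j| ≤ 1 / (2 * (k + 2) ^ 2) := fun j => by
      have h1 : |(z - y) j| ≤ ‖z - y‖ := by
        rw [← Real.norm_eq_abs]
        exact PiLp.norm_apply_le _ _
      rw [abs_div, abs_of_pos hr, div_le_iff₀ hr]
      calc |(z - y) j| ≤ r / (2 * (k + 2) ^ 2) := h1.trans hzn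
        _ = _ := by ring
    have hk : (0 : ℝ) < k + 2 := by positivity
    have hsmall : 1 / (2 * (k + 2) ^ 2 : ℝ) < (k + 2 : ℝ)⁻¹ := by
      rw [one_div]
      refine (inv_lt_inv₀ (by positivity) hk).2 ?_
      nlinarith [Nat.cast_nonneg (α := ℝ) k]
    have hsum : |∑ j, c j| < (k + 2 : ℝ)⁻¹ := by
      calc |∑ j, c j| ≤ ∑ j, |c j| := Finset.abs_sum_le_sum_abs _ _
        _ ≤ ∑ _j : Fin (k + 1), 1 / (2 * (k + 2) ^ 2 : ℝ) := Finset.sum_le_sum fun j _ => hc j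
        _ = (k + 1) / (2 * (k + 2) ^ 2 : ℝ) := by
          rw [Finset.sum_const, Finset.card_univ, Fintype.card_fin, nsmul_eq_mul]
          push_cast
          ring
        _ < (k + 2 : ℝ)⁻¹ := by
          rw [div_lt_iff₀ (by positivity)]
          field_simp
          nlinarith [Nat.cast_nonneg (α := ℝ) k]
    let t' : Fin (k + 2) → ℝ := Fin.cons ((k + 2 : ℝ)⁻¹ - ∑ j, c j) fun j => (k + 2 : ℝ)⁻¹ + c j
    have ht'pos : ∀ i, 0 < t' i := by
      intro i
      refine Fin.cases ?_ (fun j => ?_) i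
      · simp only [t', Fin.cons_zero]
        linarith [(abs_lt.1 hsum).2]
      · simp only [t', Fin.cons_succ]
        linarith [(abs_le.1 (hc j)).1]
    let t : stdSimplex ℝ (Fin (k + 2)) := ⟨t', fun i => (ht'pos i).le, by
      rw [Fin.sum_univ_succ]
      simp only [t', Fin.cons_zero, Fin.cons_succ, Finset.sum_add_distrib, Finset.sum_const,
        Finset.card_univ, Fintype.card_fin, nsmul_eq_mul, Nat.cast_add, Nat.cast_one]
      field_simp
      ring⟩
    have htz : y + simplexOffset A b t = z := by
      refine (sub_eq_iff_eq_add'.1 ?_).symm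
      rw [simplexOffset_smul]
      ext j
      have hbj : b j.succ = (k + 2 : ℝ)⁻¹ := hb _
      have htj : t j.succ = (k + 2 : ℝ)⁻¹ + c j := rfl
      have hcj : (z - y) j = r * (t j.succ - b j.succ) := by
        rw [htj, hbj, add_sub_cancel_left]
        exact (mul_div_cancel₀ _ hr.ne').symm
      simpa [simplexOffset] using hcj
    refine o.isPositiveSimplexAt_iff.2 ⟨e, he, t, A, ht'pos, hA, ?_, fun s => ⟨?_, ?_⟩⟩
    · rw [hτ, htz]
    · exact e.map_target (hball (hmem s)).1
    · rw [hτ, e.right_inv (hball (hmem s)).1, e.right_inv (hKt hz), ← htz, add_assoc,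
        simplexOffset_add]

variable {o}

/-- Local constancy of the property of representing the local orientation generators. -/
theorem IsPositiveAt.of_mem_of_mem [T2Space M]
    {e : OpenPartialHomeomorph M (EuclideanSpace ℝ (Fin (k + 1)))}
    {τ : SingularSimplex (k + 1) M} {K : Set M} (hK : IsCompact K) (hKe : K ⊆ e.source)
    (hconv : Convex ℝ (e '' K)) (hτ : ∀ x ∈ K, o.IsPositiveSimplexAt x τ)
    {c : RealSingularChain (k + 1) M} (hc : boundary c ∈ chainsIn k Kᶜ) {p q : M} (hp : p ∈ K)
    (hq : q ∈ K) (h : o.IsPositiveAt p c) : o.IsPositiveAt q c := by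
  refine (hτ q hq).isPositiveAt.of_sub_mem ?_
  refine boundariesRel_mono (Set.compl_subset_compl.2 (Set.singleton_subset_iff.2 hq))
    (mem_boundariesRel_of_convex_chart e hK hKe hconv ?_ hp (h.sub_mem (hτ p hp).isPositiveAt))
  rw [map_sub]
  exact Submodule.sub_mem _ hc (boundary_single_mem_compl hτ)

end SmoothOrientation

end Orientation

/-! ## Fundamental cycles -/

/-- A locally constant predicate on a preconnected space is constant. -/
theorem iff_of_eventually_iff {α : Type*} [TopologicalSpace α] [PreconnectedSpace α] {p : α → Prop}
    (h : ∀ a, ∀ᶠ b in nhds a, (p b ↔ p a)) (a b : α) : p a ↔ p b := by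
  have : IsLocallyConstant p := (IsLocallyConstant.iff_eventually_eq p).2 fun a =>
    (h a).mono fun b hb => propext hb
  rw [this.apply_eq_of_preconnectedSpace a b]

namespace RealSingularChain

variable {k : ℕ} {X : Type*} [TopologicalSpace X]

/-- The complements of a point and of a finite set not containing it cover `X`, so the vanishing
needed for Mayer–Vietoris is trivial. -/
theorem mem_boundariesRel_compl_finset [T1Space X] {z : RealSingularChain k X} (s : Finset X)
    (h : ∀ x ∈ s, z ∈ boundariesRel k {x}ᶜ) : z ∈ boundariesRel k (s : Set X)ᶜ := by
  classical
  induction s using Finset.induction_on with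
  | empty => exact chainsIn_le_boundariesRel _ (by simpa using chainsIn_univ z)
  | insert a s ha ih =>
    rw [Finset.coe_insert, Set.insert_eq, Set.compl_union]
    refine mem_boundariesRel_inter isOpen_compl_singleton s.finite_toSet.isClosed.isOpen_compl
      (h a (Finset.mem_insert_self a s)) (ih fun x hx => h x (Finset.mem_insert_of_mem hx)) ?_
    rw [← Set.compl_inter, Set.singleton_inter_eq_empty.2 (by simpa using ha), Set.compl_empty]
    exact homologyVanishes_univ

end RealSingularChain

/-! ### Gluing, existence and transport of positive classes. -/

namespace SmoothOrientation

variable {k : ℕ} {M : Type*} [TopologicalSpace M] [T2Space M]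
  [ChartedSpace (EuclideanSpace ℝ (Fin (k + 1))) M] {o : SmoothOrientation (k + 1) M}

/-- On `A ∩ K`, which lies in a chart, `α` and `β` agree pointwise, hence `α - β` is a boundary
modulo the complement of `A ∩ K`. Splitting the remainder into `u` off `A` and `v` off `K` makes `α
- u`, which is `β + v` up to a boundary, right on both sets. -/
theorem exists_positive_union {A K : Set M} (hA : IsClosed A) (hK : IsCompact K)
    {e : OpenPartialHomeomorph M (EuclideanSpace ℝ (Fin (k + 1)))} (hKe : K ⊆ e.source)
    {α β : RealSingularChain (k + 1) M} (hα : boundary α ∈ chainsIn k Aᶜ)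
    (hαp : ∀ x ∈ A, o.IsPositiveAt x α) (hβ : boundary β ∈ chainsIn k Kᶜ)
    (hβp : ∀ x ∈ K, o.IsPositiveAt x β) :
    ∃ γ : RealSingularChain (k + 1) M, boundary γ ∈ chainsIn k (A ∪ K)ᶜ ∧
      ∀ x ∈ A ∪ K, o.IsPositiveAt x γ := by
  have hAK : IsCompact (A ∩ K) := hK.inter_left hA
  have hz : boundary (α - β) ∈ chainsIn k Aᶜ ⊔ chainsIn k Kᶜ := by
    rw [map_sub]
    exact Submodule.sub_mem _ (Submodule.mem_sup_left hα) (Submodule.mem_sup_right hβ)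
  have hle : chainsIn k Aᶜ ⊔ chainsIn k Kᶜ ≤ chainsIn k (A ∩ K)ᶜ :=
    sup_le (chainsIn_mono (Set.compl_subset_compl.2 Set.inter_subset_left))
      (chainsIn_mono (Set.compl_subset_compl.2 Set.inter_subset_right))
  obtain ⟨d, hd⟩ := mem_boundariesRel.1 (mem_boundariesRel_of_chart e hAK
    (Set.inter_subset_right.trans hKe) (hle hz) fun x hx => (hαp x hx.1).sub_mem (hβp x hx.2))
  rw [Set.compl_inter] at hd
  obtain ⟨u, hu, v, hv, g, -, h⟩ := exists_decomposition hA.isOpen_compl hK.isClosed.isOpen_compl hd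
    (by rw [map_sub, boundary_boundary, sub_zero]; exact hz)
  have hγ : α - u = β + v + boundary (g + d) := by
    rw [sub_eq_iff_eq_add, sub_eq_iff_eq_add] at h
    rw [h, map_add]
    abel
  refine ⟨α - u, ?_, ?_⟩
  · rw [Set.compl_union]
    refine mem_chainsIn_inter.2 ⟨?_, ?_⟩
    · rw [map_sub]
      exact Submodule.sub_mem _ hα (boundary_mem hu)
    · rw [hγ, map_add, map_add, boundary_boundary, add_zero]
      exact Submodule.add_mem _ hβ (boundary_mem hv)
  · rintro x (hx | hx)
    · refine (hαp x hx).of_sub_mem (chainsIn_le_boundariesRel _ ?_)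
      rw [sub_sub_cancel_left]
      exact Submodule.neg_mem _ (chainsIn_mono (by simpa using hx) hu)
    · refine (hβp x hx).of_sub_mem ?_
      rw [hγ, add_assoc, add_sub_cancel_left]
      exact Submodule.add_mem _ (chainsIn_le_boundariesRel _ (chainsIn_mono (by simpa using hx) hv))
        (boundary_mem_boundariesRel _ _)

variable (o) in
/-- Closed oriented manifolds have fundamental cycles. -/
theorem exists_isFundamentalCycle [CompactSpace M] : ∃ c, o.IsFundamentalCycle c := by
  choose e he τ K hK hKc hKe hconv hO hτ using
    fun x : M => o.exists_local_model x (O := Set.univ) Filter.univ_mem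
  obtain ⟨t, ht⟩ := finite_cover_nhds hK
  have key : ∀ t : Finset M, ∃ γ : RealSingularChain (k + 1) M,
      boundary γ ∈ chainsIn k (⋃ x ∈ t, K x)ᶜ ∧ ∀ x ∈ ⋃ x ∈ t, K x, o.IsPositiveAt x γ := by
    intro t
    classical
    induction t using Finset.induction_on with
    | empty => exact ⟨0, by rw [map_zero]; exact Submodule.zero_mem _, by simp⟩
    | insert a t _ ih =>
      obtain ⟨α, hα, hαp⟩ := ih
      rw [Finset.set_biUnion_insert, Set.union_comm]
      exact exists_positive_union
        (t.finite_toSet.isClosed_biUnion fun x _ => (hKc x).isClosed) (hKc a) (hKe a) hα hαp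
        (boundary_single_mem_compl (hτ a)) fun x hx => (hτ a x hx).isPositiveAt
  obtain ⟨c, hc, hcp⟩ := key t
  rw [ht] at hc hcp
  rw [Set.compl_univ] at hc
  -- Once the compact sets cover `M`, the boundary lies in the empty set and is zero.
  exact ⟨c, chainsIn_empty hc, fun x => hcp x (Set.mem_univ x)⟩

/-- Positivity of a cycle is locally constant. -/
theorem eventually_isPositiveAt_iff {c : RealSingularChain (k + 1) M} (hc : boundary c = 0) (x : M) :
    ∀ᶠ y in nhds x, (o.IsPositiveAt y c ↔ o.IsPositiveAt x c) := by
  obtain ⟨e, he, τ, K, hK, hKc, hKe, hconv, -, hτ⟩ := o.exists_local_model x Filter.univ_mem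
  have hc' : boundary c ∈ chainsIn k Kᶜ := by rw [hc]; exact Submodule.zero_mem _
  filter_upwards [hK] with y hy
  exact ⟨IsPositiveAt.of_mem_of_mem hKc hKe hconv hτ hc' hy (mem_of_mem_nhds hK),
    IsPositiveAt.of_mem_of_mem hKc hKe hconv hτ hc' (mem_of_mem_nhds hK) hy⟩

/-- Positivity of a simplex is preserved when the simplex and the point are moved simultaneously,
as long as the point does not meet the faces of the simplex. -/
theorem isPositiveAt_of_homotopy (G : stdSimplex ℝ (Fin (k + 2)) × unitInterval → M)
    (hG : Continuous G) (x : unitInterval → M) (hx : Continuous x)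
    (hGx : ∀ s u, G (s, u) = x u → ∀ i, 0 < s i) {σ σ' : SingularSimplex (k + 1) M}
    (h₀ : ∀ s, G (s, 0) = σ s) (h₁ : ∀ s, G (s, 1) = σ' s)
    (h : o.IsPositiveAt (x 0) (Finsupp.single σ 1)) :
    o.IsPositiveAt (x 1) (Finsupp.single σ' 1) := by
  let ρ : unitInterval → SingularSimplex (k + 1) M := fun u =>
    ⟨fun s => G (s, u), hG.comp (continuous_id.prodMk continuous_const)⟩
  have hρ₀ : ρ 0 = σ := ContinuousMap.ext h₀
  have hρ₁ : ρ 1 = σ' := ContinuousMap.ext h₁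
  rw [← hρ₁]
  rw [← hρ₀] at h
  refine (iff_of_eventually_iff (p := fun u => o.IsPositiveAt (x u) (Finsupp.single (ρ u) 1))
    (fun u₀ => ?_) 0 1).1 h
  let F : Set (stdSimplex ℝ (Fin (k + 2))) := {s | ∃ i, s i = 0}
  have hF : IsCompact F := by
    refine IsClosed.isCompact ?_
    have : F = ⋃ i, {s : stdSimplex ℝ (Fin (k + 2)) | s i = 0} := by
      ext s
      simp [F]
    rw [this]
    exact isClosed_iUnion_of_finite fun i => isClosed_eq
      ((continuous_apply i).comp continuous_subtype_val) continuous_const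
  have hFx : ∀ s ∈ F, ∀ u, G (s, u) ≠ x u := fun s ⟨i, hi⟩ u hs => (hGx s u hs i).ne' hi
  have hO : (ρ u₀ '' F)ᶜ ∈ nhds (x u₀) := by
    refine (hF.image (ρ u₀).continuous).isClosed.isOpen_compl.mem_nhds ?_
    rintro ⟨s, hs, hsx⟩
    exact hFx s hs u₀ hsx
  obtain ⟨e, he, τ, K, hK, hKc, hKe, hconv, hτO, hτ⟩ := o.exists_local_model (x u₀) hO
  have hKO : K ⊆ (ρ u₀ '' F)ᶜ := fun y hy => by
    obtain ⟨t, -, ht⟩ := (hτ y hy).exists_center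
    rw [← (ht t).2 rfl]
    exact hτO ⟨t, rfl⟩
  have hbd : boundary (Finsupp.single (ρ u₀) 1) ∈ chainsIn k Kᶜ :=
    boundary_single_mem_of_forall fun s hs hmem => hKO hmem ⟨s, hs, rfl⟩
  -- The times of the simplex and of the point vary independently here, by compactness of the union
  -- `F` of the faces. The simplex can then be moved with the point held at `x u`, and the point
  -- with the simplex held at time `u₀`.
  have hev : ∀ᶠ q in nhds ((u₀, u₀) : unitInterval × unitInterval), ∀ s ∈ F, G (s, q.1) ≠ x q.2 := by
    refine hF.eventually_forall_of_forall_eventually fun s hs => ?_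
    exact IsOpen.mem_nhds (isOpen_ne_fun
      (hG.comp (continuous_snd.prodMk (continuous_fst.comp continuous_fst)))
      (hx.comp (continuous_snd.comp continuous_fst))) (hFx s hs u₀)
  obtain ⟨r, hr, hball⟩ := Metric.eventually_nhds_iff.1 hev
  filter_upwards [Metric.ball_mem_nhds u₀ hr, hx.continuousAt.preimage_mem_nhds hK] with u hu hxu
  let v : unitInterval → unitInterval := fun w => ⟨(1 - w) * u₀ + w * u,
    convex_Icc (0 : ℝ) 1 u₀.2 u.2 (sub_nonneg.2 w.2.2) w.2.1 (by ring)⟩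
  have hvc : Continuous v := Continuous.subtype_mk (by fun_prop) _
  have hv : ∀ w, dist (v w) u₀ < r := fun w => by
    refine lt_of_le_of_lt ?_ hu
    rw [Subtype.dist_eq, Subtype.dist_eq, Real.dist_eq, Real.dist_eq]
    have : (v w : ℝ) - u₀ = w * (u - u₀) := by simp only [v]; ring
    rw [this, abs_mul, abs_of_nonneg w.2.1]
    exact mul_le_of_le_one_left (abs_nonneg _) w.2.2
  have hm : Finsupp.single (ρ u₀) 1 - Finsupp.single (ρ u) 1 ∈ boundariesRel (k + 1) {x u}ᶜ := by
    refine single_sub_single_mem_of_homotopy (fun q => G (q.1, v q.2))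
      (hG.comp (continuous_fst.prodMk (hvc.comp continuous_snd))) (fun s w hs i => ?_)
      (fun s => ?_) (fun s => ?_)
    · refine lt_of_le_of_ne (s.2.1 i) fun hi => ?_
      refine hball (y := (v w, u)) ?_ s ⟨i, hi.symm⟩ hs
      rw [Prod.dist_eq]
      exact max_lt (hv w) hu
    · simp [v, ρ]
    · simp [v, ρ]
  have hm' := Submodule.neg_mem _ hm
  rw [neg_sub] at hm'
  constructor
  · intro hp
    exact IsPositiveAt.of_mem_of_mem hKc hKe hconv hτ hbd hxu (mem_of_mem_nhds hK)
      (hp.of_sub_mem hm)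
  · intro hp
    exact (IsPositiveAt.of_mem_of_mem hKc hKe hconv hτ hbd (mem_of_mem_nhds hK) hxu hp).of_sub_mem
      hm'

/-- The local degree formula for a map all of whose local degrees at the preimages of `x` are
`1`. -/
theorem isPositiveAt_push {N : ℕ} (hN : N ≠ 0) {h : C(M, M)} {x : M} {y : Fin N → M}
    (hxy : ∀ z, h z = x → z ∈ Set.range y)
    {τ : Fin N → SingularSimplex (k + 1) M} (hτ : ∀ j, o.IsPositiveSimplexAt (y j) (τ j))
    (hτy : ∀ j i, i ≠ j → y i ∉ Set.range (τ j))
    (hhτ : ∀ j, o.IsPositiveAt x (Finsupp.single (h.comp (τ j)) 1))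
    {c : RealSingularChain (k + 1) M} (hc : ∀ x, o.IsPositiveAt x c) :
    o.IsPositiveAt x ((N : ℝ)⁻¹ • push h c) := by
  classical
  -- At each preimage one local simplex cancels `c` and the others stay away, so `z` is trivial
  -- relative to the complement of all the preimages. Its image is trivial at `x`, which leaves `N`
  -- copies of the local generator.
  set z := c - ∑ j, Finsupp.single (τ j) (1 : ℝ) with hz
  have h₁ : z ∈ boundariesRel (k + 1) ((Finset.univ.image y : Finset M) : Set M)ᶜ := by
    refine mem_boundariesRel_compl_finset _ fun p hp => ?_
    obtain ⟨j, -, rfl⟩ := Finset.mem_image.1 hp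
    have e : z = (c - Finsupp.single (τ j) 1) -
        ∑ i ∈ Finset.univ.erase j, Finsupp.single (τ i) (1 : ℝ) := by
      rw [hz, ← Finset.add_sum_erase _ _ (Finset.mem_univ j)]
      abel
    rw [e]
    refine Submodule.sub_mem _ ((hc _).sub_mem (hτ j).isPositiveAt) (Submodule.sum_mem _ fun i hi =>
      chainsIn_le_boundariesRel _ (single_mem_chainsIn ?_ 1))
    exact Set.subset_compl_singleton_iff.2 (hτy i j (Finset.ne_of_mem_erase hi).symm)
  have h₂ : push h z ∈ boundariesRel (k + 1) {x}ᶜ := by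
    refine push_mem_boundariesRel (V := ((Finset.univ.image y : Finset M) : Set M)ᶜ)
      (W := {x}ᶜ) h (fun p hp hpx => hp ?_) h₁
    obtain ⟨j, rfl⟩ := hxy p hpx
    simp
  obtain ⟨e, he, σ, K, hK, -, -, -, -, hσ⟩ := o.exists_local_model x Filter.univ_mem
  have hσx := (hσ x (mem_of_mem_nhds hK)).isPositiveAt
  have h₃ : push h c - (N : ℝ) • Finsupp.single σ 1 ∈ boundariesRel (k + 1) {x}ᶜ := by
    have h₄ : ∑ j, (Finsupp.single (h.comp (τ j)) (1 : ℝ) - Finsupp.single σ 1) ∈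
        boundariesRel (k + 1) {x}ᶜ := Submodule.sum_mem _ fun j _ => (hhτ j).sub_mem hσx
    have := Submodule.add_mem _ h₂ h₄
    rw [hz, map_sub, map_sum] at this
    simp only [push_single, Finset.sum_sub_distrib, Finset.sum_const, Finset.card_univ,
      Fintype.card_fin] at this
    rw [Nat.cast_smul_eq_nsmul]
    convert this using 1
    abel
  refine hσx.of_sub_mem ?_
  have := Submodule.smul_mem _ (N : ℝ)⁻¹ h₃
  rwa [smul_sub, smul_smul, inv_mul_cancel₀ (Nat.cast_ne_zero.2 hN), one_smul] at this

end SmoothOrientation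

open Filter Topology

/-! ## Self-maps of open books -/

/-- The topological data of an open book with a monodromy map. -/
structure TopologicalOpenBook (M B P : Type*) [TopologicalSpace M] [TopologicalSpace B]
    [TopologicalSpace P] where
  /-- the tubular neighbourhood of the binding -/
  tube : B × ℂ → M
  map_nhds_tube : ∀ b, map tube (𝓝 (b, 0)) = 𝓝 (tube (b, 0))
  tube_injOn : Set.InjOn tube (Set.univ ×ˢ Metric.ball (0 : ℂ) 1)
  /-- the angular coordinate -/
  θ : M → Circle
  θ_tube : ∀ (b : B) (z : ℂ), ‖z‖ < 1 → z ≠ 0 → (θ (tube (b, z)) : ℂ) = z / ‖z‖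
  /-- the monodromy -/
  f : P ≃ P
  /-- the parametrization of the complement of the binding -/
  Φ : P × ℝ → M
  isLocalHomeomorph_Φ : IsLocalHomeomorph Φ
  range_Φ : Set.range Φ = (Set.range fun b : B => tube (b, 0))ᶜ
  θ_Φ : ∀ x t, θ (Φ (x, t)) = Circle.exp (2 * Real.pi * t)
  Φ_inj : ∀ x y t, Φ (x, t) = Φ (y, t) → x = y
  Φ_add_one : ∀ x t, Φ (x, t + 1) = Φ (f x, t)
  /-- the radius of the part of the tube on which `Φ` is the rotation -/
  ε : ℝ
  ε_pos : 0 < ε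
  ε_le : ε ≤ 1
  Φ_tube : ∀ (x : P) (b : B) (r : ℝ), 0 < r → r < ε → Φ (x, 0) = tube (b, (r : ℂ)) →
    ∀ t : ℝ, Φ (x, t) = tube (b, (r : ℂ) * (Circle.exp (2 * Real.pi * t) : ℂ))

theorem circle_exp_eq_iff {s t : ℝ} :
    Circle.exp (2 * Real.pi * s) = Circle.exp (2 * Real.pi * t) ↔ ∃ m : ℤ, s = t + m := by
  rw [Circle.exp_eq_exp]
  refine exists_congr fun m => ⟨fun h => ?_, fun h => by rw [h]; ring⟩
  have : 2 * Real.pi * (s - (t + m)) = 0 := by linear_combination h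
  have hpi : (2 * Real.pi : ℝ) ≠ 0 := by positivity
  linarith [(mul_eq_zero.1 this).resolve_left hpi]

theorem int_eq_zero_of_abs_lt {m : ℤ} {a : ℝ} (h : a = m) (ha : |a| < 1) : a = 0 := by
  rw [h] at ha ⊢
  have : |m| < 1 := by exact_mod_cast ha
  rw [Int.abs_lt_one_iff] at this
  simp [this]

namespace TopologicalOpenBook

variable {M B P : Type*} [TopologicalSpace M] [TopologicalSpace B] [TopologicalSpace P]
  (D : TopologicalOpenBook M B P)

/-- The binding. -/
def binding : Set M := Set.range fun b : B => D.tube (b, 0)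

theorem Φ_notMem (q : P × ℝ) : D.Φ q ∉ D.binding := by
  have : D.Φ q ∈ Set.range D.Φ := ⟨q, rfl⟩
  rw [D.range_Φ] at this
  exact this

theorem tube_notMem {b : B} {z : ℂ} (hz : ‖z‖ < 1) (hz0 : z ≠ 0) : D.tube (b, z) ∉ D.binding := by
  rintro ⟨b', hb'⟩
  have := D.tube_injOn (show ((b', 0) : B × ℂ) ∈ _ by simp) (show (b, z) ∈ _ by simpa using hz) hb'
  exact hz0 (congrArg Prod.snd this).symm

theorem exists_int_of_Φ_eq {p q : P × ℝ} (h : D.Φ p = D.Φ q) : ∃ m : ℤ, p.2 = q.2 + m := by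
  have := congrArg D.θ h
  rw [← Prod.mk.eta (p := p), ← Prod.mk.eta (p := q), D.θ_Φ, D.θ_Φ] at this
  exact circle_exp_eq_iff.1 this

theorem Φ_add_nat (m : ℕ) : ∀ x t, D.Φ (x, t + m) = D.Φ (D.f^[m] x, t) := by
  induction m with
  | zero => intro x t; simp
  | succ m ih =>
    intro x t
    rw [Nat.cast_succ, ← add_assoc, D.Φ_add_one, ih, Function.iterate_succ_apply]

theorem exists_Φ_add_int (m : ℤ) : ∀ x t, ∃ x', D.Φ (x, t) = D.Φ (x', t + m) := by
  induction m using Int.induction_on with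
  | zero => intro x t; exact ⟨x, by simp⟩
  | succ m ih =>
    intro x t
    obtain ⟨x', hx'⟩ := ih x t
    refine ⟨D.f.symm x', ?_⟩
    rw [hx', Int.cast_add, Int.cast_one, ← add_assoc, D.Φ_add_one, Equiv.apply_symm_apply]
  | pred m ih =>
    intro x t
    obtain ⟨x', hx'⟩ := ih x t
    refine ⟨D.f x', ?_⟩
    rw [hx', ← D.Φ_add_one]
    congr 2
    push_cast
    ring

theorem exists_rep {y : M} (hy : y ∉ D.binding) :
    ∃ q : P × ℝ, D.Φ q = y ∧ 0 ≤ q.2 ∧ q.2 < 1 := by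
  have : y ∈ Set.range D.Φ := by rw [D.range_Φ]; exact hy
  obtain ⟨⟨x, t⟩, rfl⟩ := this
  obtain ⟨x', hx'⟩ := D.exists_Φ_add_int (-⌊t⌋) x t
  refine ⟨_, hx'.symm, ?_, ?_⟩ <;> push_cast
  · linarith [Int.floor_le t]
  · linarith [Int.lt_floor_add_one t]

/-- An isotopy from the identity to a power of the monodromy with compact support. -/
structure Isotopy where
  /-- the exponent -/
  k : ℕ
  k_pos : 0 < k
  /-- the isotopy -/
  F : ℝ → P → P
  continuousOn_F : ContinuousOn (fun q : ℝ × P => F q.1 q.2) (Set.Icc (0 : ℝ) 1 ×ˢ Set.univ)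
  F_zero : ∀ x, F 0 x = x
  F_one : ∀ x, F 1 x = D.f^[k] x
  /-- the support -/
  K : Set P
  isCompact_K : IsCompact K
  F_eq : ∀ t ∈ Set.Icc (0 : ℝ) 1, ∀ x ∉ K, F t x = x

/-! ### Construction of the self-map from the isotopy. -/

namespace Isotopy

variable {D} (I : D.Isotopy)

/-- The degree of the self-map. -/
def N : ℕ := I.k + 1

theorem N_pos : (0 : ℝ) < I.N := by unfold N; positivity

theorem one_le_N : (1 : ℝ) ≤ I.N := by unfold N; push_cast; linarith [Nat.cast_nonneg (α := ℝ) I.k]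

/-- The isotopy in the reversed and rescaled time, extended to be stationary. -/
noncomputable def g (s : ℝ) (x : P) : P :=
  -- The argument falls from `1` at `s = 1/(3N)` to `0` at `s = 2/(3N)`. So the isotopy is
  -- stationary within `1/(3N)` of each `j / N`, at `f^k` for `j = 0` and at the identity for `1 ≤ j
  -- ≤ N`.
  I.F (Set.projIcc 0 1 zero_le_one (2 - 3 * I.N * s)) x

theorem continuous_g : Continuous fun q : P × ℝ => I.g q.2 q.1 := by
  refine I.continuousOn_F.comp_continuous (f := fun q : P × ℝ =>
    ((Set.projIcc 0 1 zero_le_one (2 - 3 * I.N * q.2) : ℝ), q.1)) ?_ fun q => ⟨Subtype.coe_prop _,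
      Set.mem_univ _⟩
  exact (continuous_subtype_val.comp (continuous_projIcc.comp (by fun_prop))).prodMk continuous_fst

theorem g_of_le {s : ℝ} (hs : 3 * I.N * s ≤ 1) (x : P) : I.g s x = D.f^[I.k] x := by
  rw [g, Set.projIcc_of_right_le _ (by linarith), I.F_one]

theorem g_of_ge {s : ℝ} (hs : 2 ≤ 3 * I.N * s) (x : P) : I.g s x = x := by
  rw [g, Set.projIcc_of_le_left _ (by linarith), I.F_zero]

theorem g_of_notMem (s : ℝ) {x : P} (hx : x ∉ I.K) : I.g s x = x :=
  I.F_eq _ (Subtype.coe_prop _) x hx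

/-- The self-map of the complement of the binding in the parametrization `Φ`. -/
noncomputable def H (q : P × ℝ) : M := D.Φ (I.g q.2 q.1, I.N * q.2)

theorem continuous_H : Continuous I.H :=
  D.isLocalHomeomorph_Φ.continuous.comp (I.continuous_g.prodMk (by fun_prop))

/-- One period in the source contributes a single `f`, and its image makes `N` turns, which
contribute `f^N`. The two match because the isotopy supplies `f^k` at the lower end and `N = k + 1`.
-/
theorem H_eq_of_Φ_eq_aux {p q : P × ℝ} (hp : 3 * I.N * p.2 ≤ 1) (hq : 2 ≤ 3 * I.N * q.2)
    (hpq : q.2 = p.2 + 1) (h : D.Φ p = D.Φ q) : I.H p = I.H q := by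
  obtain ⟨x, s⟩ := p
  obtain ⟨y, t⟩ := q
  simp only at hpq hp hq
  subst hpq
  rw [D.Φ_add_one] at h
  obtain rfl := D.Φ_inj _ _ _ h
  have e : (I.N : ℝ) * (s + 1) = I.N * s + I.N := by ring
  simp only [H, I.g_of_le hp, I.g_of_ge hq]
  rw [e, D.Φ_add_nat, N, Function.iterate_succ_apply]

/-- The bound describes the open strip `-1/(3N) < t < 1 + 1/(3N)`. Two representatives in it differ
by at most one period, and if by one, they lie where the isotopy is stationary. An open strip around
`[0, 1)` gives continuity across `t = 0`. -/
theorem H_eq_of_Φ_eq {p q : P × ℝ} (hp : |3 * I.N * p.2 - 3 / 2 * I.N| < 3 / 2 * I.N + 1)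
    (hq : |3 * I.N * q.2 - 3 / 2 * I.N| < 3 / 2 * I.N + 1) (h : D.Φ p = D.Φ q) :
    I.H p = I.H q := by
  have hN := I.one_le_N
  obtain ⟨m, hm⟩ := D.exists_int_of_Φ_eq h
  rw [abs_lt] at hp hq
  have hm1 : -2 < m ∧ m < 2 := by
    have e : 3 * I.N * p.2 = 3 * I.N * q.2 + 3 * I.N * m := by rw [hm]; ring
    constructor
    · by_contra! hlt
      have : (m : ℝ) ≤ -2 := by exact_mod_cast hlt
      have : (I.N : ℝ) * m ≤ I.N * (-2) := mul_le_mul_of_nonneg_left this I.N_pos.le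
      linarith
    · by_contra! hlt
      have : (2 : ℝ) ≤ m := by exact_mod_cast hlt
      have : (I.N : ℝ) * 2 ≤ I.N * m := mul_le_mul_of_nonneg_left this I.N_pos.le
      linarith
  have hcases : m = -1 ∨ m = 0 ∨ m = 1 := by omega
  rcases hcases with rfl | rfl | rfl
  · push_cast at hm
    have e : 3 * I.N * q.2 = 3 * I.N * p.2 + 3 * I.N := by rw [hm]; ring
    exact I.H_eq_of_Φ_eq_aux (by linarith) (by linarith) (by linarith) h
  · obtain ⟨x, s⟩ := p
    obtain ⟨y, t⟩ := q
    simp only [Int.cast_zero, add_zero] at hm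
    subst hm
    rw [D.Φ_inj _ _ _ h]
  · push_cast at hm
    have e : 3 * I.N * p.2 = 3 * I.N * q.2 + 3 * I.N := by rw [hm]; ring
    exact (I.H_eq_of_Φ_eq_aux (by linarith) (by linarith) (by linarith) h.symm).symm

open Classical in
/-- The self-map of the open book. -/
noncomputable def selfMap (y : M) : M :=
  if h : y ∈ D.binding then y else I.H (D.exists_rep h).choose

theorem selfMap_of_mem {y : M} (hy : y ∈ D.binding) : I.selfMap y = y := by
  simp [selfMap, hy]

theorem strip_of_mem_Ico {t : ℝ} (h₀ : 0 ≤ t) (h₁ : t < 1) :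
    |3 * I.N * t - 3 / 2 * I.N| < 3 / 2 * I.N + 1 := by
  have hN := I.N_pos
  have := mul_nonneg hN.le h₀
  have := mul_lt_mul_of_pos_left h₁ hN
  rw [abs_lt]
  constructor <;> linarith

theorem selfMap_Φ {q : P × ℝ} (hq : |3 * I.N * q.2 - 3 / 2 * I.N| < 3 / 2 * I.N + 1) :
    I.selfMap (D.Φ q) = I.H q := by
  have h := D.Φ_notMem q
  rw [selfMap, dif_neg h]
  obtain ⟨h₁, h₂, h₃⟩ := (D.exists_rep h).choose_spec
  exact I.H_eq_of_Φ_eq (I.strip_of_mem_Ico h₂ h₃) hq h₁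

/-- The self-map of the disc corresponding to the self-map of the open book. -/
noncomputable def discMap (N : ℕ) (z : ℂ) : ℂ := ‖z‖ * (z / ‖z‖) ^ N

theorem continuousAt_discMap (N : ℕ) : ContinuousAt (discMap N) 0 := by
  have h0 : discMap N 0 = 0 := by simp [discMap]
  rw [ContinuousAt, h0]
  refine squeeze_zero_norm (a := fun z : ℂ => ‖z‖) (fun z => ?_) (by
    simpa using (continuous_norm (E := ℂ)).tendsto 0)
  rcases eq_or_ne z 0 with rfl | hz
  · simp [discMap]
  · have : ‖z‖ ≠ 0 := norm_ne_zero_iff.2 hz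
    simp [discMap, norm_pow, this]

/-- Outside the trace of the support of the isotopy only time is multiplied by `N`, and near the
binding time is the angle in the tube. -/
theorem selfMap_tube {b : B} {z : ℂ} (hz : ‖z‖ < D.ε)
    (hK : D.tube (b, z) ∉ D.Φ '' (I.K ×ˢ Set.Icc 0 1)) :
    I.selfMap (D.tube (b, z)) = D.tube (b, discMap I.N z) := by
  rcases eq_or_ne z 0 with rfl | hz0
  · rw [I.selfMap_of_mem ⟨b, rfl⟩]
    simp [discMap]
  have hz1 : ‖z‖ < 1 := hz.trans_le D.ε_le
  have hr : 0 < ‖z‖ := norm_pos_iff.2 hz0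
  have hrn : ‖((‖z‖ : ℝ) : ℂ)‖ = ‖z‖ := by simp
  obtain ⟨⟨x, s⟩, hxs, hs0, hs1⟩ := D.exists_rep (D.tube_notMem (b := b) hz1 hz0)
  obtain ⟨⟨x', s'⟩, hx', -, -⟩ := D.exists_rep (D.tube_notMem (b := b) (z := (‖z‖ : ℝ))
    (by rwa [hrn]) (by exact_mod_cast hr.ne'))
  simp only at hs0 hs1
  have hθ : (Circle.exp (2 * Real.pi * s) : ℂ) = z / ‖z‖ := by
    rw [← D.θ_Φ x s, hxs, D.θ_tube b z hz1 hz0]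
  have hθ' : Circle.exp (2 * Real.pi * s') = Circle.exp (2 * Real.pi * 0) := by
    rw [← D.θ_Φ x' s', hx']
    ext
    rw [D.θ_tube b _ (by rwa [hrn]) (by exact_mod_cast hr.ne'), hrn]
    simp [hz0]
  -- The point `(b, ‖z‖)` lies on the page over `1`, so its time is an integer and can be shifted to
  -- `0`, where `Φ_tube` applies. Rotating it by the angle of `z` identifies its page coordinate
  -- with that of `z`.
  obtain ⟨m, hm⟩ := circle_exp_eq_iff.1 hθ'
  obtain ⟨x'', hx''⟩ := D.exists_Φ_add_int (-m) x' s'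
  rw [hx', hm, zero_add, Int.cast_neg, add_neg_cancel] at hx''
  have hrot := D.Φ_tube x'' b ‖z‖ hr hz hx''.symm
  have hxx : x'' = x := by
    refine D.Φ_inj _ _ s ?_
    rw [hxs, hrot, hθ]
    have hrC : ((‖z‖ : ℝ) : ℂ) ≠ 0 := by exact_mod_cast hr.ne'
    rw [mul_div_cancel₀ _ hrC]
  subst hxx
  have hxK : x'' ∉ I.K := fun hx => hK ⟨(x'', s), ⟨hx, hs0, hs1.le⟩, hxs⟩
  rw [← hxs, I.selfMap_Φ (I.strip_of_mem_Ico hs0 hs1), H, I.g_of_notMem _ hxK, hrot]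
  have e : 2 * Real.pi * (I.N * s) = I.N * (2 * Real.pi * s) := by ring
  rw [e, Circle.exp_natCast_mul, Circle.coe_pow, hθ, discMap]

/-- At the binding, the trace of the compact support is closed and misses the binding, so the tube
formula holds nearby and `discMap` is continuous at `0`. Elsewhere `Φ` is a local homeomorphism and
the map lifts to `H`. -/
theorem continuous_selfMap [T2Space M] : Continuous I.selfMap := by
  rw [continuous_iff_continuousAt]
  intro y
  by_cases hy : y ∈ D.binding
  · obtain ⟨b, rfl⟩ := hy
    have hcomp : IsCompact (D.Φ '' (I.K ×ˢ Set.Icc 0 1)) :=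
      (I.isCompact_K.prod isCompact_Icc).image D.isLocalHomeomorph_Φ.continuous
    have hev : ∀ᶠ q in 𝓝 ((b, 0) : B × ℂ), I.selfMap (D.tube q) = D.tube (q.1, discMap I.N q.2) := by
      have h₁ : ∀ᶠ q in 𝓝 ((b, 0) : B × ℂ), D.tube q ∉ D.Φ '' (I.K ×ˢ Set.Icc 0 1) := by
        rw [← eventually_map (P := fun y => y ∉ D.Φ '' (I.K ×ˢ Set.Icc 0 1)), D.map_nhds_tube]
        refine hcomp.isClosed.isOpen_compl.mem_nhds ?_
        rintro ⟨q, -, hq⟩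
        exact D.Φ_notMem q ⟨b, hq.symm⟩
      have h₂ : ∀ᶠ q in 𝓝 ((b, 0) : B × ℂ), ‖q.2‖ < D.ε := by
        refine (isOpen_lt (by fun_prop) continuous_const).mem_nhds ?_
        simpa using D.ε_pos
      filter_upwards [h₁, h₂] with q hq₁ hq₂
      exact I.selfMap_tube hq₂ hq₁
    have h0 : D.tube (b, 0) = I.selfMap (D.tube (b, 0)) := (I.selfMap_of_mem ⟨b, rfl⟩).symm
    rw [ContinuousAt]
    nth_rewrite 1 [← D.map_nhds_tube]
    rw [tendsto_map'_iff]
    refine (tendsto_congr' hev).2 ?_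
    change Tendsto _ _ (𝓝 (I.selfMap (D.tube (b, 0))))
    rw [← h0]
    have h1 : Tendsto (fun q : B × ℂ => (q.1, discMap I.N q.2)) (𝓝 (b, 0)) (𝓝 (b, 0)) := by
      have := (continuousAt_discMap I.N).tendsto
      rw [show discMap I.N 0 = 0 by simp [discMap]] at this
      rw [nhds_prod_eq]
      exact tendsto_id.prodMap this
    have h2 : Tendsto D.tube (𝓝 (b, 0)) (𝓝 (D.tube (b, 0))) := (D.map_nhds_tube b).le
    exact h2.comp h1
  · obtain ⟨q, rfl, h₀, h₁⟩ := D.exists_rep hy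
    rw [ContinuousAt, ← D.isLocalHomeomorph_Φ.map_nhds_eq q, tendsto_map'_iff,
      I.selfMap_Φ (I.strip_of_mem_Ico h₀ h₁)]
    have hev : ∀ᶠ p in 𝓝 q, I.selfMap (D.Φ p) = I.H p := by
      have : ∀ᶠ p : P × ℝ in 𝓝 q, |3 * (I.N : ℝ) * p.2 - 3 / 2 * I.N| < 3 / 2 * I.N + 1 :=
        (isOpen_lt (f := fun p : P × ℝ => |3 * (I.N : ℝ) * p.2 - 3 / 2 * I.N|) (by fun_prop)
          continuous_const).mem_nhds (I.strip_of_mem_Ico h₀ h₁)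
      filter_upwards [this] with p hp
      exact I.selfMap_Φ hp
    exact (tendsto_congr' hev).2 I.continuous_H.continuousAt

/-! ### The preimages of a point of the page -/

/-- The number of turns of the self-map at the `j`-th preimage. -/
def turns (j : Fin I.N) : ℕ := if (j : ℕ) = 0 then I.k else j

/-- In these windows the isotopy is stationary, so the page coordinate does not move. For `j = 0`
the power `f^k` is absorbed as `k` extra turns of time. -/
theorem selfMap_Φ_near (j : Fin I.N) (x : P) {s : ℝ} (hs : |3 * I.N * s| < 1) :
    I.selfMap (D.Φ (x, (j : ℝ) / I.N + s)) = D.Φ (x, I.turns j + I.N * s) := by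
  have hN := I.N_pos
  have e : I.N * ((j : ℝ) / I.N + s) = j + I.N * s := by field_simp
  have hj : (j : ℝ) + 1 ≤ I.N := by exact_mod_cast j.2
  rw [abs_lt] at hs
  have hj0 : (0 : ℝ) ≤ j := Nat.cast_nonneg _
  rw [I.selfMap_Φ (by rw [abs_lt, mul_assoc, e]; constructor <;> linarith), H]
  simp only [e]
  by_cases h : (j : ℕ) = 0
  · have hj' : ((j : ℕ) : ℝ) = 0 := by exact_mod_cast h
    rw [I.g_of_le (by rw [mul_assoc, e, hj']; linarith), turns, if_pos h, hj', zero_add,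
      add_comm (I.k : ℝ), D.Φ_add_nat]
  · have hj1 : (1 : ℝ) ≤ j := by exact_mod_cast Nat.one_le_iff_ne_zero.2 h
    rw [I.g_of_ge (by rw [mul_assoc, e]; linarith), turns, if_neg h]

/-- The page coordinate of the `j`-th preimage of `Φ (p, 0)`. -/
def preimageCoord (p : P) (j : Fin I.N) : P := D.f.symm^[I.turns j] p

/-- The `j`-th preimage of `Φ (p, 0)` under the self-map. -/
noncomputable def preimagePoint (p : P) (j : Fin I.N) : M :=
  D.Φ (I.preimageCoord p j, (j : ℝ) / I.N)

theorem iterate_preimageCoord (p : P) (j : Fin I.N) :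
    D.f^[I.turns j] (I.preimageCoord p j) = p :=
  (Function.LeftInverse.iterate D.f.right_inv _) p

theorem Φ_preimageCoord (p : P) (j : Fin I.N) :
    D.Φ (I.preimageCoord p j, I.turns j) = D.Φ (p, 0) := by
  have := D.Φ_add_nat (I.turns j) (I.preimageCoord p j) 0
  rwa [zero_add, I.iterate_preimageCoord] at this

/-- Binding points are fixed, hence excluded. A representative with time `s` in `[0, 1)` must have
`N s` an integer `j < N`, and then injectivity of `Φ` on a page determines the page coordinate. -/
theorem mem_range_preimagePoint {p : P} {z : M} (hz : I.selfMap z = D.Φ (p, 0)) :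
    z ∈ Set.range (I.preimagePoint p) := by
  have hN := I.N_pos
  by_cases hzB : z ∈ D.binding
  · rw [I.selfMap_of_mem hzB] at hz
    exact absurd (hz ▸ hzB) (D.Φ_notMem _)
  obtain ⟨⟨x, s⟩, rfl, h₀, h₁⟩ := D.exists_rep hzB
  simp only at h₀ h₁
  have hz' := hz
  rw [I.selfMap_Φ (I.strip_of_mem_Ico h₀ h₁), H] at hz
  obtain ⟨m, hm⟩ := D.exists_int_of_Φ_eq hz
  simp only [zero_add] at hm
  have hm0 : 0 ≤ m := by
    have : (0 : ℝ) ≤ m := hm ▸ mul_nonneg hN.le h₀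
    exact_mod_cast this
  obtain ⟨j, rfl⟩ := Int.eq_ofNat_of_zero_le hm0
  simp only [Int.cast_natCast] at hm
  have hj : j < I.N := by
    have : (j : ℝ) < I.N := by
      rw [← hm]
      calc I.N * s < I.N * 1 := mul_lt_mul_of_pos_left h₁ hN
        _ = I.N := mul_one _
    exact_mod_cast this
  have hs : s = ((⟨j, hj⟩ : Fin I.N) : ℕ) / I.N + 0 := by
    rw [add_zero, ← hm]
    field_simp
  refine ⟨⟨j, hj⟩, ?_⟩
  rw [hs, I.selfMap_Φ_near _ _ (by simp), mul_zero, add_zero] at hz'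
  have hx : x = I.preimageCoord p ⟨j, hj⟩ :=
    D.Φ_inj _ _ _ (hz'.trans (I.Φ_preimageCoord p _).symm)
  rw [preimagePoint, hs, add_zero, ← hx]

/-- The window around `j / N` contains no other `i / N` modulo `1`. Hence a simplex inside one strip
avoids the remaining preimages, as the degree formula requires. -/
theorem eq_of_preimagePoint_mem {p : P} {i j : Fin I.N} {x : P} {s : ℝ} (hs : |3 * I.N * s| < 1)
    (h : I.preimagePoint p i = D.Φ (x, (j : ℝ) / I.N + s)) : i = j := by
  have hN := I.N_pos
  obtain ⟨m, hm⟩ := D.exists_int_of_Φ_eq h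
  simp only at hm
  have e : (i : ℝ) = j + I.N * s + I.N * m := by
    field_simp at hm
    linarith
  have e' : I.N * s = (((i : ℤ) - j - I.N * m : ℤ) : ℝ) := by
    push_cast
    linarith
  have hs0 := int_eq_zero_of_abs_lt e' (by
    rw [abs_lt] at hs ⊢
    constructor <;> linarith)
  rw [hs0, add_zero] at e
  have e'' : (i : ℤ) = j + I.N * m := by exact_mod_cast e
  have hi := i.2
  have hj := j.2
  have hm0 : m = 0 := by
    have hNZ : (0 : ℤ) < I.N := by exact_mod_cast hN
    by_contra hm0
    rcases lt_or_gt_of_ne hm0 with h | h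
    · have : (I.N : ℤ) * m ≤ I.N * (-1) := mul_le_mul_of_nonneg_left (by omega) hNZ.le
      omega
    · have : (I.N : ℤ) * 1 ≤ I.N * m := mul_le_mul_of_nonneg_left (by omega) hNZ.le
      omega
  rw [hm0] at e''
  exact Fin.ext (by omega)

end Isotopy

end TopologicalOpenBook

/-! ### The degree of the self-map -/

namespace TopologicalOpenBook.Isotopy

variable {k : ℕ} {M B P : Type*} [TopologicalSpace M]
  [TopologicalSpace B] [TopologicalSpace P] {D : TopologicalOpenBook M B P} (I : D.Isotopy)

/-- The parametrization of a neighbourhood of the page through the `j`-th preimages. -/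
noncomputable def strip (j : Fin I.N) (q : {q : P × ℝ // |3 * I.N * q.2| < 1}) : M :=
  D.Φ (q.1.1, (j : ℝ) / I.N + q.1.2)

theorem isOpenEmbedding_strip (j : Fin I.N) : IsOpenEmbedding (I.strip j) := by
  have hN := I.one_le_N
  have hopen : IsOpen {q : P × ℝ | |3 * (I.N : ℝ) * q.2| < 1} :=
    isOpen_lt (by fun_prop) continuous_const
  have hloc : IsLocalHomeomorph (I.strip j) :=
    (D.isLocalHomeomorph_Φ.comp ((Homeomorph.refl P).prodCongr
      (Homeomorph.addLeft ((j : ℝ) / I.N))).isLocalHomeomorph).comp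
      hopen.isOpenEmbedding_subtypeVal.isLocalHomeomorph
  refine hloc.isOpenEmbedding_of_injective ?_
  rintro ⟨⟨x, s⟩, hs⟩ ⟨⟨y, t⟩, ht⟩ h
  obtain ⟨m, hm⟩ := D.exists_int_of_Φ_eq h
  simp only at hm hs ht
  have hm' : s - t = m := by linarith
  have hst := int_eq_zero_of_abs_lt hm' (by
    rw [mul_assoc, abs_mul, abs_mul, Nat.abs_cast, abs_of_pos (by norm_num : (0 : ℝ) < 3)] at hs ht
    have h₁ : |s| ≤ I.N * |s| := le_mul_of_one_le_left (abs_nonneg _) hN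
    have h₂ : |t| ≤ I.N * |t| := le_mul_of_one_le_left (abs_nonneg _) hN
    have := abs_sub s t
    linarith)
  obtain rfl : s = t := by linarith
  obtain rfl : x = y := D.Φ_inj _ _ _ h
  rfl

variable [T2Space M] [ChartedSpace (EuclideanSpace ℝ (Fin (k + 1))) M]
  {o : SmoothOrientation (k + 1) M}

/-- The self-map as a continuous map. -/
noncomputable def selfMapC : C(M, M) := ⟨I.selfMap, I.continuous_selfMap⟩

/-- In the coordinates of `Φ` the simplex has time `j / N + s` and its image has time `turns j + N
s`, with the same page coordinate. Interpolating the times moves the simplex and its central point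
together, so orientation is preserved without any derivative of `Φ`. -/
theorem isPositiveAt_selfMap_comp (p : P) (j : Fin I.N) {τ : SingularSimplex (k + 1) M}
    (hτ : o.IsPositiveSimplexAt (I.preimagePoint p j) τ) (hr : Set.range τ ⊆ Set.range (I.strip j)) :
    o.IsPositiveAt (D.Φ (p, 0)) (Finsupp.single (I.selfMapC.comp τ) 1) := by
  have hN := I.one_le_N
  have hemb := (I.isOpenEmbedding_strip j).isEmbedding
  let q : stdSimplex ℝ (Fin (k + 2)) → {q : P × ℝ // |3 * I.N * q.2| < 1} := fun t =>
    hemb.toHomeomorph.symm ⟨τ t, hr ⟨t, rfl⟩⟩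
  have hq : Continuous q :=
    hemb.toHomeomorph.symm.continuous.comp (τ.continuous.subtype_mk _)
  have hqτ : ∀ t, D.Φ ((q t).1.1, (j : ℝ) / I.N + (q t).1.2) = τ t := fun t =>
    congrArg Subtype.val (hemb.toHomeomorph.apply_symm_apply ⟨τ t, hr ⟨t, rfl⟩⟩)
  have hΦ := D.isLocalHomeomorph_Φ.continuous
  obtain ⟨t₀, ht₀, hcenter⟩ := hτ.exists_center
  have hx₁ : D.Φ (I.preimageCoord p j, (1 - ((1 : unitInterval) : ℝ)) * (j / I.N) +
      ((1 : unitInterval) : ℝ) * I.turns j) = D.Φ (p, 0) := by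
    rw [← I.Φ_preimageCoord p j]
    simp
  rw [← hx₁]
  refine SmoothOrientation.isPositiveAt_of_homotopy (σ := τ)
    (fun r => D.Φ ((q r.1).1.1, (1 - (r.2 : ℝ)) * (j / I.N + (q r.1).1.2) +
      r.2 * (I.turns j + I.N * (q r.1).1.2))) (hΦ.comp (by fun_prop))
    (fun u => D.Φ (I.preimageCoord p j, (1 - (u : ℝ)) * (j / I.N) + u * I.turns j))
    (hΦ.comp (by fun_prop)) (fun t u h => ?_) (fun t => ?_) (fun t => ?_) ?_
  · obtain ⟨m, hm⟩ := D.exists_int_of_Φ_eq h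
    simp only at hm h
    have hs := (q t).2
    have hu₀ := u.2.1
    have hu₁ := u.2.2
    -- If the simplex meets the moving point, the stretched time displacement is an integer. The
    -- stretching factor lies between `1` and `N`, and `N |s| < 1/3`, so `s = 0` and the meeting is
    -- at the centre.
    have hm' : (1 - (u : ℝ) + u * I.N) * (q t).1.2 = m := by linarith
    have hc : 1 ≤ 1 - (u : ℝ) + u * I.N := by nlinarith
    have hcN : 1 - (u : ℝ) + u * I.N ≤ I.N := by nlinarith
    have h0 := int_eq_zero_of_abs_lt hm' (by
      rw [mul_assoc, abs_mul, abs_mul, Nat.abs_cast,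
        abs_of_pos (by norm_num : (0 : ℝ) < 3)] at hs
      rw [abs_mul, abs_of_nonneg (by linarith)]
      have := mul_le_mul_of_nonneg_right hcN (abs_nonneg (q t).1.2)
      have := mul_nonneg I.N_pos.le (abs_nonneg (q t).1.2)
      linarith)
    have hs0 : (q t).1.2 = 0 := (mul_eq_zero.1 h0).resolve_left (by linarith)
    rw [hs0, mul_zero, add_zero, add_zero] at h
    have hx := D.Φ_inj _ _ _ h
    have : τ t = I.preimagePoint p j := by
      rw [← hqτ t, hs0, add_zero, hx, preimagePoint]
    rw [(hcenter t).1 this]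
    exact ht₀
  · simp [hqτ]
  · change _ = I.selfMap (τ t)
    rw [← hqτ t, I.selfMap_Φ_near j _ (q t).2]
    simp
  · simpa [preimagePoint] using hτ.isPositiveAt

theorem isPositiveAt_Φ (p : P) {c : RealSingularChain (k + 1) M} (hc : ∀ x, o.IsPositiveAt x c) :
    o.IsPositiveAt (D.Φ (p, 0)) ((I.N : ℝ)⁻¹ • push I.selfMapC c) := by
  have hmem : ∀ j, I.preimagePoint p j ∈ Set.range (I.strip j) := fun j =>
    ⟨⟨(I.preimageCoord p j, 0), by simp⟩, by simp [strip, preimagePoint]⟩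
  choose e he τ K hK hKc hKe hconv hr hτ using fun j =>
    o.exists_local_model (I.preimagePoint p j)
      ((I.isOpenEmbedding_strip j).isOpen_range.mem_nhds (hmem j))
  have hτ' := fun j => hτ j _ (mem_of_mem_nhds (hK j))
  refine SmoothOrientation.isPositiveAt_push (Nat.succ_ne_zero I.k)
    (fun z hz => I.mem_range_preimagePoint hz) hτ' (fun j i hij hmem => hij ?_)
    (fun j => I.isPositiveAt_selfMap_comp p j (hτ' j) (hr j)) hc
  obtain ⟨⟨⟨x, s⟩, hs⟩, hq⟩ := hr j hmem
  exact I.eq_of_preimagePoint_mem hs hq.symm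

/-- Every point off the binding lies on a line `t ↦ Φ (p, t)` that meets the page at time `0`, and
every binding point is a limit of points off the binding. Local constancy for cycles concludes,
without connectedness of `M`. -/
theorem isPositiveAt_of_forall_Φ {c : RealSingularChain (k + 1) M} (hc : boundary c = 0)
    (h : ∀ p, o.IsPositiveAt (D.Φ (p, 0)) c) (y : M) : o.IsPositiveAt y c := by
  have key : ∀ y ∉ D.binding, o.IsPositiveAt y c := by
    intro y hy
    obtain ⟨⟨p, t⟩, rfl, -⟩ := D.exists_rep hy
    refine (iff_of_eventually_iff (p := fun s : ℝ => o.IsPositiveAt (D.Φ (p, s)) c) (fun s => ?_)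
      0 t).1 (h p)
    have hΦ : Continuous fun s : ℝ => D.Φ (p, s) :=
      D.isLocalHomeomorph_Φ.continuous.comp (by fun_prop)
    exact (hΦ.tendsto s).eventually (SmoothOrientation.eventually_isPositiveAt_iff hc (D.Φ (p, s)))
  by_cases hy : y ∈ D.binding
  · obtain ⟨b, rfl⟩ := hy
    have h₁ := SmoothOrientation.eventually_isPositiveAt_iff (o := o) hc (D.tube (b, 0))
    rw [← D.map_nhds_tube b, eventually_map] at h₁
    have h₂ : Tendsto (fun z : ℂ => (b, z)) (𝓝 0) (𝓝 (b, 0)) :=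
      (by fun_prop : Continuous fun z : ℂ => (b, z)).tendsto 0
    have h₃ : ∀ᶠ z : ℂ in 𝓝[≠] 0, (o.IsPositiveAt (D.tube (b, z)) c ↔
        o.IsPositiveAt (D.tube (b, 0)) c) := (h₂.eventually h₁).filter_mono nhdsWithin_le_nhds
    have h₄ : ∀ᶠ z : ℂ in 𝓝[≠] 0, ‖z‖ < 1 := by
      refine Filter.Eventually.filter_mono nhdsWithin_le_nhds ?_
      filter_upwards [Metric.ball_mem_nhds (0 : ℂ) one_pos] with z hz
      simpa using hz
    obtain ⟨z, hz, hz1, hz0⟩ := (h₃.and (h₄.and self_mem_nhdsWithin)).exists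
    exact hz.1 (key _ (D.tube_notMem hz1 hz0))
  · exact key y hy

theorem isFundamentalCycle_push {c : RealSingularChain (k + 1) M} (hc : o.IsFundamentalCycle c) :
    o.IsFundamentalCycle ((I.N : ℝ)⁻¹ • push I.selfMapC c) := by
  have hcyc : boundary ((I.N : ℝ)⁻¹ • push I.selfMapC c) = 0 := by
    rw [map_smul, ← push_boundary, show boundary c = 0 from hc.1, map_zero, smul_zero]
  exact ⟨hcyc, fun y => isPositiveAt_of_forall_Φ hcyc (fun p => I.isPositiveAt_Φ p hc.2) y⟩

end TopologicalOpenBook.Isotopy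

/-! ### Norm estimates and the limit argument. -/

namespace RealSingularChain

variable {k : ℕ} {X Y : Type*} [TopologicalSpace X] [TopologicalSpace Y]

theorem sum_abs_add_le (c d : RealSingularChain k X) :
    ((c + d).sum fun _ a => |a|) ≤ (c.sum fun _ a => |a|) + d.sum fun _ a => |a| := by
  classical
  rw [Finsupp.sum_of_support_subset _ Finsupp.support_add _ (by simp),
    Finsupp.sum_of_support_subset c Finset.subset_union_left _ (by simp),
    Finsupp.sum_of_support_subset d Finset.subset_union_right _ (by simp),
    ← Finset.sum_add_distrib]
  exact Finset.sum_le_sum fun σ _ => abs_add_le _ _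

theorem sum_abs_push_le (g : C(X, Y)) (c : RealSingularChain k X) :
    ((push g c).sum fun _ a => |a|) ≤ c.sum fun _ a => |a| := by
  classical
  induction c using Finsupp.induction with
  | zero => simp
  | single_add σ r c hσ _ ih =>
    have hdisj : Disjoint (Finsupp.single σ r).support c.support :=
      Finset.disjoint_of_subset_left Finsupp.support_single_subset
        (Finset.disjoint_singleton_left.2 hσ)
    rw [map_add, push_single, Finsupp.sum_add_index_of_disjoint hdisj]
    refine (sum_abs_add_le _ _).trans (add_le_add ?_ ih)
    rw [Finsupp.sum_single_index abs_zero, Finsupp.sum_single_index abs_zero]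

theorem l1Norm_smul_push_le {a : ℝ} (ha : 0 ≤ a) (g : C(X, Y)) (c : RealSingularChain k X) :
    (a • push g c).l1Norm ≤ ENNReal.ofReal a * c.l1Norm := by
  rw [l1Norm, l1Norm, ← ENNReal.ofReal_mul ha]
  refine ENNReal.ofReal_le_ofReal ?_
  rw [Finsupp.sum_smul_index fun _ => abs_zero]
  simp only [abs_mul, abs_of_nonneg ha]
  rw [← Finsupp.mul_sum]
  exact mul_le_mul_of_nonneg_left (sum_abs_push_le g c) ha

end RealSingularChain

/-- Pushing forward and dividing by `N` is iterated, starting from one fundamental cycle; `k > 0`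
gives `N ≥ 2`. Existence of that cycle is essential, as otherwise the infimum would be `∞`. -/
theorem TopologicalOpenBook.Isotopy.simplicialVolume_eq_zero {k : ℕ} {M B P : Type*}
    [TopologicalSpace M] [T2Space M] [CompactSpace M]
    [ChartedSpace (EuclideanSpace ℝ (Fin (k + 1))) M] (o : SmoothOrientation (k + 1) M)
    [TopologicalSpace B] [TopologicalSpace P] {D : TopologicalOpenBook M B P} (I : D.Isotopy) :
    simplicialVolume o = 0 := by
  obtain ⟨c₀, hc₀⟩ := o.exists_isFundamentalCycle
  have hle : ∀ c : RealSingularChain (k + 1) M, o.IsFundamentalCycle c →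
      simplicialVolume o ≤ c.l1Norm := fun c hc => iInf₂_le c hc
  have hfin : simplicialVolume o ≠ ⊤ := ne_top_of_le_ne_top ENNReal.ofReal_ne_top (hle c₀ hc₀)
  have key : ∀ m : ℕ, ∃ c, o.IsFundamentalCycle c ∧
      c.l1Norm ≤ ENNReal.ofReal (I.N : ℝ)⁻¹ ^ m * c₀.l1Norm := by
    intro m
    induction m with
    | zero => exact ⟨c₀, hc₀, by simp⟩
    | succ m ih =>
      obtain ⟨c, hc, hm⟩ := ih
      refine ⟨_, I.isFundamentalCycle_push hc,
        (l1Norm_smul_push_le (inv_nonneg.2 I.N_pos.le) _ c).trans ?_⟩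
      rw [pow_succ', mul_assoc]
      gcongr
  have hlt : ENNReal.ofReal (I.N : ℝ)⁻¹ < 1 := by
    rw [ENNReal.ofReal_lt_one]
    refine inv_lt_one_of_one_lt₀ ?_
    exact_mod_cast Nat.lt_succ_of_le I.k_pos
  have hlim : Tendsto (fun m : ℕ => ENNReal.ofReal (I.N : ℝ)⁻¹ ^ m * c₀.l1Norm) atTop (𝓝 0) := by
    have := ENNReal.Tendsto.mul_const (ENNReal.tendsto_pow_atTop_nhds_zero_of_lt_one hlt)
      (Or.inr (show c₀.l1Norm ≠ ⊤ from ENNReal.ofReal_ne_top))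
    rwa [zero_mul] at this
  refine le_antisymm (ge_of_tendsto' hlim fun m => ?_) bot_le
  obtain ⟨c, hc, hm⟩ := key m
  exact (hle c hc).trans hm

/-! ## The simplicial volume of open books -/

/-- A discrete space with an open book is empty. -/
theorem TopologicalOpenBook.isEmpty_of_discreteTopology {M B P : Type*} [TopologicalSpace M]
    [DiscreteTopology M] [TopologicalSpace B] [TopologicalSpace P] (D : TopologicalOpenBook M B P) :
    IsEmpty M := by
  refine ⟨fun y => ?_⟩
  by_cases hy : y ∈ D.binding
  · obtain ⟨b, -⟩ := hy
    have h₁ : ∀ᶠ q in 𝓝 ((b, 0) : B × ℂ), D.tube q = D.tube (b, 0) := by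
      rw [← eventually_map (P := fun y => y = D.tube (b, 0)), D.map_nhds_tube]
      simp
    have h₂ : Tendsto (fun z : ℂ => (b, z)) (𝓝 0) (𝓝 (b, 0)) :=
      (by fun_prop : Continuous fun z : ℂ => (b, z)).tendsto 0
    have h₃ : ∀ᶠ z : ℂ in 𝓝[≠] 0, D.tube (b, z) = D.tube (b, 0) :=
      (h₂.eventually h₁).filter_mono nhdsWithin_le_nhds
    have h₄ : ∀ᶠ z : ℂ in 𝓝[≠] 0, ‖z‖ < 1 := by
      refine Filter.Eventually.filter_mono nhdsWithin_le_nhds ?_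
      filter_upwards [Metric.ball_mem_nhds (0 : ℂ) one_pos] with z hz
      simpa using hz
    obtain ⟨z, hz, hz1, hz0⟩ := (h₃.and (h₄.and self_mem_nhdsWithin)).exists
    exact D.tube_notMem hz1 hz0 ⟨b, hz.symm⟩
  · obtain ⟨⟨x, -⟩, -⟩ := D.exists_rep hy
    have hΦ : Continuous fun t : ℝ => D.Φ (x, t) :=
      D.isLocalHomeomorph_Φ.continuous.comp (by fun_prop)
    -- A line of `Φ` in a discrete space is constant, whereas the times `1/2` and `0` have different
    -- values of `θ`.
    obtain ⟨m, hm⟩ := D.exists_int_of_Φ_eq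
      (PreconnectedSpace.constant inferInstance hΦ (x := 1 / 2) (y := 0))
    simp only [zero_add] at hm
    have := int_eq_zero_of_abs_lt hm (by norm_num [abs_lt])
    norm_num at this

/-- The zero chain is vacuously a fundamental cycle. -/
theorem simplicialVolume_of_isEmpty {n : ℕ} {M : Type*} [TopologicalSpace M]
    [ChartedSpace (EuclideanSpace ℝ (Fin n)) M] [IsEmpty M] (o : SmoothOrientation n M) :
    simplicialVolume o = 0 := by
  refine le_antisymm (iInf₂_le_of_le 0 ⟨?_, isEmptyElim⟩ (by simp [l1Norm])) bot_le
  cases n with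
  | zero => trivial
  | succ n => exact map_zero boundary

section

variable {n : ℕ} {M B P : Type*}
    [TopologicalSpace M] [ChartedSpace (EuclideanSpace ℝ (Fin n)) M]
    [TopologicalSpace B] [ChartedSpace (EuclideanSpace ℝ (Fin (n - 2))) B]
    [TopologicalSpace P] [ChartedSpace (EuclideanSpace ℝ (Fin (n - 1))) P]

/-- The topological data of a smooth open book with a monodromy diffeomorphism. -/
theorem OpenBook.IsMonodromy.exists_topologicalOpenBook {ob : OpenBook n M B P}
    {f : P ≃ₘ^∞⟮𝓡 (n - 1), 𝓡 (n - 1)⟯ P} (hf : ob.IsMonodromy f) :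
    ∃ D : TopologicalOpenBook M B P, D.f = f.toEquiv := by
  obtain ⟨Φ, hΦ, hrange, hθ, hinj, hadd, ε, hε, hε1, hrot⟩ := hf
  exact ⟨{
    tube := ob.tube
    map_nhds_tube := fun b => ob.tube_isLocalDiffeomorphOn.isLocalHomeomorphOn.map_nhds_eq (by simp)
    tube_injOn := ob.tube_injOn
    θ := ob.θ
    θ_tube := ob.θ_tube
    f := f.toEquiv
    Φ := Φ
    isLocalHomeomorph_Φ := hΦ.isLocalHomeomorph
    range_Φ := hrange
    θ_Φ := hθ
    Φ_inj := hinj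
    Φ_add_one := hadd
    ε := ε
    ε_pos := hε
    ε_le := hε1
    Φ_tube := hrot }, rfl⟩

theorem HasFiniteOrderMappingClass.nonempty_isotopy {m : ℕ} [ChartedSpace (EuclideanSpace ℝ (Fin m)) P]
    {f : P ≃ₘ^∞⟮𝓡 m, 𝓡 m⟯ P} (h : HasFiniteOrderMappingClass f) (D : TopologicalOpenBook M B P)
    (hD : D.f = f.toEquiv) : Nonempty D.Isotopy := by
  obtain ⟨k, hk, F, hF, h₀, h₁, K, hK, hFK⟩ := h
  exact ⟨{
    k := k
    k_pos := hk
    F := fun t => F t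
    continuousOn_F := hF.continuousOn
    F_zero := h₀
    F_one := fun x => by rw [h₁, hD]; rfl
    K := K
    isCompact_K := hK
    F_eq := hFK }⟩

end

theorem proposition5p1 {n : ℕ} {M B P : Type*}
    [TopologicalSpace M] [T2Space M] [CompactSpace M]
    [ChartedSpace (EuclideanSpace ℝ (Fin n)) M] [IsManifold (𝓡 n) ∞ M]
    [TopologicalSpace B] [ChartedSpace (EuclideanSpace ℝ (Fin (n - 2))) B]
    [IsManifold (𝓡 (n - 2)) ∞ B]
    [TopologicalSpace P] [ChartedSpace (EuclideanSpace ℝ (Fin (n - 1))) P]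
    [IsManifold (𝓡 (n - 1)) ∞ P]
    (o : SmoothOrientation n M) (ob : OpenBook n M B P)
    (f : P ≃ₘ^∞⟮𝓡 (n - 1), 𝓡 (n - 1)⟯ P) (hf : ob.IsMonodromy f)
    (hfin : HasFiniteOrderMappingClass f) :
    simplicialVolume o = 0 := by
  obtain ⟨D, hD⟩ := hf.exists_topologicalOpenBook
  obtain ⟨I⟩ := hfin.nonempty_isotopy D hD
  cases n with
  | zero =>
    -- The chain argument needs positive dimension. In dimension `0` an open book exists only on the
    -- empty manifold.
    have := ChartedSpace.discreteTopology (EuclideanSpace ℝ (Fin 0)) M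
    have := D.isEmpty_of_discreteTopology
    exact simplicialVolume_of_isEmpty o
  | succ k => exact I.simplicialVolume_eq_zero o
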